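/- For $N\in\mathbb{N}$ let $h=1/(N+1)$ and write vectors of $\mathbb{C}^{2N+1}$ as $\mathbf F=(F_{j/2})_{1\le j\le 2N+1}$, with the convention $F_0=F_{N+1}=0$; integer indices are the nodal components and half-integer indices the midpoint components. Let $M_h$ and $S_h$ be the mass and stiffness matrices of the quadratic ($P_2$) finite element discretization of the wave equation on $(0,1)$ with homogeneous Dirichlet conditions on the uniform grid of size $h$, that is, the symmetric pentadiagonal $(2N+1)\times(2N+1)$ matrices whose only non-zero entries (rows and columns numbered $p,q=1,\dots,2N+1$) are $$(M_h)_{pp}=\tfrac{8h}{15}\ (p\text{ odd}),\quad (M_h)_{pp}=\tfrac{4h}{15}\ (p\text{ even}),\quad (M_h)_{pq}=\tfrac{h}{15}\ (|p-q|=1),\quad (M_h)_{pq}=-\tfrac{h}{30}\ (|p-q|=2,\ p,q\text{ even}),$$ $$(S_h)_{pp}=\tfrac{16}{3h}\ (p\text{ odd}),\quad (S_h)_{pp}=\tfrac{14}{3h}\ (p\text{ even}),\quad (S_h)_{pq}=-\tfrac{8}{3h}\ (|p-q|=1),\quad (S_h)_{pq}=\tfrac{1}{3h}\ (|p-q|=2,\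 p,q\text{ even}).$$ For $i\in\{0,1\}$ put $\|\mathbf F\|_{h,i}^2=\big((M_hS_h^{-1})^{1-i}S_h\mathbf F,\mathbf F\big)_{\mathbb{C}^{2N+1}}$, where $(\cdot,\cdot)_{\mathbb{C}^{2N+1}}$ is the Euclidean inner product, and let $$\mathcal E_h(\mathbf F,\mathbf G)=\tfrac12\big(\|\mathbf F\|_{h,1}^2+\|\mathbf G\|_{h,0}^2\big).$$ Let $B_h$ be the $(2N+1)\times(2N+1)$ matrix whose only non-zero entry is $-1/h$, in position $(2N+1,2N)$. For $N$ odd let $$\mathcal L_h=\{\mathbf F:\ F_{j+1/2}=\tfrac12(F_j+F_{j+1}),\ 0\le j\le N\},\qquad \mathcal B_h=\{\mathbf F:\ F_{2j+1}=\tfrac12(F_{2j}+F_{2j+2}),\ 0\le j\le (N-1)/2\},$$ and $\mathcal S_h=(\mathcal L_h\cap\mathcal B_h)\times(\mathcal L_h\cap\mathcal B_h)$. Theorem. For every $T>2$ there is a constant $C(T)>0$, depending only on $T$, such that for every odd $N\ge1$, with $h=1/(N+1)$, for all $(\mathbf U_h^0,\mathbf U_h^1)\in\mathcal S_h$, the solution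 $\mathbf U_h$ of the adjoint problem $$M_h\mathbf U_{h,tt}(t)+S_h\mathbf U_h(t)=0,\qquad \mathbf U_h(T)=\mathbf U_h^0,\quad \mathbf U_{h,t}(T)=\mathbf U_h^1,$$ satisfies $$\mathcal E_h(\mathbf U_h^0,\mathbf U_h^1)\le C(T)\int_0^T\|B_h\mathbf U_h(t)\|_{\mathbb{C}^{2N+1}}^2\,dt .$$ -/

import Mathlib

open scoped Matrix

noncomputable section

namespace QuadFEM

/-- The mesh size `h = 1 / (N + 1)`. -/
def meshSize (N : ℕ) : ℝ := 1 / ((N : ℝ) + 1)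

/-- Vectors `F = (F_{p/2})_{1 ≤ p ≤ 2N+1}` of nodal values (`p` even) and midpoint values (`p` odd).
The entry with index `i : Fin (2 * N + 1)` is the value at `p = i + 1`. -/
abbrev DiscreteVec (N : ℕ) : Type := Fin (2 * N + 1) → ℂ

/-- `halfVal N F p` is the value `F_{p/2}` at the point `p h / 2`, with the boundary convention
`F_0 = F_{N+1} = 0`. -/
def halfVal (N : ℕ) (F : DiscreteVec N) (p : ℕ) : ℂ :=
  if hp : 1 ≤ p ∧ p ≤ 2 * N + 1 then F ⟨p - 1, by omega⟩ else 0

/-- Entry `(p, q)` of the pentadiagonal mass matrix, `1 ≤ p, q ≤ 2N+1`. -/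
def massEntry (h : ℝ) (p q : ℕ) : ℝ :=
  if p = q then (if Odd p then 8 * h / 15 else 4 * h / 15)
  else if p + 1 = q ∨ q + 1 = p then h / 15
  else if (p + 2 = q ∨ q + 2 = p) ∧ Even p then -(h / 30)
  else 0

/-- Entry `(p, q)` of the pentadiagonal stiffness matrix, `1 ≤ p, q ≤ 2N+1`. -/
def stiffEntry (h : ℝ) (p q : ℕ) : ℝ :=
  if p = q then (if Odd p then 16 / (3 * h) else 14 / (3 * h))
  else if p + 1 = q ∨ q + 1 = p then -(8 / (3 * h))
  else if (p + 2 = q ∨ q + 2 = p) ∧ Even p then 1 / (3 * h)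
  else 0

/-- The mass matrix `M_h`. -/
def massMatrix (N : ℕ) : Matrix (Fin (2 * N + 1)) (Fin (2 * N + 1)) ℂ :=
  Matrix.of fun i j => (massEntry (meshSize N) (i.val + 1) (j.val + 1) : ℂ)

/-- The stiffness matrix `S_h`. -/
def stiffMatrix (N : ℕ) : Matrix (Fin (2 * N + 1)) (Fin (2 * N + 1)) ℂ :=
  Matrix.of fun i j => (stiffEntry (meshSize N) (i.val + 1) (j.val + 1) : ℂ)

/-- The boundary observation matrix `B_h`: its only non-zero entry is `-1/h`, at position
`(2N+1, 2N)` (rows and columns counted from `1`). -/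
def obsMatrix (N : ℕ) : Matrix (Fin (2 * N + 1)) (Fin (2 * N + 1)) ℂ :=
  Matrix.of fun i j =>
    if i.val + 1 = 2 * N + 1 ∧ j.val + 1 = 2 * N then ((-(1 / meshSize N) : ℝ) : ℂ) else 0

/-- The discrete inner product
`(F, G)_{h,i} = ((M_h S_h⁻¹)^(1-i) S_h F, G)`, used for `i = -1, 0, 1`. -/
def discreteInner (N : ℕ) (i : ℤ) (F G : DiscreteVec N) : ℂ :=
  (((massMatrix N * (stiffMatrix N)⁻¹) ^ (1 - i) * stiffMatrix N) *ᵥ F) ⬝ᵥ star G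

/-- The squared discrete norm `‖F‖²_{h,i} = (F, F)_{h,i}`. -/
def discreteNormSq (N : ℕ) (i : ℤ) (F : DiscreteVec N) : ℝ :=
  (discreteInner N i F F).re

/-- The total energy `½ (‖F‖²_{h,1} + ‖G‖²_{h,0})` of a position-velocity pair `(F, G)`. -/
def energy (N : ℕ) (F G : DiscreteVec N) : ℝ :=
  (1 / 2) * (discreteNormSq N 1 F + discreteNormSq N 0 G)

/-- `U` solves the adjoint problem `M_h U'' + S_h U = 0`, `U(T) = U0`, `U'(T) = U1`. -/
structure IsAdjointSolution (N : ℕ) (T : ℝ) (U0 U1 : DiscreteVec N)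
    (U : ℝ → DiscreteVec N) : Prop where
  differentiable : Differentiable ℝ U
  differentiable_deriv : Differentiable ℝ (deriv U)
  equation : ∀ t : ℝ, massMatrix N *ᵥ deriv (deriv U) t + stiffMatrix N *ᵥ U t = 0
  position_final : U T = U0
  velocity_final : deriv U T = U1

/-- The space `𝓛_h` of piecewise linear data: `F_{j+1/2} = (F_j + F_{j+1}) / 2`, `0 ≤ j ≤ N`. -/
def linearSpace (N : ℕ) : Set (DiscreteVec N) :=
  {F | ∀ j : ℕ, j ≤ N →
    halfVal N F (2 * j + 1) = (halfVal N F (2 * j) + halfVal N F (2 * (j + 1))) / 2}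

/-- The space `𝓑_h` of data with bi-grid nodal values:
`F_{2j+1} = (F_{2j} + F_{2j+2}) / 2`, `0 ≤ j ≤ (N-1)/2` (for `N` odd, that is, `2j+1 ≤ N`). -/
def bigridSpace (N : ℕ) : Set (DiscreteVec N) :=
  {F | ∀ j : ℕ, 2 * j + 1 ≤ N →
    halfVal N F (2 * (2 * j + 1)) =
      (halfVal N F (2 * (2 * j)) + halfVal N F (2 * (2 * j + 2))) / 2}

/-- The data space `𝓢_h = (𝓛_h ∩ 𝓑_h) × (𝓛_h ∩ 𝓑_h)`. -/
def dataSpace (N : ℕ) : Set (DiscreteVec N × DiscreteVec N) :=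
  (linearSpace N ∩ bigridSpace N) ×ˢ (linearSpace N ∩ bigridSpace N)

/-- The squared Euclidean norm `‖B_h F‖²` in `ℂ^{2N+1}` of the boundary observation. -/
def obsNormSq (N : ℕ) (F : DiscreteVec N) : ℝ :=
  ‖WithLp.toLp 2 (obsMatrix N *ᵥ F)‖ ^ 2

end QuadFEM

end

/-! Eliminating the midpoint values from `S φ = λ M φ` leaves the three-point recurrence of a sine:
when `0 < λh² ≤ 4` the nodal values are multiples of `sin (jη)` with `cos η = dispersion (λh²)`, and
the boundary condition forces `η = mπh`. On this range, that is `ωh ≤ 2` with `ω = √λ`, the group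
velocity `h dω/dη` is at least one (`arccos_dispersion_sub_le`). Hence the frequencies `±ω` are
spaced by at least `π`, and Ingham's inequality observes these modes in any time larger than 2. The
remaining acoustic modes and the optic modes have no such gap, and bi-grid data do contain them.

Two facts make them harmless. The first concerns the data. A function that is piecewise linear on
the grid of size `2h` is seen by the stiffness matrix only through its coarse nodal values. A
discrete sine transform on the coarse grid therefore gives its stiffness energy exactly and bounds
its mass, and pairing with the sine eigenvectors of wave number `η < π/2` shows that modes with `λh²
≤ 5/2` carry a fixed fraction of the energy (`IsModalBasis.coeff_bigrid`,
`IsAdjointSolution.modal_reduction`). The multiplicity and the traces of the high modes play no role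
in this.

The second is a filter in time. Averaging symmetric translates of the observed trace, with step
`h/2` and the Fourier weights of a tent function, multiplies mode `ω` by approximately `max 0 (1 -
ωh/2)`. This factor is at least `1/10` when `(ωh)² ≤ 5/2`, and of size `1/J` when `(ωh)² > 4`, where
`J` is the number of translates. The translates fill a fixed margin `δ`, so `J` is of order `1/h`,
and even the crude trace bound `15/h³` leaves a high-frequency remainder of order `h` times the
total energy. The low modes dominate the total energy, so this remainder is absorbed when `h` is
small (`SpectralTrace.observability`).

Finitely many coarse meshes remain. On each one every low frequency is isolated, so its amplitude
can be recovered by eliminating the other frequencies one at a time (`exists_norm_coeff_sq_le`). -/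

namespace QuadFEM

/-! ### Ingham's inequality with gap `π`. -/

section Ingham

open Complex

/-- Partial fractions telescope: the term is `1/(r + 1/2) - 1/(r + 3/2)`. The two-sided sum over
nonzero integers is then at most 4, which is the off-diagonal constant in Ingham's inequality. -/
theorem sum_inv_sq_sub_quarter_range (R : ℕ) :
    ∑ r ∈ Finset.range R, 1 / (((r : ℝ) + 1) ^ 2 - 1 / 4) = 2 - 1 / ((R : ℝ) + 1 / 2) := by
  induction R with
  | zero => norm_num
  | succ k ih =>
    rw [Finset.sum_range_succ, ih]
    have h1 : ((k : ℝ) + 1) ^ 2 - 1 / 4 = (k + 1 / 2) * (k + 1 + 1 / 2) := by ring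
    have h2 : (k : ℝ) + 1 / 2 ≠ 0 := by positivity
    have h3 : (k : ℝ) + 1 + 1 / 2 ≠ 0 := by positivity
    rw [h1]
    push_cast
    field_simp
    ring

theorem sum_inv_sq_sub_quarter_le (s : Finset ℤ) (hs : (0 : ℤ) ∉ s) :
    ∑ r ∈ s, 1 / ((r : ℝ) ^ 2 - 1 / 4) ≤ 4 := by
  obtain ⟨R, hR⟩ : ∃ R : ℕ, ∀ r ∈ s, r.natAbs ≤ R :=
    ⟨s.sup Int.natAbs, fun r hr => Finset.le_sup (f := Int.natAbs) hr⟩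
  let p : Finset ℤ := (Finset.range R).image fun k : ℕ => (k : ℤ) + 1
  let q : Finset ℤ := (Finset.range R).image fun k : ℕ => -((k : ℤ) + 1)
  have hsub : s ⊆ p ∪ q := by
    intro r hr
    have h0 : r ≠ 0 := fun h => hs (h ▸ hr)
    have h1 := hR r hr
    simp only [p, q, Finset.mem_union, Finset.mem_image, Finset.mem_range]
    rcases lt_or_gt_of_ne h0 with h | h
    · exact Or.inr ⟨r.natAbs - 1, by omega, by omega⟩
    · exact Or.inl ⟨r.natAbs - 1, by omega, by omega⟩
  have hpos : ∀ r ∈ p ∪ q, 0 ≤ 1 / ((r : ℝ) ^ 2 - 1 / 4) := by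
    intro r hr
    have h0 : r ≠ 0 := by
      simp only [p, q, Finset.mem_union, Finset.mem_image, Finset.mem_range] at hr
      rcases hr with ⟨k, _, rfl⟩ | ⟨k, _, rfl⟩ <;> omega
    have h1 : (1 : ℤ) ≤ r ^ 2 := by
      have := Int.one_le_abs h0
      nlinarith [sq_abs r]
    have h2 : (1 : ℝ) ≤ (r : ℝ) ^ 2 := by exact_mod_cast h1
    exact div_nonneg zero_le_one (by linarith)
  have hdisj : Disjoint p q := by
    rw [Finset.disjoint_left]
    intro r hp hq
    simp only [p, q, Finset.mem_image, Finset.mem_range] at hp hq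
    obtain ⟨k, _, hk⟩ := hp
    obtain ⟨l, _, hl⟩ := hq
    omega
  have hp : ∑ r ∈ p, 1 / ((r : ℝ) ^ 2 - 1 / 4) ≤ 2 := by
    rw [Finset.sum_image (fun a _ b _ h => by simpa using h)]
    push_cast
    rw [sum_inv_sq_sub_quarter_range]
    have : 0 ≤ 1 / ((R : ℝ) + 1 / 2) := by positivity
    linarith
  have hq : ∑ r ∈ q, 1 / ((r : ℝ) ^ 2 - 1 / 4) ≤ 2 := by
    rw [Finset.sum_image (fun a _ b _ h => by simpa using h)]
    push_cast
    simp only [neg_sq]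
    rw [sum_inv_sq_sub_quarter_range]
    have : 0 ≤ 1 / ((R : ℝ) + 1 / 2) := by positivity
    linarith
  calc ∑ r ∈ s, 1 / ((r : ℝ) ^ 2 - 1 / 4)
      ≤ ∑ r ∈ p ∪ q, 1 / ((r : ℝ) ^ 2 - 1 / 4) :=
        Finset.sum_le_sum_of_subset_of_nonneg hsub fun r hr _ => hpos r hr
    _ = _ := Finset.sum_union hdisj
    _ ≤ 4 := by linarith

/-- The Fourier transform of the cosine weight on `[-τ, τ]`. -/
theorem integral_cos_mul_exp (τ u : ℝ) (hτ : 0 < τ) (hu : (Real.pi / (2 * τ)) ^ 2 - u ^ 2 ≠ 0) :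
    ∫ t in (-τ)..τ, (Real.cos (Real.pi / (2 * τ) * t) : ℂ) * exp (I * u * t) =
      ((Real.pi / τ * Real.cos (u * τ) / ((Real.pi / (2 * τ)) ^ 2 - u ^ 2) : ℝ) : ℂ) := by
  set b : ℝ := Real.pi / (2 * τ) with hb
  have hbτ : b * τ = Real.pi / 2 := by rw [hb]; field_simp
  have hne : ((b : ℂ) ^ 2 - (u : ℂ) ^ 2) ≠ 0 := by exact_mod_cast hu
  have hderiv : ∀ t ∈ Set.uIcc (-τ) τ, HasDerivAt
      (fun t : ℝ => exp (I * u * t) * (I * u * Complex.cos (b * t) + b * Complex.sin (b * t)) /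
        ((b : ℂ) ^ 2 - (u : ℂ) ^ 2))
      ((Real.cos (b * t) : ℂ) * exp (I * u * t)) t := by
    intro t _
    have h0 : HasDerivAt (fun t : ℝ => (t : ℂ)) 1 t := Complex.ofRealCLM.hasDerivAt
    have h1 : HasDerivAt (fun t : ℝ => exp (I * u * t)) (exp (I * u * t) * (I * u * 1)) t :=
      (h0.const_mul (I * u)).cexp
    have h2 : HasDerivAt (fun t : ℝ => Complex.cos (b * t)) (-Complex.sin (b * t) * (b * 1)) t :=
      (Complex.hasDerivAt_cos _).comp t (h0.const_mul (b : ℂ))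
    have h3 : HasDerivAt (fun t : ℝ => Complex.sin (b * t)) (Complex.cos (b * t) * (b * 1)) t :=
      (Complex.hasDerivAt_sin _).comp t (h0.const_mul (b : ℂ))
    have h4 := (h1.mul ((h2.const_mul (I * u)).add (h3.const_mul (b : ℂ)))).div_const
      ((b : ℂ) ^ 2 - (u : ℂ) ^ 2)
    refine h4.congr_deriv ?_
    simp only [Pi.add_apply]
    rw [div_eq_iff hne]
    push_cast
    linear_combination (exp (I * u * t) * u ^ 2 * Complex.cos (b * t)) * I_sq
  rw [intervalIntegral.integral_eq_sub_of_hasDerivAt hderiv]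
  · have e1 : (b : ℂ) * (τ : ℂ) = ((Real.pi / 2 : ℝ) : ℂ) := by rw [← hbτ]; push_cast; rfl
    have hc : Complex.cos ((b : ℂ) * τ) = 0 := by
      rw [e1, ← Complex.ofReal_cos, Real.cos_pi_div_two]; simp
    have hs : Complex.sin ((b : ℂ) * τ) = 1 := by
      rw [e1, ← Complex.ofReal_sin, Real.sin_pi_div_two]; simp
    have h2b : (Real.pi / τ : ℝ) = 2 * b := by rw [hb]; field_simp
    rw [h2b]
    push_cast
    have hm : I * (u : ℂ) * -(τ : ℂ) = -((u : ℂ) * τ) * I := by ring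
    rw [hm, mul_neg, Complex.cos_neg, Complex.sin_neg, hc, hs, Complex.cos, show I * (u : ℂ) * (τ : ℂ) = (u : ℂ) * τ * I by ring]
    ring
  · apply Continuous.intervalIntegrable
    fun_prop

/-- For `τ > 1` the pole `π/(2τ)` of the transform lies below `π/2`, while `|u| ≥ π|r|`. The
denominator is thus at least `π²(r² - 1/4)`, of a summable form. -/
theorem abs_cosine_weight_transform_le {τ u : ℝ} {r : ℤ} (hτ : 1 < τ) (hr : r ≠ 0)
    (hu : Real.pi * |(r : ℝ)| ≤ |u|) :
    (Real.pi / (2 * τ)) ^ 2 - u ^ 2 ≠ 0 ∧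
    |Real.pi / τ * Real.cos (u * τ) / ((Real.pi / (2 * τ)) ^ 2 - u ^ 2)| ≤
      1 / (Real.pi * τ) * (1 / ((r : ℝ) ^ 2 - 1 / 4)) := by
  have hpi := Real.pi_pos
  have hr1 : (1 : ℝ) ≤ (r : ℝ) ^ 2 := by
    have : (1 : ℤ) ≤ r ^ 2 := by
      have := Int.one_le_abs hr
      nlinarith [sq_abs r]
    exact_mod_cast this
  have hu2 : Real.pi ^ 2 * (r : ℝ) ^ 2 ≤ u ^ 2 := by
    have := mul_self_le_mul_self (by positivity) hu
    nlinarith [sq_abs u, sq_abs (r : ℝ)]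
  have hb : (Real.pi / (2 * τ)) ^ 2 ≤ Real.pi ^ 2 / 4 := by
    rw [div_pow]
    apply div_le_div_of_nonneg_left (by positivity) (by norm_num)
    nlinarith
  have hden : Real.pi ^ 2 * ((r : ℝ) ^ 2 - 1 / 4) ≤ u ^ 2 - (Real.pi / (2 * τ)) ^ 2 := by linarith
  have hq : 0 < (r : ℝ) ^ 2 - 1 / 4 := by linarith
  have hpos : 0 < u ^ 2 - (Real.pi / (2 * τ)) ^ 2 := lt_of_lt_of_le (by positivity) hden
  refine ⟨by linarith, ?_⟩
  rw [abs_div, abs_mul, abs_sub_comm, abs_of_pos hpos, abs_of_pos (by positivity : 0 < Real.pi / τ)]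
  calc Real.pi / τ * |Real.cos (u * τ)| / (u ^ 2 - (Real.pi / (2 * τ)) ^ 2)
      ≤ Real.pi / τ * 1 / (Real.pi ^ 2 * ((r : ℝ) ^ 2 - 1 / 4)) := by
        gcongr
        exact Real.abs_cos_le_one _
    _ = _ := by field_simp

theorem normSq_sum_exp {ι : Type*} (s : Finset ι) (μ : ι → ℝ) (a : ι → ℂ) (t : ℝ) :
    ((‖∑ i ∈ s, a i * exp (I * μ i * t)‖ ^ 2 : ℝ) : ℂ) =
      ∑ i ∈ s, ∑ j ∈ s, a i * (starRingEnd ℂ) (a j) * exp (I * ((μ i - μ j : ℝ) : ℂ) * t) := by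
  rw [← Complex.normSq_eq_norm_sq, ← Complex.mul_conj, map_sum, Finset.sum_mul_sum]
  refine Finset.sum_congr rfl fun i _ => Finset.sum_congr rfl fun j _ => ?_
  rw [map_mul, ← Complex.exp_conj]
  simp only [map_mul, conj_I, conj_ofReal]
  rw [show I * ((μ i - μ j : ℝ) : ℂ) * (t : ℂ) = I * μ i * t + -I * μ j * t by push_cast; ring,
    Complex.exp_add]
  ring

/-- Ingham's inequality for frequencies with gap `π` on an interval of length `2 τ > 2`. -/
theorem ingham_inequality {ι : Type*} (s : Finset ι) {τ : ℝ} (hτ : 1 < τ) (μ : ι → ℝ) (n : ι → ℤ)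
    (hn : Set.InjOn n s)
    (hgap : ∀ i ∈ s, ∀ j ∈ s, Real.pi * |((n i - n j : ℤ) : ℝ)| ≤ |μ i - μ j|) (a : ι → ℂ) :
    4 / Real.pi * (τ - 1 / τ) * ∑ i ∈ s, ‖a i‖ ^ 2 ≤
      ∫ t in (-τ)..τ, ‖∑ i ∈ s, a i * exp (I * μ i * t)‖ ^ 2 := by
  classical
  have hpi := Real.pi_pos
  have hτ0 : 0 < τ := by linarith
  set b : ℝ := Real.pi / (2 * τ) with hb
  set f : ℝ → ℂ := fun t => ∑ i ∈ s, a i * exp (I * μ i * t) with hf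
  set k : ℝ → ℝ := fun u => Real.pi / τ * Real.cos (u * τ) / (b ^ 2 - u ^ 2) with hk
  have hfc : Continuous f := by fun_prop
  have hk0 : k 0 = 4 / Real.pi * τ := by
    simp only [hk, hb]
    rw [zero_mul, Real.cos_zero]
    field_simp
    ring
  have hne : ∀ i ∈ s, ∀ j ∈ s, b ^ 2 - (μ i - μ j) ^ 2 ≠ 0 := by
    intro i hi j hj
    by_cases hij : n i = n j
    · have : i = j := hn hi hj hij
      subst this
      have : 0 < b := by positivity
      rw [sub_self, zero_pow two_ne_zero, sub_zero]
      positivity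
    · exact (abs_cosine_weight_transform_le hτ (sub_ne_zero.mpr hij) (hgap i hi j hj)).1
  have hint : ∫ t in (-τ)..τ, Real.cos (b * t) * ‖f t‖ ^ 2 =
      (∑ i ∈ s, ∑ j ∈ s, a i * (starRingEnd ℂ) (a j) * (k (μ i - μ j) : ℂ)).re := by
    have h1 : ((∫ t in (-τ)..τ, Real.cos (b * t) * ‖f t‖ ^ 2 : ℝ) : ℂ) =
        ∑ i ∈ s, ∑ j ∈ s, a i * (starRingEnd ℂ) (a j) * (k (μ i - μ j) : ℂ) := by
      rw [← intervalIntegral.integral_ofReal]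
      have h2 : ∀ t : ℝ, ((Real.cos (b * t) * ‖f t‖ ^ 2 : ℝ) : ℂ) =
          ∑ i ∈ s, ∑ j ∈ s, a i * (starRingEnd ℂ) (a j) *
            ((Real.cos (b * t) : ℂ) * exp (I * ((μ i - μ j : ℝ) : ℂ) * t)) := by
        intro t
        rw [Complex.ofReal_mul, hf, normSq_sum_exp, Finset.mul_sum]
        refine Finset.sum_congr rfl fun i _ => ?_
        rw [Finset.mul_sum]
        refine Finset.sum_congr rfl fun j _ => ?_
        ring
      simp_rw [h2]
      rw [intervalIntegral.integral_finsetSum]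
      · refine Finset.sum_congr rfl fun i hi => ?_
        rw [intervalIntegral.integral_finsetSum]
        · refine Finset.sum_congr rfl fun j hj => ?_
          rw [intervalIntegral.integral_const_mul, hb,
            integral_cos_mul_exp τ _ hτ0 (hne i hi j hj)]
        · intro j _
          apply Continuous.intervalIntegrable
          fun_prop
      · intro i _
        apply Continuous.intervalIntegrable
        fun_prop
    rw [← h1, Complex.ofReal_re]
  -- Diagonal dominance: the diagonal value is `4τ/π`, so a row sum of at most `4/(πτ)` leaves
  -- `(4/π)(τ - 1/τ)`, positive exactly because `τ > 1`. Injectivity of the labels `n` turns the row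
  -- into a sum over distinct nonzero integers.
  have hrow : ∀ i ∈ s, ∑ j ∈ s.erase i, |k (μ i - μ j)| ≤ 4 / (Real.pi * τ) := by
    intro i hi
    have hinj : Set.InjOn (fun j => n i - n j) (s.erase i : Finset ι) := by
      intro j hj l hl hjl
      exact hn (Finset.mem_of_mem_erase hj) (Finset.mem_of_mem_erase hl) (by simpa using hjl)
    have hnz : ∀ j ∈ s.erase i, n i - n j ≠ 0 := by
      intro j hj h
      exact (Finset.ne_of_mem_erase hj) (hn (Finset.mem_of_mem_erase hj) hi (by omega))
    calc ∑ j ∈ s.erase i, |k (μ i - μ j)|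
        ≤ ∑ j ∈ s.erase i, 1 / (Real.pi * τ) * (1 / (((n i - n j : ℤ) : ℝ) ^ 2 - 1 / 4)) :=
          Finset.sum_le_sum fun j hj => (abs_cosine_weight_transform_le hτ (hnz j hj)
            (hgap i hi j (Finset.mem_of_mem_erase hj))).2
      _ = 1 / (Real.pi * τ) *
          ∑ r ∈ (s.erase i).image (fun j => n i - n j), 1 / ((r : ℝ) ^ 2 - 1 / 4) := by
          rw [Finset.sum_image hinj, Finset.mul_sum]
      _ ≤ 1 / (Real.pi * τ) * 4 := by
          gcongr
          apply sum_inv_sq_sub_quarter_le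
          intro h
          obtain ⟨j, hj, hj0⟩ := Finset.mem_image.mp h
          exact hnz j hj hj0
      _ = _ := by ring
  have hksymm : ∀ u, k (-u) = k u := by
    intro u
    simp only [hk, neg_mul, Real.cos_neg, neg_sq]
  have hdiag : (∑ i ∈ s, ∑ j ∈ s, a i * (starRingEnd ℂ) (a j) * (k (μ i - μ j) : ℂ)).re ≥
      4 / Real.pi * (τ - 1 / τ) * ∑ i ∈ s, ‖a i‖ ^ 2 := by
    have hsplit : ∀ i ∈ s, ∑ j ∈ s, a i * (starRingEnd ℂ) (a j) * (k (μ i - μ j) : ℂ) =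
        ((‖a i‖ ^ 2 * k 0 : ℝ) : ℂ) +
          ∑ j ∈ s.erase i, a i * (starRingEnd ℂ) (a j) * (k (μ i - μ j) : ℂ) := by
      intro i hi
      rw [← Finset.add_sum_erase s _ hi, sub_self, Complex.mul_conj, Complex.normSq_eq_norm_sq]
      push_cast
      rfl
    rw [Finset.sum_congr rfl hsplit, Finset.sum_add_distrib, Complex.add_re, ← Complex.ofReal_sum,
      Complex.ofReal_re, ← Finset.sum_mul, hk0]
    have hoff : |(∑ i ∈ s, ∑ j ∈ s.erase i,
        a i * (starRingEnd ℂ) (a j) * (k (μ i - μ j) : ℂ)).re| ≤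
        4 / (Real.pi * τ) * ∑ i ∈ s, ‖a i‖ ^ 2 := by
      calc |(∑ i ∈ s, ∑ j ∈ s.erase i, a i * (starRingEnd ℂ) (a j) * (k (μ i - μ j) : ℂ)).re|
          ≤ ‖∑ i ∈ s, ∑ j ∈ s.erase i, a i * (starRingEnd ℂ) (a j) * (k (μ i - μ j) : ℂ)‖ :=
            Complex.abs_re_le_norm _
        _ ≤ ∑ i ∈ s, ∑ j ∈ s.erase i, ‖a i * (starRingEnd ℂ) (a j) * (k (μ i - μ j) : ℂ)‖ :=
            (norm_sum_le _ _).trans (Finset.sum_le_sum fun i _ => norm_sum_le _ _)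
        _ ≤ ∑ i ∈ s, ∑ j ∈ s.erase i, (‖a i‖ ^ 2 / 2 * |k (μ i - μ j)| +
              ‖a j‖ ^ 2 / 2 * |k (μ i - μ j)|) := by
            refine Finset.sum_le_sum fun i _ => Finset.sum_le_sum fun j _ => ?_
            rw [norm_mul, norm_mul, RCLike.norm_conj, Complex.norm_real, Real.norm_eq_abs,
              ← add_mul]
            gcongr
            nlinarith [sq_nonneg (‖a i‖ - ‖a j‖)]
        _ = ∑ i ∈ s, ∑ j ∈ s.erase i, ‖a i‖ ^ 2 / 2 * |k (μ i - μ j)| +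
              ∑ i ∈ s, ∑ j ∈ s.erase i, ‖a j‖ ^ 2 / 2 * |k (μ i - μ j)| := by
            simp only [Finset.sum_add_distrib]
        _ = ∑ i ∈ s, ∑ j ∈ s.erase i, ‖a i‖ ^ 2 / 2 * |k (μ i - μ j)| +
              ∑ i ∈ s, ∑ j ∈ s.erase i, ‖a i‖ ^ 2 / 2 * |k (μ i - μ j)| := by
            -- The kernel is even, so the two halves of the Young splitting agree after exchanging
            -- the indices.
            congr 1
            rw [Finset.sum_comm' (t' := s) (s' := fun j => s.erase j)]
            · refine Finset.sum_congr rfl fun i _ => Finset.sum_congr rfl fun j _ => ?_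
              rw [← hksymm, neg_sub]
            · intro x y
              simp only [Finset.mem_erase]
              tauto
        _ = ∑ i ∈ s, ‖a i‖ ^ 2 * ∑ j ∈ s.erase i, |k (μ i - μ j)| := by
            rw [← Finset.sum_add_distrib]
            refine Finset.sum_congr rfl fun i _ => ?_
            rw [← Finset.mul_sum]
            ring
        _ ≤ ∑ i ∈ s, ‖a i‖ ^ 2 * (4 / (Real.pi * τ)) :=
            Finset.sum_le_sum fun i hi => mul_le_mul_of_nonneg_left (hrow i hi) (by positivity)
        _ = _ := by rw [← Finset.sum_mul]; ring
    have h5 := (abs_le.mp hoff).1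
    have h6 : 4 / Real.pi * (τ - 1 / τ) * ∑ i ∈ s, ‖a i‖ ^ 2 =
        (∑ i ∈ s, ‖a i‖ ^ 2) * (4 / Real.pi * τ) - 4 / (Real.pi * τ) * ∑ i ∈ s, ‖a i‖ ^ 2 := by
      field_simp
    rw [h6]
    linarith
  calc 4 / Real.pi * (τ - 1 / τ) * ∑ i ∈ s, ‖a i‖ ^ 2
      ≤ ∫ t in (-τ)..τ, Real.cos (b * t) * ‖f t‖ ^ 2 := by rw [hint]; exact hdiag
    -- The cosine weight is at most 1 and can be dropped.
    _ ≤ ∫ t in (-τ)..τ, ‖f t‖ ^ 2 := by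
        apply intervalIntegral.integral_mono_on (by linarith)
        · apply Continuous.intervalIntegrable
          fun_prop
        · apply Continuous.intervalIntegrable
          fun_prop
        · intro t _
          calc Real.cos (b * t) * ‖f t‖ ^ 2 ≤ 1 * ‖f t‖ ^ 2 := by
                gcongr
                exact Real.cos_le_one _
            _ = _ := one_mul _

/-- Ingham's inequality on an arbitrary interval of length `2 τ > 2`. -/
theorem ingham_inequality_shift {ι : Type*} (s : Finset ι) {τ : ℝ} (hτ : 1 < τ) (t₀ : ℝ)
    (μ : ι → ℝ) (n : ι → ℤ) (hn : Set.InjOn n s)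
    (hgap : ∀ i ∈ s, ∀ j ∈ s, Real.pi * |((n i - n j : ℤ) : ℝ)| ≤ |μ i - μ j|) (a : ι → ℂ) :
    4 / Real.pi * (τ - 1 / τ) * ∑ i ∈ s, ‖a i‖ ^ 2 ≤
      ∫ t in (t₀ - τ)..(t₀ + τ), ‖∑ i ∈ s, a i * exp (I * μ i * t)‖ ^ 2 := by
  have h := ingham_inequality s hτ μ n hn hgap fun i => a i * exp (I * μ i * t₀)
  have h1 : ∀ i, ‖a i * exp (I * μ i * t₀)‖ = ‖a i‖ := by
    intro i
    rw [norm_mul, show I * (μ i : ℂ) * (t₀ : ℂ) = ((μ i * t₀ : ℝ) : ℂ) * I by push_cast; ring,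
      Complex.norm_exp_ofReal_mul_I, mul_one]
  simp only [h1] at h
  refine h.trans (le_of_eq ?_)
  have h2 := intervalIntegral.integral_comp_add_right (a := -τ) (b := τ)
    (fun t : ℝ => ‖∑ i ∈ s, a i * exp (I * μ i * t)‖ ^ 2) t₀
  rw [show -τ + t₀ = t₀ - τ by ring, show τ + t₀ = t₀ + τ by ring] at h2
  rw [← h2]
  congr 1
  funext t
  congr 2
  refine Finset.sum_congr rfl fun i _ => ?_
  rw [mul_assoc, ← Complex.exp_add]
  congr 2
  push_cast
  ring

end Ingham

end QuadFEM

namespace QuadFEM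

/-! ### Averaging over time shifts with the Fourier weights of a tent function. -/

section Filter

/-- Cosine coefficients of the `2π`-periodic tent function that equals `max 0 (1 - |x|)` on
`[-π, π]`. -/
noncomputable def tentCoeff (j : ℕ) : ℝ :=
  if j = 0 then 1 / (2 * Real.pi) else 2 / Real.pi * ((1 - Real.cos j) / (j : ℝ) ^ 2)

theorem tentCoeff_nonneg (j : ℕ) : 0 ≤ tentCoeff j := by
  have := Real.pi_pos
  unfold tentCoeff
  split_ifs
  · positivity
  · have := Real.cos_le_one j
    exact mul_nonneg (by positivity) (div_nonneg (by linarith) (by positivity))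

theorem tentCoeff_succ_le (j : ℕ) : tentCoeff (j + 1) ≤ 2 / ((j : ℝ) + 1) ^ 2 := by
  have := Real.pi_gt_three
  have h1 := Real.neg_one_le_cos ((j + 1 : ℕ) : ℝ)
  rw [tentCoeff, if_neg (Nat.succ_ne_zero j), ← mul_div_assoc]
  push_cast at h1 ⊢
  gcongr
  rw [div_mul_eq_mul_div, div_le_iff₀ (by linarith)]
  linarith

/-- The Fourier series of the second Bernoulli polynomial, rescaled from `[0, 1]` to `[0, 2π]`. -/
theorem hasSum_cos_div_sq {y : ℝ} (hy : y ∈ Set.Icc 0 (2 * Real.pi)) :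
    HasSum (fun n : ℕ => Real.cos (n * y) / (n : ℝ) ^ 2)
      (Real.pi ^ 2 / 6 - Real.pi * y / 2 + y ^ 2 / 4) := by
  have hpi := Real.pi_pos
  have hx : y / (2 * Real.pi) ∈ Set.Icc (0 : ℝ) 1 :=
    ⟨div_nonneg hy.1 (by positivity), div_le_one_of_le₀ hy.2 (by positivity)⟩
  have h := hasSum_one_div_nat_pow_mul_cos one_ne_zero hx
  have hB : (Polynomial.map (algebraMap ℚ ℝ) (Polynomial.bernoulli 2)).eval (y / (2 * Real.pi)) =
      (y / (2 * Real.pi)) ^ 2 - y / (2 * Real.pi) + 1 / 6 := by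
    simp [Polynomial.bernoulli, Finset.sum_range_succ, Polynomial.eval_add, bernoulli_two]
    ring
  rw [mul_one, hB] at h
  convert! h using 1
  · funext n
    rw [show 2 * Real.pi * n * (y / (2 * Real.pi)) = n * y by field_simp]
    ring
  · norm_num [Nat.factorial]
    field_simp
    ring

/-- The tent is a second difference with step 1 of the periodic parabola of `hasSum_cos_div_sq`,
whose kink at the origin produces the peak. The bound `2π - 1` is where the next periodic tent
begins. -/
theorem hasSum_tentCoeff_mul_cos {x : ℝ} (h0 : 0 ≤ x) (h1 : x ≤ 2 * Real.pi - 1) :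
    HasSum (fun j : ℕ => tentCoeff j * Real.cos (j * x)) (max 0 (1 - x)) := by
  have hpi := Real.pi_gt_three
  have ha := hasSum_cos_div_sq (y := x) ⟨h0, by linarith⟩
  have hb := hasSum_cos_div_sq (y := x + 1) ⟨by linarith, by linarith⟩
  -- The parabola formula holds only on `[0, 2π]`; the absolute value is harmless because cosine is
  -- even.
  have hc := hasSum_cos_div_sq (y := |x - 1|) ⟨abs_nonneg _, by
    rw [abs_le]; constructor <;> linarith⟩
  have h := ((ha.sub (hb.mul_left (1 / 2))).sub (hc.mul_left (1 / 2))).mul_left (2 / Real.pi)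
  -- Division by zero makes the terms `j = 0` of the three series vanish, so the mean value of the
  -- tent is added separately.
  have hone : HasSum (fun j : ℕ => if j = 0 then 1 / (2 * Real.pi) else 0) (1 / (2 * Real.pi)) :=
    hasSum_ite_eq 0 _
  convert! h.add hone using 1
  · funext j
    by_cases hj : j = 0
    · simp [hj, tentCoeff]
    · have hj' : (j : ℝ) ≠ 0 := Nat.cast_ne_zero.mpr hj
      have e1 : Real.cos (j * |x - 1|) = Real.cos (j * (x - 1)) := by
        rcases abs_choice (x - 1) with h | h
        · rw [h]
        · rw [h, mul_neg, Real.cos_neg]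
      rw [tentCoeff, if_neg hj, if_neg hj, e1, show (j : ℝ) * (x + 1) = j * x + j by ring,
        show (j : ℝ) * (x - 1) = j * x - j by ring, Real.cos_add, Real.cos_sub]
      ring
  · rcases le_total x 1 with hx | hx
    · rw [max_eq_right (by linarith), abs_of_nonpos (by linarith)]
      field_simp
      ring
    · rw [max_eq_left (by linarith), abs_of_nonneg (by linarith)]
      field_simp
      ring

/-- The nonnegative weights sum to the height of the tent at 0. This makes the filter a sub-convex
combination of shifts, hence a contraction for the integrated squares below. -/
theorem sum_tentCoeff_le_one (s : Finset ℕ) : ∑ j ∈ s, tentCoeff j ≤ 1 := by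
  have hpi := Real.pi_gt_three
  have h := hasSum_tentCoeff_mul_cos (x := 0) le_rfl (by linarith)
  simp only [mul_zero, Real.cos_zero, mul_one, sub_zero, max_eq_right zero_le_one] at h
  exact sum_le_hasSum s (fun j _ => tentCoeff_nonneg j) h

theorem abs_sum_tentCoeff_mul_cos_sub_le {x : ℝ} (h0 : 0 ≤ x) (h1 : x ≤ 2 * Real.pi - 1) {J : ℕ}
    (hJ : 1 ≤ J) :
    |∑ j ∈ Finset.range (J + 1), tentCoeff j * Real.cos (j * x) - max 0 (1 - x)| ≤ 2 / J := by
  set S : ℕ → ℝ := fun M => ∑ j ∈ Finset.range M, tentCoeff j * Real.cos (j * x) with hS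
  have hJ0 : (0 : ℝ) < J := by exact_mod_cast hJ
  -- The tail is compared with the telescoping series `2/M - 2/(M + 1)`, which dominates `2/(M +
  -- 1)²`.
  have hstep : ∀ M, J ≤ M → |S (J + 1) - S (M + 1)| ≤ 2 / J - 2 / M := by
    intro M hM
    induction M, hM using Nat.le_induction with
    | base => simp
    | succ M hM ih =>
      have hM0 : (0 : ℝ) < M := by exact_mod_cast (lt_of_lt_of_le hJ hM)
      have e : S (M + 1 + 1) = S (M + 1) + tentCoeff (M + 1) * Real.cos ((M + 1 : ℕ) * x) :=
        Finset.sum_range_succ _ _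
      have hb : |tentCoeff (M + 1) * Real.cos ((M + 1 : ℕ) * x)| ≤ 2 / (M : ℝ) - 2 / (M + 1) := by
        rw [abs_mul, abs_of_nonneg (tentCoeff_nonneg _)]
        calc tentCoeff (M + 1) * |Real.cos ((M + 1 : ℕ) * x)|
            ≤ 2 / ((M : ℝ) + 1) ^ 2 * 1 :=
              mul_le_mul (tentCoeff_succ_le M) (Real.abs_cos_le_one _) (abs_nonneg _)
                (by positivity)
          _ ≤ 2 / (M * ((M : ℝ) + 1)) := by
              rw [mul_one]
              gcongr
              nlinarith
          _ = 2 / (M : ℝ) - 2 / (M + 1) := by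
              field_simp
              ring
      rw [e, ← sub_sub]
      calc |S (J + 1) - S (M + 1) - tentCoeff (M + 1) * Real.cos ((M + 1 : ℕ) * x)|
          ≤ |S (J + 1) - S (M + 1)| + |tentCoeff (M + 1) * Real.cos ((M + 1 : ℕ) * x)| :=
            abs_sub _ _
        _ ≤ (2 / J - 2 / M) + (2 / (M : ℝ) - 2 / (M + 1)) := add_le_add ih hb
        _ = _ := by push_cast; ring
  have hlim : Filter.Tendsto (fun M : ℕ => |S (J + 1) - S (M + 1)|) Filter.atTop
      (nhds |S (J + 1) - max 0 (1 - x)|) :=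
    (((hasSum_tentCoeff_mul_cos h0 h1).tendsto_sum_nat.comp
      (Filter.tendsto_add_atTop_nat 1)).const_sub _).abs
  refine le_of_tendsto hlim (Filter.eventually_atTop.mpr ⟨J, fun M hM => ?_⟩)
  have : (0 : ℝ) ≤ 2 / M := by positivity
  linarith [hstep M hM]

theorem norm_half_add_sq_le (z w : ℂ) : ‖(z + w) / 2‖ ^ 2 ≤ (‖z‖ ^ 2 + ‖w‖ ^ 2) / 2 := by
  have h := norm_add_le z w
  rw [norm_div, Complex.norm_two, div_pow]
  nlinarith [sq_nonneg (‖z‖ - ‖w‖), norm_nonneg (z + w)]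

/-- Weighted averages of symmetric time shifts of `g`. -/
noncomputable def shiftFilter (J : ℕ) (s : ℝ) (g : ℝ → ℂ) (t : ℝ) : ℂ :=
  ∑ j ∈ Finset.range (J + 1), (tentCoeff j : ℂ) * ((g (t + j * s) + g (t - j * s)) / 2)

theorem norm_shiftFilter_sq_le (J : ℕ) (s : ℝ) (g : ℝ → ℂ) (t : ℝ) :
    ‖shiftFilter J s g t‖ ^ 2 ≤ ∑ j ∈ Finset.range (J + 1),
      tentCoeff j * ((‖g (t + j * s)‖ ^ 2 + ‖g (t - j * s)‖ ^ 2) / 2) := by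
  set z : ℕ → ℂ := fun j => (g (t + j * s) + g (t - j * s)) / 2 with hz
  calc ‖shiftFilter J s g t‖ ^ 2
      ≤ (∑ j ∈ Finset.range (J + 1), tentCoeff j * ‖z j‖) ^ 2 := by
        gcongr
        refine (norm_sum_le _ _).trans (Finset.sum_le_sum fun j _ => ?_)
        rw [norm_mul, Complex.norm_real, Real.norm_of_nonneg (tentCoeff_nonneg j)]
    _ ≤ (∑ j ∈ Finset.range (J + 1), tentCoeff j) *
          ∑ j ∈ Finset.range (J + 1), tentCoeff j * ‖z j‖ ^ 2 := by
        -- Cauchy–Schwarz with the weights `tentCoeff j`; their total mass then disappears because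
        -- it is at most 1.
        refine Finset.sum_sq_le_sum_mul_sum_of_sq_le_mul _ (fun j _ => tentCoeff_nonneg j)
          (fun j _ => mul_nonneg (tentCoeff_nonneg j) (sq_nonneg _)) (fun j _ => le_of_eq ?_)
        ring
    _ ≤ 1 * ∑ j ∈ Finset.range (J + 1), tentCoeff j * ‖z j‖ ^ 2 := by
        gcongr
        · exact Finset.sum_nonneg fun j _ => mul_nonneg (tentCoeff_nonneg j) (sq_nonneg _)
        · exact sum_tentCoeff_le_one _
    _ ≤ _ := by
        rw [one_mul]
        refine Finset.sum_le_sum fun j _ =>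
          mul_le_mul_of_nonneg_left (norm_half_add_sq_le _ _) (tentCoeff_nonneg j)

theorem integral_comp_add_le {F : ℝ → ℝ} (hF : Continuous F) (hF0 : ∀ t, 0 ≤ F t) {a b c d e : ℝ}
    (hab : a ≤ b) (hc : c ≤ a + e) (hd : b + e ≤ d) :
    ∫ t in a..b, F (t + e) ≤ ∫ t in c..d, F t := by
  rw [intervalIntegral.integral_comp_add_right]
  exact intervalIntegral.integral_mono_interval hc (by linarith) hd
    (Filter.Eventually.of_forall hF0) (hF.intervalIntegrable _ _)

theorem continuous_shiftFilter (J : ℕ) (s : ℝ) {g : ℝ → ℂ} (hg : Continuous g) :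
    Continuous (shiftFilter J s g) := by
  unfold shiftFilter
  fun_prop

/-- All shifts are at most `δ`, so the filter on `[δ, T - δ]` uses the signal only inside `[0, T]`.
The margins are the price in time for suppressing high frequencies. -/
theorem integral_norm_shiftFilter_sq_le {J : ℕ} {s δ T : ℝ} (hs : 0 ≤ s) (hJ : J * s ≤ δ)
    (hT : δ ≤ T - δ) {g : ℝ → ℂ} (hg : Continuous g) :
    ∫ t in δ..(T - δ), ‖shiftFilter J s g t‖ ^ 2 ≤ ∫ t in (0 : ℝ)..T, ‖g t‖ ^ 2 := by
  have hF : Continuous fun t => ‖g t‖ ^ 2 := by fun_prop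
  have hF0 : ∀ t, 0 ≤ ‖g t‖ ^ 2 := fun t => sq_nonneg _
  have hI : 0 ≤ ∫ t in (0 : ℝ)..T, ‖g t‖ ^ 2 := by
    refine intervalIntegral.integral_nonneg ?_ fun t _ => hF0 t
    have : 0 ≤ (J : ℝ) * s := by positivity
    linarith
  calc ∫ t in δ..(T - δ), ‖shiftFilter J s g t‖ ^ 2
      ≤ ∫ t in δ..(T - δ), ∑ j ∈ Finset.range (J + 1),
          tentCoeff j * ((‖g (t + j * s)‖ ^ 2 + ‖g (t - j * s)‖ ^ 2) / 2) := by
        refine intervalIntegral.integral_mono_on hT ?_ ?_ fun t _ => norm_shiftFilter_sq_le J s g t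
        · exact ((continuous_shiftFilter J s hg).norm.pow 2).intervalIntegrable _ _
        · apply Continuous.intervalIntegrable
          fun_prop
    _ = ∑ j ∈ Finset.range (J + 1), tentCoeff j *
          ((∫ t in δ..(T - δ), ‖g (t + j * s)‖ ^ 2) +
            ∫ t in δ..(T - δ), ‖g (t - j * s)‖ ^ 2) / 2 := by
        rw [intervalIntegral.integral_finsetSum]
        · refine Finset.sum_congr rfl fun j _ => ?_
          rw [intervalIntegral.integral_const_mul, intervalIntegral.integral_div,
            intervalIntegral.integral_add, mul_div_assoc]
          · apply Continuous.intervalIntegrable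
            fun_prop
          · apply Continuous.intervalIntegrable
            fun_prop
        · intro j _
          apply Continuous.intervalIntegrable
          fun_prop
    _ ≤ ∑ j ∈ Finset.range (J + 1), tentCoeff j * ∫ t in (0 : ℝ)..T, ‖g t‖ ^ 2 := by
        refine Finset.sum_le_sum fun j hj => ?_
        have hjJ : (j : ℝ) * s ≤ δ := by
          refine le_trans ?_ hJ
          gcongr
          exact Nat.lt_succ_iff.mp (Finset.mem_range.mp hj)
        have hj0 : 0 ≤ (j : ℝ) * s := by positivity
        have h1 := integral_comp_add_le hF hF0 (e := j * s) (c := 0) (d := T) hT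
          (by linarith) (by linarith)
        have h2 := integral_comp_add_le hF hF0 (e := -(j * s)) (c := 0) (d := T) hT
          (by linarith) (by linarith)
        simp only [← sub_eq_add_neg] at h2
        rw [mul_div_assoc]
        exact mul_le_mul_of_nonneg_left (by linarith) (tentCoeff_nonneg j)
    _ ≤ _ := by
        rw [← Finset.sum_mul]
        exact mul_le_of_le_one_left hI (sum_tentCoeff_le_one _)

end Filter

/-! ### Isolating one frequency; the harmonic oscillator. -/

section Exponentials

open Complex

theorem exists_shift_exp_ne {α β T : ℝ} (hαβ : α ≠ β) (hT : 0 < T) :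
    ∃ σ, 0 < σ ∧ σ ≤ T ∧ exp (I * α * (σ : ℝ)) ≠ exp (I * β * (σ : ℝ)) := by
  have hd : 0 < |α - β| := abs_pos.mpr (sub_ne_zero.mpr hαβ)
  -- With this shift the phase difference is nonzero and at most 1 in modulus, hence not a multiple
  -- of `2π`.
  refine ⟨min T (1 / |α - β|), lt_min hT (by positivity), min_le_left _ _, fun h => ?_⟩
  set σ := min T (1 / |α - β|) with hσ
  have hσ0 : 0 < σ := lt_min hT (by positivity)
  have h1 : exp ((((α - β) * σ : ℝ) : ℂ) * I) = 1 := by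
    rw [show (((α - β) * σ : ℝ) : ℂ) * I = I * α * σ - I * β * σ by push_cast; ring,
      Complex.exp_sub, h, div_self (Complex.exp_ne_zero _)]
  obtain ⟨n, hn⟩ := Complex.exp_eq_one_iff.mp h1
  have h2 : (α - β) * σ = n * (2 * Real.pi) := by
    have := congrArg Complex.im hn
    simpa using this
  have h3 : |(α - β) * σ| ≤ 1 := by
    rw [abs_mul, abs_of_pos hσ0]
    calc |α - β| * σ ≤ |α - β| * (1 / |α - β|) := by
          gcongr
          exact min_le_right _ _
      _ = 1 := by field_simp
  have h4 : n ≠ 0 := by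
    rintro rfl
    simp only [Int.cast_zero, zero_mul, mul_eq_zero] at h2
    rcases h2 with h2 | h2
    · exact hαβ (sub_eq_zero.mp h2)
    · exact hσ0.ne' h2
  have h5 : (1 : ℝ) ≤ |(n : ℝ)| := by exact_mod_cast Int.one_le_abs h4
  rw [h2, abs_mul, abs_of_pos Real.two_pi_pos] at h3
  nlinarith [Real.pi_gt_three]

/-- The coefficient of an isolated frequency is controlled by the `L²` norm on any interval. -/
theorem exists_norm_coeff_sq_le {ι : Type*} [DecidableEq ι] (μ : ι → ℝ) (k : ι) (s : Finset ι)
    (hs : ∀ j ∈ s, μ j ≠ μ k) :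
    ∀ T : ℝ, 0 < T → ∃ C : ℝ, 0 < C ∧ ∀ a : ι → ℂ, ‖a k‖ ^ 2 ≤
      C * ∫ t in (0 : ℝ)..T, ‖a k * exp (I * μ k * t) + ∑ j ∈ s, a j * exp (I * μ j * t)‖ ^ 2 := by
  induction s using Finset.induction_on with
  | empty =>
    intro T hT
    refine ⟨1 / T, by positivity, fun a => ?_⟩
    have h : ∀ t : ℝ, ‖a k * exp (I * μ k * t) + ∑ j ∈ (∅ : Finset ι), a j * exp (I * μ j * t)‖ ^ 2
        = ‖a k‖ ^ 2 := by
      intro t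
      rw [Finset.sum_empty, add_zero, norm_mul,
        show I * (μ k : ℂ) * (t : ℂ) = ((μ k * t : ℝ) : ℂ) * I by push_cast; ring,
        Complex.norm_exp_ofReal_mul_I, mul_one]
    simp_rw [h]
    rw [intervalIntegral.integral_const, smul_eq_mul, sub_zero]
    field_simp
    exact le_rfl
  | insert j s hjs ih =>
    intro T hT
    have hjk : μ k ≠ μ j := (hs j (Finset.mem_insert_self j s)).symm
    -- The combination `f (t + σ) - e j * f t` kills frequency `μ j` and multiplies the coefficient
    -- of `μ k` by `e k - e j ≠ 0`. Since `σ ≤ T/2`, it is defined on `[0, T/2]` from values on `[0,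
    -- T]`.
    obtain ⟨σ, hσ0, hσT, hσ⟩ := exists_shift_exp_ne hjk (half_pos hT)
    obtain ⟨C, hC, hCa⟩ := ih (fun l hl => hs l (Finset.mem_insert_of_mem hl)) (T / 2) (half_pos hT)
    set e : ι → ℂ := fun l => exp (I * μ l * σ) with he
    have hd : 0 < ‖e k - e j‖ := norm_pos_iff.mpr (sub_ne_zero.mpr hσ)
    refine ⟨4 * C / ‖e k - e j‖ ^ 2, by positivity, fun a => ?_⟩
    set f : ℝ → ℂ := fun t =>
      a k * exp (I * μ k * t) + ∑ l ∈ insert j s, a l * exp (I * μ l * t) with hf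
    have hfc : Continuous f := by fun_prop
    have hF : Continuous fun t => ‖f t‖ ^ 2 := by fun_prop
    have hF0 : ∀ t, 0 ≤ ‖f t‖ ^ 2 := fun t => sq_nonneg _
    have hshift : ∀ (l : ι) (t : ℝ), exp (I * μ l * ((t + σ : ℝ) : ℂ)) =
        e l * exp (I * μ l * t) := by
      intro l t
      rw [he, ← Complex.exp_add]
      congr 1
      push_cast
      ring
    have hy : ∀ t : ℝ, a k * (e k - e j) * exp (I * μ k * t) +
        ∑ l ∈ s, a l * (e l - e j) * exp (I * μ l * t) = f (t + σ) - e j * f t := by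
      intro t
      simp only [hf, hshift, Finset.sum_insert hjs, mul_add, Finset.mul_sum]
      rw [show ∑ l ∈ s, a l * (e l - e j) * exp (I * μ l * t) =
          ∑ l ∈ s, a l * (e l * exp (I * μ l * t)) - ∑ l ∈ s, e j * (a l * exp (I * μ l * t)) by
        rw [← Finset.sum_sub_distrib]
        exact Finset.sum_congr rfl fun l _ => by ring]
      ring
    have hej : ‖e j‖ = 1 := by
      rw [he]
      show ‖exp (I * μ j * σ)‖ = 1
      rw [show I * (μ j : ℂ) * (σ : ℂ) = ((μ j * σ : ℝ) : ℂ) * I by push_cast; ring,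
        Complex.norm_exp_ofReal_mul_I]
    have h1 := hCa fun l => a l * (e l - e j)
    simp only [hy] at h1
    have h2 : ∫ t in (0 : ℝ)..(T / 2), ‖f (t + σ) - e j * f t‖ ^ 2 ≤
        4 * ∫ t in (0 : ℝ)..T, ‖f t‖ ^ 2 := by
      calc ∫ t in (0 : ℝ)..(T / 2), ‖f (t + σ) - e j * f t‖ ^ 2
          ≤ ∫ t in (0 : ℝ)..(T / 2), (2 * ‖f (t + σ)‖ ^ 2 + 2 * ‖f (t + 0)‖ ^ 2) := by
            refine intervalIntegral.integral_mono_on (by linarith) ?_ ?_ fun t _ => ?_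
            · apply Continuous.intervalIntegrable
              fun_prop
            · apply Continuous.intervalIntegrable
              fun_prop
            · have h := norm_sub_le (f (t + σ)) (e j * f t)
              rw [norm_mul, hej, one_mul] at h
              rw [add_zero]
              nlinarith [sq_nonneg (‖f (t + σ)‖ - ‖f t‖), norm_nonneg (f (t + σ) - e j * f t)]
        _ = 2 * (∫ t in (0 : ℝ)..(T / 2), ‖f (t + σ)‖ ^ 2) +
              2 * ∫ t in (0 : ℝ)..(T / 2), ‖f (t + 0)‖ ^ 2 := by
            rw [intervalIntegral.integral_add, intervalIntegral.integral_const_mul,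
              intervalIntegral.integral_const_mul]
            · apply Continuous.intervalIntegrable
              fun_prop
            · apply Continuous.intervalIntegrable
              fun_prop
        _ ≤ _ := by
            have h3 := integral_comp_add_le hF hF0 (a := 0) (b := T / 2) (c := 0) (d := T) (e := σ)
              (by linarith) (by linarith) (by linarith)
            have h4 := integral_comp_add_le hF hF0 (a := 0) (b := T / 2) (c := 0) (d := T) (e := 0)
              (by linarith) (by linarith) (by linarith)
            linarith
    rw [norm_mul, mul_pow] at h1
    rw [div_mul_eq_mul_div, le_div_iff₀ (by positivity)]
    nlinarith [mul_le_mul_of_nonneg_left h2 hC.le]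

/-- Solutions of the harmonic oscillator. -/
theorem exists_harmonic_coeffs {f f' : ℝ → ℂ} {ω : ℝ} (hω : 0 < ω)
    (hf : ∀ t, HasDerivAt f (f' t) t) (hf' : ∀ t, HasDerivAt f' (-((ω : ℂ) ^ 2) * f t) t) :
    ∃ A B : ℂ, ∀ t : ℝ, f t = A * exp (I * ω * t) + B * exp (I * ((-ω : ℝ) : ℂ) * t) ∧
      f' t = I * ω * (A * exp (I * ω * t) - B * exp (I * ((-ω : ℝ) : ℂ) * t)) := by
  have hωc : (ω : ℂ) ≠ 0 := by exact_mod_cast hω.ne'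
  -- Factorization of the oscillator: `f' + iνf` solves the first-order equation `g' = iνg`. The
  -- choices `ν = ±ω` then determine `f` and `f'`.
  have key : ∀ ν : ℝ, ν ^ 2 = ω ^ 2 → ∃ c : ℂ, ∀ t : ℝ, f' t + I * ν * f t = c * exp (I * ν * t) := by
    intro ν hν
    have hνc : (ν : ℂ) ^ 2 = (ω : ℂ) ^ 2 := by exact_mod_cast hν
    have hE : ∀ t : ℝ, HasDerivAt (fun t : ℝ => exp (-(I * ν) * t))
        (exp (-(I * ν) * t) * (-(I * ν) * 1)) t := fun t =>
      ((Complex.ofRealCLM.hasDerivAt (x := t)).const_mul (-(I * ν))).cexp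
    have hconst : ∀ t : ℝ, HasDerivAt (fun t : ℝ => (f' t + I * ν * f t) * exp (-(I * ν) * t)) 0 t := by
      intro t
      refine (((hf' t).add ((hf t).const_mul (I * ν))).mul (hE t)).congr_deriv ?_
      simp only [Pi.add_apply]
      rw [← hνc]
      linear_combination -(exp (-(I * ν) * t) * f t * ν ^ 2) * I_sq
    refine ⟨(f' 0 + I * ν * f 0), fun t => ?_⟩
    have h := is_const_of_deriv_eq_zero (fun t => (hconst t).differentiableAt)
      (fun t => (hconst t).deriv) t 0
    simp only [Complex.ofReal_zero, mul_zero, Complex.exp_zero, mul_one] at h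
    have hexp : exp (-(I * ν) * t) * exp (I * ν * t) = 1 := by
      rw [← Complex.exp_add, show -(I * (ν : ℂ)) * t + I * ν * t = 0 by ring, Complex.exp_zero]
    linear_combination -(f' t + I * ν * f t) * hexp + exp (I * ν * t) * h
  obtain ⟨c, hc⟩ := key ω rfl
  obtain ⟨d, hd⟩ := key (-ω) (by ring)
  refine ⟨c / (2 * I * ω), -d / (2 * I * ω), fun t => ?_⟩
  have h1 := hc t
  have h2 := hd t
  have hI := I_ne_zero
  push_cast at h2 ⊢
  generalize exp (I * ω * t) = E₁ at *
  generalize exp (I * -ω * t) = E₂ at *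
  constructor
  · field_simp
    linear_combination h1 - h2
  · field_simp
    linear_combination h1 + h2

theorem harmonic_energy (ω : ℝ) (z w : ℂ) :
    ω ^ 2 * ‖z + w‖ ^ 2 + ‖I * ω * (z - w)‖ ^ 2 = 2 * (ω ^ 2 * (‖z‖ ^ 2 + ‖w‖ ^ 2)) := by
  rw [norm_mul, norm_mul, Complex.norm_I, one_mul, Complex.norm_real, mul_pow, Real.norm_eq_abs,
    sq_abs]
  have h := parallelogram_law_with_norm ℝ z w
  linear_combination ω ^ 2 * h

end Exponentials

end QuadFEM

namespace QuadFEM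

/-! ### The dispersion relation and the group velocity. -/

section Dispersion

/-- The dispersion function: `cos η = dispersion (λ h²)` for an eigenvalue `λ` with wave number
`η / h`. -/
noncomputable def dispersion (L : ℝ) : ℝ :=
  (240 - 104 * L + 3 * L ^ 2) / (L ^ 2 + 16 * L + 240)

theorem dispersion_denom_pos (L : ℝ) : 0 < L ^ 2 + 16 * L + 240 := by nlinarith [sq_nonneg (L + 8)]

theorem dispersion_mul (L : ℝ) :
    dispersion L * (L ^ 2 + 16 * L + 240) = 240 - 104 * L + 3 * L ^ 2 :=
  div_mul_cancel₀ _ (dispersion_denom_pos L).ne'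

theorem dispersion_zero : dispersion 0 = 1 := by norm_num [dispersion]

theorem one_sub_dispersion (L : ℝ) :
    1 - dispersion L = 2 * L * (60 - L) / (L ^ 2 + 16 * L + 240) := by
  rw [eq_div_iff (dispersion_denom_pos L).ne']
  linear_combination -dispersion_mul L

theorem one_add_dispersion (L : ℝ) :
    1 + dispersion L = 4 * (10 - L) * (12 - L) / (L ^ 2 + 16 * L + 240) := by
  rw [eq_div_iff (dispersion_denom_pos L).ne']
  linear_combination dispersion_mul L

theorem dispersion_lt_one {L : ℝ} (h0 : 0 < L) (h1 : L < 10) : dispersion L < 1 := by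
  have h : 0 < 1 - dispersion L := by
    rw [one_sub_dispersion]
    exact div_pos (mul_pos (by linarith) (by linarith)) (dispersion_denom_pos L)
  linarith

theorem neg_one_lt_dispersion {L : ℝ} (h1 : L < 10) : -1 < dispersion L := by
  have h : 0 < 1 + dispersion L := by
    rw [one_add_dispersion]
    exact div_pos (mul_pos (by linarith) (by linarith)) (dispersion_denom_pos L)
  linarith

theorem hasDerivAt_dispersion (L : ℝ) :
    HasDerivAt dispersion (-(8 * (3600 - 120 * L - 19 * L ^ 2) / (L ^ 2 + 16 * L + 240) ^ 2)) L := by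
  have hD := (dispersion_denom_pos L).ne'
  have h1 : HasDerivAt (fun L : ℝ => 240 - 104 * L + 3 * L ^ 2) (-104 + 6 * L) L := by
    have := (((hasDerivAt_id L).const_mul 104).const_sub 240).add
      ((hasDerivAt_pow 2 L).const_mul 3)
    refine this.congr_deriv ?_
    norm_num
    ring
  have h2 : HasDerivAt (fun L : ℝ => L ^ 2 + 16 * L + 240) (2 * L + 16) L := by
    have := ((hasDerivAt_pow 2 L).add ((hasDerivAt_id L).const_mul 16)).add_const 240
    refine this.congr_deriv ?_
    norm_num
  refine (h1.div h2 hD).congr_deriv ?_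
  field_simp
  ring

theorem strictAntiOn_dispersion : StrictAntiOn dispersion (Set.Icc 0 4) := by
  refine strictAntiOn_of_deriv_neg (convex_Icc 0 4)
    (fun L _ => (hasDerivAt_dispersion L).continuousAt.continuousWithinAt) fun L hL => ?_
  rw [interior_Icc] at hL
  rw [(hasDerivAt_dispersion L).deriv, neg_lt_zero]
  have := dispersion_denom_pos L
  have : 0 < 3600 - 120 * L - 19 * L ^ 2 := by nlinarith [hL.1, hL.2]
  positivity

/-- The group velocity is at least `1` for `λ h² ≤ 4`. -/
theorem group_velocity_bound {L : ℝ} (h0 : 0 ≤ L) (h4 : L ≤ 4) :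
    32 * (3600 - 120 * L - 19 * L ^ 2) ^ 2 ≤
      -- The two sides agree to first order at `L = 0`, where the group velocity is exactly 1. Their
      -- difference has the factor `L²` shown below.
      (60 - L) * (10 - L) * (12 - L) * (L ^ 2 + 16 * L + 240) ^ 2 := by
  have h : 0 ≤ L ^ 2 * (2880000 - 403200 * L + L ^ 2 * (2240 + 448 * L) + L ^ 4 * (50 - L)) := by
    have h1 : 0 ≤ 2880000 - 403200 * L := by linarith
    have h2 : 0 ≤ 50 - L := by linarith
    positivity
  linear_combination h

/-- With `x = ωh`, this says that the wave number `η` grows no faster than `ωh`. A spacing `πh` of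
wave numbers thus becomes a spacing of at least `π` of frequencies. It follows from the mean value
inequality and `group_velocity_bound`. -/
theorem arccos_dispersion_sub_le {x y : ℝ} (hx : 0 ≤ x) (hxy : x ≤ y) (hy : y ≤ 2) :
    Real.arccos (dispersion (y ^ 2)) - Real.arccos (dispersion (x ^ 2)) ≤ y - x := by
  have hcont : Continuous fun x : ℝ => dispersion (x ^ 2) :=
    (continuous_iff_continuousAt.mpr fun L => (hasDerivAt_dispersion L).continuousAt).comp
      (continuous_pow 2)
  have hder : ∀ z ∈ interior (Set.Icc (0 : ℝ) 2),
      HasDerivAt (fun x : ℝ => Real.arccos (dispersion (x ^ 2)))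
        (-(1 / √(1 - dispersion (z ^ 2) ^ 2)) *
          (-(8 * (3600 - 120 * z ^ 2 - 19 * (z ^ 2) ^ 2) / ((z ^ 2) ^ 2 + 16 * z ^ 2 + 240) ^ 2) *
            (2 * z))) z := by
    intro z hz
    rw [interior_Icc] at hz
    have h1 : 0 < z ^ 2 := by have := hz.1; positivity
    have h2 : z ^ 2 < 10 := by nlinarith [hz.1, hz.2]
    have ha := Real.hasDerivAt_arccos (x := dispersion (z ^ 2)) (neg_one_lt_dispersion h2).ne'
      (dispersion_lt_one h1 h2).ne
    have hp : HasDerivAt (fun x : ℝ => x ^ 2) (2 * z) z := by simpa using hasDerivAt_pow 2 z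
    exact HasDerivAt.comp (h₂ := Real.arccos) (h := fun x : ℝ => dispersion (x ^ 2)) z ha
      (HasDerivAt.comp (h₂ := dispersion) (h := fun x : ℝ => x ^ 2) z
        (hasDerivAt_dispersion (z ^ 2)) hp)
  have h := (convex_Icc (0 : ℝ) 2).image_sub_le_mul_sub_of_deriv_le
    (f := fun x : ℝ => Real.arccos (dispersion (x ^ 2))) (C := 1)
    (Real.continuous_arccos.comp hcont).continuousOn
    (fun z hz => (hder z hz).differentiableAt.differentiableWithinAt) (fun z hz => ?_)
    x ⟨hx, by linarith⟩ y ⟨by linarith, hy⟩ hxy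
  · linarith
  · rw [(hder z hz).deriv]
    rw [interior_Icc] at hz
    obtain ⟨hz0, hz2⟩ := hz
    set L := z ^ 2 with hL
    have hL0 : 0 < L := by positivity
    have hL4 : L ≤ 4 := by nlinarith
    have hD := dispersion_denom_pos L
    set q := 3600 - 120 * L - 19 * L ^ 2 with hq
    have hq0 : 0 < q := by nlinarith
    set D := L ^ 2 + 16 * L + 240 with hDdef
    have hs : 1 - dispersion L ^ 2 = 8 * L * (60 - L) * (10 - L) * (12 - L) / D ^ 2 := by
      rw [show 1 - dispersion L ^ 2 = (1 - dispersion L) * (1 + dispersion L) by ring,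
        one_sub_dispersion, one_add_dispersion]
      field_simp
      ring
    have hspos : 0 < 1 - dispersion L ^ 2 := by
      rw [hs]
      have h1 : 0 < 60 - L := by linarith
      have h2 : 0 < 10 - L := by linarith
      have h3 : 0 < 12 - L := by linarith
      positivity
    -- The derivative of `arccos ∘ dispersion` is at most 1. After squaring, `1 - dispersion²`
    -- factors explicitly and the claim becomes the polynomial inequality.
    have hkey : 8 * q / D ^ 2 * (2 * z) ≤ √(1 - dispersion L ^ 2) := by
      apply Real.le_sqrt_of_sq_le
      rw [hs, show (8 * q / D ^ 2 * (2 * z)) ^ 2 = 8 * L * (32 * q ^ 2) / (D ^ 2 * D ^ 2) by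
        rw [hL]; field_simp; ring, div_le_div_iff₀ (by positivity) (by positivity)]
      have h := group_velocity_bound hL0.le hL4
      have h' := mul_le_mul_of_nonneg_left h (by positivity : 0 ≤ 8 * L * D ^ 2)
      calc 8 * L * (32 * q ^ 2) * D ^ 2 = 8 * L * D ^ 2 * (32 * q ^ 2) := by ring
        _ ≤ _ := h'
        _ = _ := by ring
    rw [show -(1 / √(1 - dispersion L ^ 2)) * (-(8 * q / D ^ 2) * (2 * z)) =
      8 * q / D ^ 2 * (2 * z) / √(1 - dispersion L ^ 2) by ring]
    exact div_le_one_of_le₀ hkey (Real.sqrt_nonneg _)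

/-- A lower bound for `sin² η`. It bounds from below both the boundary trace of a low mode and its
coupling with bi-grid data; the constant is not sharp. -/
theorem le_one_sub_dispersion_sq {L : ℝ} (h0 : 0 ≤ L) (h1 : L ≤ 5 / 2) :
    L / 10 ≤ 1 - dispersion L ^ 2 := by
  have hD := dispersion_denom_pos L
  have hs : 1 - dispersion L ^ 2 =
      8 * L * (60 - L) * (10 - L) * (12 - L) / (L ^ 2 + 16 * L + 240) ^ 2 := by
    rw [show 1 - dispersion L ^ 2 = (1 - dispersion L) * (1 + dispersion L) by ring,
      one_sub_dispersion, one_add_dispersion]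
    field_simp
    ring
  have hD2 : L ^ 2 + 16 * L + 240 ≤ 290 := by nlinarith
  have h2 : (57 : ℝ) * 7 * 9 ≤ (60 - L) * (10 - L) * (12 - L) := by
    have e1 : (57 : ℝ) ≤ 60 - L := by linarith
    have e2 : (7 : ℝ) ≤ 10 - L := by linarith
    have e3 : (9 : ℝ) ≤ 12 - L := by linarith
    gcongr
  rw [hs, div_le_div_iff₀ (by norm_num) (by positivity)]
  have h3 : (L ^ 2 + 16 * L + 240) ^ 2 ≤ 290 ^ 2 := by gcongr
  calc L * (L ^ 2 + 16 * L + 240) ^ 2 ≤ L * 290 ^ 2 := by gcongr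
    _ ≤ 80 * L * (57 * 7 * 9) := by nlinarith
    _ ≤ 80 * L * ((60 - L) * (10 - L) * (12 - L)) := by gcongr
    _ = _ := by ring

/-- `dispersion (5/2)` is slightly negative, so every wave number `η ≤ π/2` is reached with `λh² ≤
5/2`. This is the origin of the threshold `5/2`. -/
theorem exists_dispersion_eq {c : ℝ} (h0 : 0 ≤ c) (h1 : c < 1) :
    ∃ L, 0 < L ∧ L ≤ 5 / 2 ∧ dispersion L = c := by
  have hcont : Continuous dispersion :=
    continuous_iff_continuousAt.mpr fun L => (hasDerivAt_dispersion L).continuousAt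
  have hmem : c ∈ Set.Icc (dispersion (5 / 2)) (dispersion 0) :=
    ⟨by norm_num [dispersion]; linarith, by rw [dispersion_zero]; exact h1.le⟩
  obtain ⟨L, hL, hLc⟩ := intermediate_value_Icc' (by norm_num) hcont.continuousOn hmem
  refine ⟨L, lt_of_le_of_ne hL.1 ?_, hL.2, hLc⟩
  rintro rfl
  rw [dispersion_zero] at hLc
  linarith

end Dispersion

end QuadFEM

namespace QuadFEM

/-! ### Quadratic forms of the mass and stiffness matrices, and their joint diagonalization. -/

section Pentadiagonal

open scoped ComplexOrder

/-- Entries of a pentadiagonal matrix of the shape shared by the mass and stiffness matrices. -/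
def pentaEntry (a b c d : ℝ) (p q : ℕ) : ℝ :=
  if p = q then (if Odd p then a else b)
  else if p + 1 = q ∨ q + 1 = p then c
  else if (p + 2 = q ∨ q + 2 = p) ∧ Even p then d
  else 0

theorem pentaEntry_comm (a b c d : ℝ) (p q : ℕ) : pentaEntry a b c d p q = pentaEntry a b c d q p := by
  unfold pentaEntry
  by_cases h1 : p = q
  · subst h1; rfl
  · have h1' : ¬ q = p := fun h => h1 h.symm
    rw [if_neg h1, if_neg h1']
    by_cases h2 : p + 1 = q ∨ q + 1 = p
    · rw [if_pos h2, if_pos h2.symm]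
    · rw [if_neg h2, if_neg (mt Or.symm h2)]
      refine if_congr ⟨fun h => ⟨h.1.symm, ?_⟩, fun h => ⟨h.1.symm, ?_⟩⟩ rfl rfl
      · obtain ⟨rfl | rfl, h⟩ := h <;> simpa [Nat.even_add] using h
      · obtain ⟨rfl | rfl, h⟩ := h <;> simpa [Nat.even_add] using h

/-- The pentadiagonal matrix with entries `pentaEntry`. -/
def pentaMatrix (N : ℕ) (a b c d : ℝ) : Matrix (Fin (2 * N + 1)) (Fin (2 * N + 1)) ℂ :=
  Matrix.of fun i j => (pentaEntry a b c d (i.val + 1) (j.val + 1) : ℂ)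

theorem massMatrix_eq (N : ℕ) : massMatrix N = pentaMatrix N (8 * meshSize N / 15)
    (4 * meshSize N / 15) (meshSize N / 15) (-(meshSize N / 30)) := rfl

theorem stiffMatrix_eq (N : ℕ) : stiffMatrix N = pentaMatrix N (16 / (3 * meshSize N))
    (14 / (3 * meshSize N)) (-(8 / (3 * meshSize N))) (1 / (3 * meshSize N)) := rfl

theorem isHermitian_pentaMatrix (N : ℕ) (a b c d : ℝ) : (pentaMatrix N a b c d).IsHermitian := by
  ext i j
  simp only [Matrix.conjTranspose_apply, pentaMatrix, Matrix.of_apply, Complex.star_def,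
    Complex.conj_ofReal]
  rw [pentaEntry_comm]

variable {N : ℕ}

theorem halfVal_succ (F : DiscreteVec N) (i : Fin (2 * N + 1)) : halfVal N F (i + 1) = F i := by
  have h : 1 ≤ (i : ℕ) + 1 ∧ (i : ℕ) + 1 ≤ 2 * N + 1 := ⟨by omega, by omega⟩
  rw [halfVal, dif_pos h]
  rfl

theorem halfVal_zero (F : DiscreteVec N) : halfVal N F 0 = 0 := by simp [halfVal]

theorem halfVal_of_lt (F : DiscreteVec N) {p : ℕ} (hp : 2 * N + 1 < p) : halfVal N F p = 0 := by
  rw [halfVal, dif_neg]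
  omega

/-- Padding with the zero boundary values at `q = 0` and `q = 2N + 2` gives every row its complete
stencil, with no special case at the boundary. -/
theorem sum_row_eq_range (e : ℕ → ℝ) (F : DiscreteVec N) :
    ∑ j : Fin (2 * N + 1), (e (j + 1) : ℂ) * F j =
      ∑ q ∈ Finset.range (2 * N + 3), (e q : ℂ) * halfVal N F q := by
  rw [Finset.sum_range_succ, halfVal_of_lt F (by omega), mul_zero, add_zero, Finset.sum_range_succ',
    halfVal_zero, mul_zero, add_zero,
    ← Fin.sum_univ_eq_sum_range (fun q => (e (q + 1) : ℂ) * halfVal N F (q + 1))]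
  simp only [halfVal_succ]

theorem pentaEntry_odd (a b c d : ℝ) (k q : ℕ) : pentaEntry a b c d (2 * k + 1) q =
    (if q = 2 * k + 1 then a else 0) + (if q = 2 * k then c else 0) +
      (if q = 2 * k + 2 then c else 0) := by
  have ho : Odd (2 * k + 1) := ⟨k, rfl⟩
  have he : ¬ Even (2 * k + 1) := by simp
  unfold pentaEntry
  simp only [ho, he, if_true, and_false, if_false]
  split_ifs <;> first | omega | simp

theorem pentaEntry_even (a b c d : ℝ) (k q : ℕ) : pentaEntry a b c d (2 * k + 2) q =
    (if q = 2 * k + 2 then b else 0) + (if q = 2 * k + 1 then c else 0) +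
      (if q = 2 * k + 3 then c else 0) + (if q = 2 * k then d else 0) +
      (if q = 2 * k + 4 then d else 0) := by
  have he : Even (2 * k + 2) := ⟨k + 1, by ring⟩
  have ho : ¬ Odd (2 * k + 2) := by simpa using he
  unfold pentaEntry
  simp only [ho, he, and_true, if_false]
  split_ifs <;> first | omega | simp

theorem pentaMatrix_mulVec_odd (a b c d : ℝ) (F : DiscreteVec N) (k : ℕ) (hk : 2 * k < 2 * N + 1) :
    (pentaMatrix N a b c d *ᵥ F) ⟨2 * k, hk⟩ =
      a * halfVal N F (2 * k + 1) + c * (halfVal N F (2 * k) + halfVal N F (2 * k + 2)) := by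
  show ∑ j : Fin (2 * N + 1), (pentaEntry a b c d (2 * k + 1) (j + 1) : ℂ) * F j = _
  rw [sum_row_eq_range]
  simp only [pentaEntry_odd, Complex.ofReal_add, add_mul, Finset.sum_add_distrib,
    apply_ite Complex.ofReal, Complex.ofReal_zero, ite_mul, zero_mul, Finset.sum_ite_eq',
    Finset.mem_range]
  rw [if_pos (by omega), if_pos (by omega), if_pos (by omega)]
  ring

theorem pentaMatrix_mulVec_even (a b c d : ℝ) (F : DiscreteVec N) (k : ℕ)
    (hk : 2 * k + 1 < 2 * N + 1) :
    (pentaMatrix N a b c d *ᵥ F) ⟨2 * k + 1, hk⟩ =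
      b * halfVal N F (2 * k + 2) + c * (halfVal N F (2 * k + 1) + halfVal N F (2 * k + 3)) +
        d * (halfVal N F (2 * k) + halfVal N F (2 * k + 4)) := by
  show ∑ j : Fin (2 * N + 1), (pentaEntry a b c d (2 * k + 2) (j + 1) : ℂ) * F j = _
  rw [sum_row_eq_range]
  simp only [pentaEntry_even, Complex.ofReal_add, add_mul, Finset.sum_add_distrib,
    apply_ite Complex.ofReal, Complex.ofReal_zero, ite_mul, zero_mul, Finset.sum_ite_eq',
    Finset.mem_range]
  rw [if_pos (by omega), if_pos (by omega), if_pos (by omega), if_pos (by omega),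
    if_pos (by omega)]
  ring

theorem sum_fin_odd_eq (N : ℕ) (f : ℕ → ℂ) : ∑ i : Fin (2 * N + 1), f i =
    ∑ k ∈ Finset.range (N + 1), f (2 * k) + ∑ k ∈ Finset.range N, f (2 * k + 1) := by
  rw [Fin.sum_univ_eq_sum_range]
  induction N with
  | zero => simp
  | succ N ih =>
    rw [show 2 * (N + 1) + 1 = 2 * N + 1 + 1 + 1 by ring, Finset.sum_range_succ,
      Finset.sum_range_succ, ih, Finset.sum_range_succ (fun k => f (2 * k)) (N + 1),
      Finset.sum_range_succ (fun k => f (2 * k + 1)) N, show 2 * (N + 1) = 2 * N + 1 + 1 by ring]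
    ring

/-- The form of a single element, on real nodal and midpoint values. -/
noncomputable def elementForm (a b c d x m y : ℝ) : ℝ :=
  a * m ^ 2 + b / 2 * (x ^ 2 + y ^ 2) + 2 * c * (m * (x + y)) + 2 * d * (x * y)

/-- Assembly by elements: each nodal diagonal entry `b` is shared equally by its two neighbouring
cells. The boundary term at the right end vanishes once `2n` is the last grid point. -/
theorem penta_telescope (a b c d : ℝ) (u : ℕ → ℂ) (hu : u 0 = 0) (n : ℕ) :
    ∑ k ∈ Finset.range n, ((a * u (2 * k + 1) + c * (u (2 * k) + u (2 * k + 2))) *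
        (starRingEnd ℂ) (u (2 * k + 1)) +
      (b * u (2 * k + 2) + c * (u (2 * k + 1) + u (2 * k + 3)) +
        d * (u (2 * k) + u (2 * k + 4))) * (starRingEnd ℂ) (u (2 * k + 2))) =
    ∑ k ∈ Finset.range n,
      ((elementForm a b c d (u (2 * k)).re (u (2 * k + 1)).re (u (2 * k + 2)).re +
        elementForm a b c d (u (2 * k)).im (u (2 * k + 1)).im (u (2 * k + 2)).im : ℝ) : ℂ) +
      (b / 2 * u (2 * n) + c * u (2 * n + 1) + d * u (2 * n + 2)) * (starRingEnd ℂ) (u (2 * n)) := by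
  induction n with
  | zero => simp [hu]
  | succ n ih =>
    rw [Finset.sum_range_succ, ih, Finset.sum_range_succ, show 2 * (n + 1) = 2 * n + 2 by ring,
      show 2 * n + 2 + 1 = 2 * n + 3 by ring, show 2 * n + 2 + 2 = 2 * n + 4 by ring]
    generalize u (2 * n) = x
    generalize u (2 * n + 1) = m
    generalize u (2 * n + 2) = y
    generalize u (2 * n + 3) = z
    generalize u (2 * n + 4) = w
    have key : (a * m + c * (x + y)) * (starRingEnd ℂ) m +
        (b / 2 * y + c * m + d * x) * (starRingEnd ℂ) y +
        (b / 2 * x + c * m + d * y) * (starRingEnd ℂ) x =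
        ((elementForm a b c d x.re m.re y.re + elementForm a b c d x.im m.im y.im : ℝ) : ℂ) := by
      unfold elementForm
      apply Complex.ext
      · simp [sq]
        ring
      · simp [sq]
        ring
    linear_combination key

theorem pentaMatrix_form (a b c d : ℝ) (F : DiscreteVec N) :
    (pentaMatrix N a b c d *ᵥ F) ⬝ᵥ star F = ((∑ k ∈ Finset.range (N + 1),
      (elementForm a b c d (halfVal N F (2 * k)).re (halfVal N F (2 * k + 1)).re
          (halfVal N F (2 * k + 2)).re +
        elementForm a b c d (halfVal N F (2 * k)).im (halfVal N F (2 * k + 1)).im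
          (halfVal N F (2 * k + 2)).im) : ℝ) : ℂ) := by
  set u := halfVal N F with hu
  have h1 : (pentaMatrix N a b c d *ᵥ F) ⬝ᵥ star F = ∑ i : Fin (2 * N + 1),
      (if hi : (i : ℕ) < 2 * N + 1 then (pentaMatrix N a b c d *ᵥ F) ⟨i, hi⟩ else 0) *
        (starRingEnd ℂ) (u (i + 1)) := by
    refine Finset.sum_congr rfl fun i _ => ?_
    rw [dif_pos i.2, hu, halfVal_succ]
    rfl
  rw [h1, sum_fin_odd_eq N fun i => (if hi : i < 2 * N + 1 then
      (pentaMatrix N a b c d *ᵥ F) ⟨i, hi⟩ else 0) * (starRingEnd ℂ) (u (i + 1))]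
  have ho : ∀ k ∈ Finset.range (N + 1), (if hi : 2 * k < 2 * N + 1 then
      (pentaMatrix N a b c d *ᵥ F) ⟨2 * k, hi⟩ else 0) * (starRingEnd ℂ) (u (2 * k + 1)) =
      (a * u (2 * k + 1) + c * (u (2 * k) + u (2 * k + 2))) * (starRingEnd ℂ) (u (2 * k + 1)) := by
    intro k hk
    have hk' : 2 * k < 2 * N + 1 := by have := Finset.mem_range.mp hk; omega
    rw [dif_pos hk', pentaMatrix_mulVec_odd]
  have he : ∀ k ∈ Finset.range N, (if hi : 2 * k + 1 < 2 * N + 1 then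
      (pentaMatrix N a b c d *ᵥ F) ⟨2 * k + 1, hi⟩ else 0) *
        (starRingEnd ℂ) (u (2 * k + 1 + 1)) =
      (b * u (2 * k + 2) + c * (u (2 * k + 1) + u (2 * k + 3)) + d * (u (2 * k) + u (2 * k + 4))) *
        (starRingEnd ℂ) (u (2 * k + 2)) := by
    intro k hk
    have hk' : 2 * k + 1 < 2 * N + 1 := by have := Finset.mem_range.mp hk; omega
    rw [dif_pos hk', pentaMatrix_mulVec_even]
  rw [Finset.sum_congr rfl ho, Finset.sum_congr rfl he]
  have ht := penta_telescope a b c d u (halfVal_zero F) (N + 1)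
  have hz : u (2 * N + 2) = 0 := halfVal_of_lt F (by omega)
  have hz' : u (2 * (N + 1)) = 0 := hz
  rw [Finset.sum_add_distrib, Finset.sum_range_succ (fun k => (b * u (2 * k + 2) +
    c * (u (2 * k + 1) + u (2 * k + 3)) + d * (u (2 * k) + u (2 * k + 4))) *
        (starRingEnd ℂ) (u (2 * k + 2))), hz, hz', map_zero, mul_zero, mul_zero, add_zero,
    add_zero] at ht
  rw [ht, Complex.ofReal_sum]

theorem meshSize_pos (N : ℕ) : 0 < meshSize N := by unfold meshSize; positivity

/-- The quadratic form of the mass matrix. -/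
noncomputable def massForm (N : ℕ) (F : DiscreteVec N) : ℝ := ((massMatrix N *ᵥ F) ⬝ᵥ star F).re

/-- The quadratic form of the stiffness matrix. -/
noncomputable def stiffForm (N : ℕ) (F : DiscreteVec N) : ℝ := ((stiffMatrix N *ᵥ F) ⬝ᵥ star F).re

theorem norm_sq_eq_re_im (z : ℂ) : ‖z‖ ^ 2 = z.re ^ 2 + z.im ^ 2 := by
  rw [← Complex.normSq_eq_norm_sq, Complex.normSq_apply]
  ring

theorem mass_elementForm_lower {h : ℝ} (hh : 0 < h) (x m y : ℝ) :
    h / 15 * (x ^ 2 + m ^ 2 + y ^ 2) ≤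
      elementForm (8 * h / 15) (4 * h / 15) (h / 15) (-(h / 30)) x m y := by
  have e : elementForm (8 * h / 15) (4 * h / 15) (h / 15) (-(h / 30)) x m y -
      h / 15 * (x ^ 2 + m ^ 2 + y ^ 2) = h / 30 * ((x + 2 * m) ^ 2 + (y + 2 * m) ^ 2 +
        (x - y) ^ 2 + 6 * m ^ 2) := by
    unfold elementForm; ring
  have : 0 ≤ h / 30 * ((x + 2 * m) ^ 2 + (y + 2 * m) ^ 2 + (x - y) ^ 2 + 6 * m ^ 2) := by
    positivity
  linarith

theorem mass_elementForm_upper {h : ℝ} (hh : 0 < h) (x m y : ℝ) :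
    elementForm (8 * h / 15) (4 * h / 15) (h / 15) (-(h / 30)) x m y ≤
      h * (x ^ 2 + m ^ 2 + y ^ 2) := by
  have e : h * (x ^ 2 + m ^ 2 + y ^ 2) -
      elementForm (8 * h / 15) (4 * h / 15) (h / 15) (-(h / 30)) x m y =
      h / 30 * ((x - 2 * m) ^ 2 + (y - 2 * m) ^ 2 + (x + y) ^ 2 + 24 * x ^ 2 + 24 * y ^ 2 +
        6 * m ^ 2) := by
    unfold elementForm; ring
  have : 0 ≤ h / 30 * ((x - 2 * m) ^ 2 + (y - 2 * m) ^ 2 + (x + y) ^ 2 + 24 * x ^ 2 +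
      24 * y ^ 2 + 6 * m ^ 2) := by
    positivity
  linarith

theorem stiff_elementForm {h : ℝ} (hh : 0 < h) (x m y : ℝ) :
    elementForm (16 / (3 * h)) (14 / (3 * h)) (-(8 / (3 * h))) (1 / (3 * h)) x m y =
      1 / (3 * h) * ((4 * m - 2 * (x + y)) ^ 2 + 3 * (x - y) ^ 2) := by
  unfold elementForm
  field_simp
  ring

/-- The difference is a sum of squares on each cell. Summed, it confines the whole spectrum to `λh²
≤ 60`, a range on which the time filter is still controlled. -/
theorem stiff_elementForm_le_mass {h : ℝ} (hh : 0 < h) (x m y : ℝ) :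
    elementForm (16 / (3 * h)) (14 / (3 * h)) (-(8 / (3 * h))) (1 / (3 * h)) x m y ≤
      60 / h ^ 2 * elementForm (8 * h / 15) (4 * h / 15) (h / 15) (-(h / 30)) x m y := by
  have e : 60 / h ^ 2 * elementForm (8 * h / 15) (4 * h / 15) (h / 15) (-(h / 30)) x m y -
      elementForm (16 / (3 * h)) (14 / (3 * h)) (-(8 / (3 * h))) (1 / (3 * h)) x m y =
      1 / (3 * h) * (5 * (4 * m + (x + y)) ^ 2 + 12 * (x - y) ^ 2) := by
    unfold elementForm
    field_simp
    ring
  have : 0 ≤ 1 / (3 * h) * (5 * (4 * m + (x + y)) ^ 2 + 12 * (x - y) ^ 2) := by positivity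
  linarith

theorem massForm_lower (F : DiscreteVec N) : meshSize N / 15 * ∑ k ∈ Finset.range (N + 1),
    (‖halfVal N F (2 * k)‖ ^ 2 + ‖halfVal N F (2 * k + 1)‖ ^ 2 + ‖halfVal N F (2 * k + 2)‖ ^ 2) ≤
      massForm N F := by
  rw [massForm, massMatrix_eq, pentaMatrix_form, Complex.ofReal_re, Finset.mul_sum]
  refine Finset.sum_le_sum fun k _ => ?_
  simp only [norm_sq_eq_re_im]
  refine le_trans (le_of_eq ?_) (add_le_add (mass_elementForm_lower (meshSize_pos N) _ _ _)
    (mass_elementForm_lower (meshSize_pos N) _ _ _))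
  ring

theorem massForm_upper (F : DiscreteVec N) : massForm N F ≤
    meshSize N * ∑ k ∈ Finset.range (N + 1),
      (‖halfVal N F (2 * k)‖ ^ 2 + ‖halfVal N F (2 * k + 1)‖ ^ 2 +
        ‖halfVal N F (2 * k + 2)‖ ^ 2) := by
  rw [massForm, massMatrix_eq, pentaMatrix_form, Complex.ofReal_re, Finset.mul_sum]
  refine Finset.sum_le_sum fun k _ => ?_
  simp only [norm_sq_eq_re_im]
  refine (add_le_add (mass_elementForm_upper (meshSize_pos N) _ _ _)
    (mass_elementForm_upper (meshSize_pos N) _ _ _)).trans (le_of_eq ?_)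
  ring

/-- An inverse estimate, crude but valid for every superposition of modes. It bounds the trace of
the filtered high-frequency part. -/
theorem halfVal_sq_le_massForm (F : DiscreteVec N) (p : ℕ) :
    meshSize N / 15 * ‖halfVal N F p‖ ^ 2 ≤ massForm N F := by
  have hh := meshSize_pos N
  refine le_trans ?_ (massForm_lower F)
  refine mul_le_mul_of_nonneg_left ?_ (by positivity)
  by_cases hp : 2 * N + 1 < p
  · rw [halfVal_of_lt F hp]
    rw [norm_zero, zero_pow two_ne_zero]
    positivity
  · have hk : p / 2 ∈ Finset.range (N + 1) := Finset.mem_range.mpr (by omega)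
    refine le_trans ?_ (Finset.single_le_sum (f := fun k => ‖halfVal N F (2 * k)‖ ^ 2 +
      ‖halfVal N F (2 * k + 1)‖ ^ 2 + ‖halfVal N F (2 * k + 2)‖ ^ 2)
      (fun k _ => by positivity) hk)
    have h2 := sq_nonneg ‖halfVal N F (2 * (p / 2) + 2)‖
    rcases Nat.mod_two_eq_zero_or_one p with h | h
    · have : 2 * (p / 2) = p := by omega
      have h1 := sq_nonneg ‖halfVal N F (2 * (p / 2) + 1)‖
      simp only [this] at *
      linarith
    · have : 2 * (p / 2) + 1 = p := by omega
      have h1 := sq_nonneg ‖halfVal N F (2 * (p / 2))‖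
      simp only [this] at *
      linarith

theorem stiffForm_eq (F : DiscreteVec N) : stiffForm N F = ∑ k ∈ Finset.range (N + 1),
    1 / (3 * meshSize N) * (‖4 * halfVal N F (2 * k + 1) -
        2 * (halfVal N F (2 * k) + halfVal N F (2 * k + 2))‖ ^ 2 +
      3 * ‖halfVal N F (2 * k) - halfVal N F (2 * k + 2)‖ ^ 2) := by
  rw [stiffForm, stiffMatrix_eq, pentaMatrix_form, Complex.ofReal_re]
  refine Finset.sum_congr rfl fun k _ => ?_
  rw [stiff_elementForm (meshSize_pos N), stiff_elementForm (meshSize_pos N), norm_sq_eq_re_im,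
    norm_sq_eq_re_im]
  simp
  ring

theorem stiffForm_le_massForm (F : DiscreteVec N) :
    stiffForm N F ≤ 60 / meshSize N ^ 2 * massForm N F := by
  rw [stiffForm, massForm, massMatrix_eq, stiffMatrix_eq, pentaMatrix_form, pentaMatrix_form,
    Complex.ofReal_re, Complex.ofReal_re, Finset.mul_sum]
  refine Finset.sum_le_sum fun k _ => ?_
  rw [mul_add]
  exact add_le_add (stiff_elementForm_le_mass (meshSize_pos N) _ _ _)
    (stiff_elementForm_le_mass (meshSize_pos N) _ _ _)

theorem eq_zero_of_halfVal {F : DiscreteVec N} (h : ∀ p, halfVal N F p = 0) : F = 0 := by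
  funext i
  rw [← halfVal_succ F i, h, Pi.zero_apply]

theorem massForm_pos {F : DiscreteVec N} (hF : F ≠ 0) : 0 < massForm N F := by
  have hh := meshSize_pos N
  by_contra hneg
  refine hF (eq_zero_of_halfVal fun p => ?_)
  by_contra hp
  have h1 := halfVal_sq_le_massForm F p
  have : 0 < ‖halfVal N F p‖ := norm_pos_iff.mpr hp
  have : 0 < meshSize N / 15 * ‖halfVal N F p‖ ^ 2 := by positivity
  linarith

theorem stiffForm_pos {F : DiscreteVec N} (hF : F ≠ 0) : 0 < stiffForm N F := by
  have hh := meshSize_pos N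
  have hterm : ∀ k ∈ Finset.range (N + 1), 0 ≤ 1 / (3 * meshSize N) *
      (‖4 * halfVal N F (2 * k + 1) - 2 * (halfVal N F (2 * k) + halfVal N F (2 * k + 2))‖ ^ 2 +
      3 * ‖halfVal N F (2 * k) - halfVal N F (2 * k + 2)‖ ^ 2) := fun k _ => by positivity
  refine lt_of_le_of_ne ?_ fun h0 => hF ?_
  · rw [stiffForm_eq]
    exact Finset.sum_nonneg hterm
  · rw [stiffForm_eq, eq_comm, Finset.sum_eq_zero_iff_of_nonneg hterm] at h0
    -- Zero energy forces equal nodal values across each cell and the midpoint equal to their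
    -- average, so the zero at the left end propagates everywhere.
    have hstep : ∀ k ≤ N, halfVal N F (2 * k) = halfVal N F (2 * k + 2) ∧
        4 * halfVal N F (2 * k + 1) = 2 * (halfVal N F (2 * k) + halfVal N F (2 * k + 2)) := by
      intro k hk
      have h1 := h0 k (Finset.mem_range.mpr (by omega))
      rw [mul_eq_zero] at h1
      have h2 := h1.resolve_left (by positivity)
      have h3 := sq_nonneg ‖4 * halfVal N F (2 * k + 1) -
        2 * (halfVal N F (2 * k) + halfVal N F (2 * k + 2))‖
      have h4 := sq_nonneg ‖halfVal N F (2 * k) - halfVal N F (2 * k + 2)‖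
      have h5 : ‖4 * halfVal N F (2 * k + 1) -
        2 * (halfVal N F (2 * k) + halfVal N F (2 * k + 2))‖ ^ 2 = 0 := by linarith
      have h6 : ‖halfVal N F (2 * k) - halfVal N F (2 * k + 2)‖ ^ 2 = 0 := by linarith
      rw [sq_eq_zero_iff, norm_eq_zero, sub_eq_zero] at h5 h6
      exact ⟨h6, h5⟩
    have heven : ∀ k ≤ N + 1, halfVal N F (2 * k) = 0 := by
      intro k
      induction k with
      | zero => intro _; exact halfVal_zero F
      | succ k ih =>
        intro hk
        rw [show 2 * (k + 1) = 2 * k + 2 by ring, ← (hstep k (by omega)).1]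
        exact ih (by omega)
    refine eq_zero_of_halfVal fun p => ?_
    by_cases hp : 2 * N + 1 < p
    · exact halfVal_of_lt F hp
    · rcases Nat.even_or_odd' p with ⟨k, rfl | rfl⟩
      · exact heven k (by omega)
      · have h1 := (hstep k (by omega)).2
        rw [heven k (by omega), show 2 * k + 2 = 2 * (k + 1) by ring, heven (k + 1) (by omega),
          add_zero, mul_zero] at h1
        exact (mul_eq_zero.mp h1).resolve_left (by norm_num)

theorem pentaMatrix_posDef {a b c d : ℝ}
    (h : ∀ F : DiscreteVec N, F ≠ 0 → 0 < ((pentaMatrix N a b c d *ᵥ F) ⬝ᵥ star F).re) :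
    (pentaMatrix N a b c d).PosDef := by
  refine Matrix.PosDef.of_dotProduct_mulVec_pos (isHermitian_pentaMatrix N a b c d) fun F hF => ?_
  rw [dotProduct_comm]
  have h1 := h F hF
  rw [pentaMatrix_form, Complex.ofReal_re] at h1
  rw [pentaMatrix_form]
  exact_mod_cast h1

theorem massMatrix_posDef (N : ℕ) : (massMatrix N).PosDef :=
  pentaMatrix_posDef fun _ hF => massForm_pos hF

theorem stiffMatrix_posDef (N : ℕ) : (stiffMatrix N).PosDef :=
  pentaMatrix_posDef fun _ hF => stiffForm_pos hF

theorem discreteNormSq_one (F : DiscreteVec N) : discreteNormSq N 1 F = stiffForm N F := by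
  simp [discreteNormSq, discreteInner, stiffForm]

theorem discreteNormSq_zero (F : DiscreteVec N) : discreteNormSq N 0 F = massForm N F := by
  have hdet : IsUnit (stiffMatrix N).det :=
    (Matrix.isUnit_iff_isUnit_det _).mp (stiffMatrix_posDef N).isUnit
  simp only [discreteNormSq, discreteInner, massForm, sub_zero, zpow_one]
  rw [Matrix.mul_assoc, Matrix.nonsing_inv_mul _ hdet, Matrix.mul_one]

theorem energy_eq (F G : DiscreteVec N) :
    energy N F G = (stiffForm N F + massForm N G) / 2 := by
  rw [energy, discreteNormSq_one, discreteNormSq_zero]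
  ring

/-- Simultaneous diagonalization of a positive definite and a Hermitian matrix. -/
theorem exists_generalized_eigenbasis {n : Type*} [Fintype n] [DecidableEq n] {M S : Matrix n n ℂ}
    (hM : M.PosDef) (hS : S.IsHermitian) : ∃ (E : Matrix n n ℂ) (ev : n → ℝ),
      Eᴴ * M * E = 1 ∧ S * E = M * E * Matrix.diagonal fun i => (ev i : ℂ) := by
  obtain ⟨B, hB⟩ : ∃ B : Matrix n n ℂ, M = Bᴴ * B := by
    open scoped MatrixOrder in
    exact CStarAlgebra.nonneg_iff_eq_star_mul_self.mp hM.posSemidef.nonneg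
  have hBdet : IsUnit B.det := by
    have h := (Matrix.isUnit_iff_isUnit_det _).mp hM.isUnit
    rw [hB, Matrix.det_mul] at h
    exact isUnit_of_mul_isUnit_right h
  have hBB : B * B⁻¹ = 1 := Matrix.mul_nonsing_inv _ hBdet
  have hBB' : (B⁻¹)ᴴ * Bᴴ = 1 := by rw [← Matrix.conjTranspose_mul, hBB, Matrix.conjTranspose_one]
  have hBB'' : Bᴴ * (B⁻¹)ᴴ = 1 := mul_eq_one_comm.mp hBB'
  -- In the coordinates `B F` the mass matrix becomes the identity, and the spectral theorem for one
  -- Hermitian matrix applies.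
  have hA : ((B⁻¹)ᴴ * S * B⁻¹).IsHermitian := Matrix.isHermitian_conjTranspose_mul_mul _ hS
  set V : Matrix n n ℂ := hA.eigenvectorUnitary.1 with hV
  have hVV : Vᴴ * V = 1 := Unitary.coe_star_mul_self hA.eigenvectorUnitary
  have hAV : (B⁻¹)ᴴ * S * B⁻¹ * V = V * Matrix.diagonal fun i => (hA.eigenvalues i : ℂ) := by
    have h := hA.conjStarAlgAut_star_eigenvectorUnitary
    rw [Unitary.conjStarAlgAut_star_apply] at h
    have h2 := congrArg (V * ·) h
    have hVV' : V * star V = 1 := mul_eq_one_comm.mp hVV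
    simp only [← hV] at h2
    rw [← Matrix.mul_assoc, ← Matrix.mul_assoc, hVV', Matrix.one_mul] at h2
    exact h2
  refine ⟨B⁻¹ * V, hA.eigenvalues, ?_, ?_⟩
  · rw [Matrix.conjTranspose_mul, hB]
    calc Vᴴ * (B⁻¹)ᴴ * (Bᴴ * B) * (B⁻¹ * V) = Vᴴ * ((B⁻¹)ᴴ * Bᴴ) * (B * B⁻¹) * V := by
          simp only [Matrix.mul_assoc]
      _ = 1 := by rw [hBB, hBB', Matrix.mul_one, Matrix.mul_one, hVV]
  · calc S * (B⁻¹ * V) = (Bᴴ * (B⁻¹)ᴴ) * (S * (B⁻¹ * V)) := by rw [hBB'', Matrix.one_mul]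
      _ = Bᴴ * ((B⁻¹)ᴴ * S * B⁻¹ * V) := by simp only [Matrix.mul_assoc]
      _ = Bᴴ * (B * B⁻¹) * (V * Matrix.diagonal fun i => (hA.eigenvalues i : ℂ)) := by
          rw [hAV, hBB, Matrix.mul_one]
      _ = _ := by rw [hB]; simp only [Matrix.mul_assoc]

end Pentadiagonal

end QuadFEM

namespace QuadFEM

/-! ### Low eigenvectors and the modal basis. -/

section Eigenvectors

open scoped ComplexOrder

variable {N : ℕ}

/-- The midpoint rows are multiplied by `15h` and the nodal rows by `30h`, so that only `L = λh²`
remains. -/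
theorem eigenvector_iff (F : DiscreteVec N) (L : ℝ) :
    stiffMatrix N *ᵥ F = ((L / meshSize N ^ 2 : ℝ) : ℂ) • (massMatrix N *ᵥ F) ↔
      (∀ k ≤ N, (80 - 8 * L) * halfVal N F (2 * k + 1) =
        (40 + L) * (halfVal N F (2 * k) + halfVal N F (2 * k + 2))) ∧
      ∀ k < N, 140 * halfVal N F (2 * k + 2) -
          80 * (halfVal N F (2 * k + 1) + halfVal N F (2 * k + 3)) +
          10 * (halfVal N F (2 * k) + halfVal N F (2 * k + 4)) =
        L * (8 * halfVal N F (2 * k + 2) + 2 * (halfVal N F (2 * k + 1) + halfVal N F (2 * k + 3)) -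
          (halfVal N F (2 * k) + halfVal N F (2 * k + 4))) := by
  have hh : (meshSize N : ℂ) ≠ 0 := by exact_mod_cast (meshSize_pos N).ne'
  have hodd : ∀ (k : ℕ) (hk : 2 * k < 2 * N + 1),
      ((stiffMatrix N *ᵥ F) ⟨2 * k, hk⟩ =
        (((L / meshSize N ^ 2 : ℝ) : ℂ) • (massMatrix N *ᵥ F)) ⟨2 * k, hk⟩ ↔
      (80 - 8 * L) * halfVal N F (2 * k + 1) =
        (40 + L) * (halfVal N F (2 * k) + halfVal N F (2 * k + 2))) := by
    intro k hk
    rw [Pi.smul_apply, massMatrix_eq, stiffMatrix_eq, pentaMatrix_mulVec_odd,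
      pentaMatrix_mulVec_odd, smul_eq_mul]
    generalize halfVal N F (2 * k) = x
    generalize halfVal N F (2 * k + 1) = m
    generalize halfVal N F (2 * k + 2) = y
    push_cast
    constructor
    · intro h
      field_simp at h
      linear_combination h / 3
    · intro h
      field_simp
      linear_combination 3 * h
  have heven : ∀ (k : ℕ) (hk : 2 * k + 1 < 2 * N + 1),
      ((stiffMatrix N *ᵥ F) ⟨2 * k + 1, hk⟩ =
        (((L / meshSize N ^ 2 : ℝ) : ℂ) • (massMatrix N *ᵥ F)) ⟨2 * k + 1, hk⟩ ↔
      140 * halfVal N F (2 * k + 2) -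
          80 * (halfVal N F (2 * k + 1) + halfVal N F (2 * k + 3)) +
          10 * (halfVal N F (2 * k) + halfVal N F (2 * k + 4)) =
        L * (8 * halfVal N F (2 * k + 2) + 2 * (halfVal N F (2 * k + 1) + halfVal N F (2 * k + 3)) -
          (halfVal N F (2 * k) + halfVal N F (2 * k + 4)))) := by
    intro k hk
    rw [Pi.smul_apply, massMatrix_eq, stiffMatrix_eq, pentaMatrix_mulVec_even,
      pentaMatrix_mulVec_even, smul_eq_mul]
    generalize halfVal N F (2 * k) = x
    generalize halfVal N F (2 * k + 1) = m
    generalize halfVal N F (2 * k + 2) = y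
    generalize halfVal N F (2 * k + 3) = n
    generalize halfVal N F (2 * k + 4) = z
    push_cast
    constructor
    · intro h
      field_simp at h
      linear_combination h / 45
    · intro h
      field_simp
      linear_combination 45 * h
  constructor
  · intro h
    exact ⟨fun k hk => (hodd k (by omega)).mp (by rw [h]),
      fun k hk => (heven k (by omega)).mp (by rw [h])⟩
  · rintro ⟨h1, h2⟩
    funext ⟨i, hi⟩
    rcases Nat.even_or_odd' i with ⟨k, rfl | rfl⟩
    · exact (hodd k hi).mpr (h1 k (by omega))
    · exact (heven k hi).mpr (h2 k (by omega))

/-- Here `u` is a nodal value, `t` the sum of the adjacent nodal values and `s` the sum of the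
adjacent midpoint values. Adding the two midpoint rows expresses `s` through `u` and `t` away from
the singular value `L = 10`, and what is left is the recurrence of a sine. -/
theorem even_row_iff {L : ℝ} (hL : L < 10) {u s t : ℂ}
    (hs : (80 - 8 * L) * s = (40 + L) * (2 * u + t)) :
    140 * u - 80 * s + 10 * t = L * (8 * u + 2 * s - t) ↔ t = 2 * dispersion L * u := by
  have hD : ((L : ℂ) ^ 2 + 16 * L + 240) ≠ 0 := by exact_mod_cast (dispersion_denom_pos L).ne'
  have h8 : (80 - 8 * L : ℂ) ≠ 0 := by
    have : (80 - 8 * L : ℝ) ≠ 0 := by linarith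
    exact_mod_cast this
  have hw : (dispersion L : ℂ) * ((L : ℂ) ^ 2 + 16 * L + 240) = 240 - 104 * L + 3 * L ^ 2 := by
    exact_mod_cast dispersion_mul L
  constructor
  · intro h
    apply mul_left_cancel₀ hD
    linear_combination (-(80 - 8 * L) / 10 : ℂ) * h - ((80 + 2 * L) / 10 : ℂ) * hs - 2 * u * hw
  · intro h
    apply mul_left_cancel₀ h8
    linear_combination (-((L : ℂ) ^ 2 + 16 * L + 240) * 10) * h - (80 + 2 * L : ℂ) * hs -
      20 * u * hw

theorem sin_add_two_mul (η : ℝ) (k : ℕ) : Real.sin (((k + 2 : ℕ) : ℝ) * η) =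
    2 * Real.cos η * Real.sin (((k + 1 : ℕ) : ℝ) * η) - Real.sin (k * η) := by
  push_cast
  rw [show ((k : ℝ) + 2) * η = (k + 1) * η + η by ring,
    show (k : ℝ) * η = (k + 1) * η - η by ring, Real.sin_add, Real.sin_sub]
  ring

/-- Eigenvectors with `λ h² ≤ 4` have sinusoidal nodal values. -/
theorem low_eigenvector {F : DiscreteVec N} {L : ℝ} (hF : F ≠ 0) (h0 : 0 < L) (h4 : L ≤ 4)
    (hev : stiffMatrix N *ᵥ F = ((L / meshSize N ^ 2 : ℝ) : ℂ) • (massMatrix N *ᵥ F)) :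
    ∃ (C : ℂ) (m : ℕ), C ≠ 0 ∧ 1 ≤ m ∧ m ≤ N ∧
      Real.arccos (dispersion L) = m * Real.pi * meshSize N ∧
      (∀ k ≤ N + 1, halfVal N F (2 * k) = C * Real.sin (k * Real.arccos (dispersion L))) ∧
      ∀ k ≤ N, halfVal N F (2 * k + 1) = ((40 + L) / (80 - 8 * L) : ℝ) *
        (halfVal N F (2 * k) + halfVal N F (2 * k + 2)) := by
  have h8 : (80 - 8 * L : ℂ) ≠ 0 := by
    have : (80 - 8 * L : ℝ) ≠ 0 := by linarith
    exact_mod_cast this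
  obtain ⟨hodd, heven⟩ := (eigenvector_iff F L).mp hev
  have hw1 := dispersion_lt_one h0 (by linarith)
  have hw2 := neg_one_lt_dispersion (L := L) (by linarith)
  set η := Real.arccos (dispersion L) with hη
  have hcos : Real.cos η = dispersion L := Real.cos_arccos hw2.le hw1.le
  have hη0 : 0 < η := Real.arccos_pos.mpr hw1
  have hηpi : η < Real.pi := by
    refine lt_of_le_of_ne (Real.arccos_le_pi _) fun h => ?_
    rw [h, Real.cos_pi] at hcos
    linarith
  have hsin : 0 < Real.sin η := Real.sin_pos_of_pos_of_lt_pi hη0 hηpi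
  have hsinc : (Real.sin η : ℂ) ≠ 0 := by exact_mod_cast hsin.ne'
  set C : ℂ := halfVal N F 2 / Real.sin η with hC
  have hmid : ∀ k ≤ N, halfVal N F (2 * k + 1) = ((40 + L) / (80 - 8 * L) : ℝ) *
      (halfVal N F (2 * k) + halfVal N F (2 * k + 2)) := by
    intro k hk
    apply mul_left_cancel₀ h8
    have h9 : (80 - 8 * L : ℂ) * ((40 + L) / (80 - 8 * L)) = 40 + L := mul_div_cancel₀ _ h8
    rw [hodd k hk]
    push_cast
    rw [← mul_assoc, h9]
  have hrec : ∀ k < N, halfVal N F (2 * k + 4) =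
      2 * dispersion L * halfVal N F (2 * k + 2) - halfVal N F (2 * k) := by
    intro k hk
    have h1 := hodd k (by omega)
    have h2 := hodd (k + 1) (by omega)
    rw [show 2 * (k + 1) = 2 * k + 2 by ring, show 2 * k + 2 + 1 = 2 * k + 3 by ring,
      show 2 * k + 2 + 2 = 2 * k + 4 by ring] at h2
    have h3 := (even_row_iff (L := L) (by linarith) (u := halfVal N F (2 * k + 2))
      (s := halfVal N F (2 * k + 1) + halfVal N F (2 * k + 3))
      (t := halfVal N F (2 * k) + halfVal N F (2 * k + 4))
      (by linear_combination h1 + h2)).mp (heven k hk)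
    linear_combination h3
  have hnodal : ∀ k ≤ N, halfVal N F (2 * k) = C * Real.sin (k * η) ∧
      halfVal N F (2 * k + 2) = C * Real.sin (((k + 1 : ℕ) : ℝ) * η) := by
    intro k
    induction k with
    | zero =>
      intro _
      refine ⟨by simp [halfVal_zero], ?_⟩
      simp only [mul_zero, zero_add, Nat.cast_one, one_mul]
      rw [hC, div_mul_cancel₀ _ hsinc]
    | succ k ih =>
      intro hk
      obtain ⟨ih1, ih2⟩ := ih (by omega)
      refine ⟨ih2, ?_⟩
      rw [show 2 * (k + 1) + 2 = 2 * k + 4 by ring, hrec k (by omega), ih1, ih2,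
        show k + 1 + 1 = k + 2 by ring, sin_add_two_mul, hcos]
      push_cast
      ring
  have hnodal' : ∀ k ≤ N + 1, halfVal N F (2 * k) = C * Real.sin (k * η) := by
    intro k hk
    rcases Nat.lt_or_ge N k with h | h
    · obtain rfl : k = N + 1 := by omega
      exact (hnodal N le_rfl).2
    · exact (hnodal k h).1
  have hC0 : C ≠ 0 := by
    intro hC0
    refine hF (eq_zero_of_halfVal fun p => ?_)
    by_cases hp : 2 * N + 1 < p
    · exact halfVal_of_lt F hp
    · rcases Nat.even_or_odd' p with ⟨k, rfl | rfl⟩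
      · rw [hnodal' k (by omega), hC0, zero_mul]
      · rw [hmid k (by omega), hnodal' k (by omega), show 2 * k + 2 = 2 * (k + 1) by ring,
          hnodal' (k + 1) (by omega), hC0]
        ring
  -- The right boundary condition quantizes the wave number: `(N + 1) η` is a multiple of `π`, and
  -- `0 < η < π` keeps the integer between 1 and `N`.
  have hlast : Real.sin ((N + 1 : ℕ) * η) = 0 := by
    have h1 := hnodal' (N + 1) le_rfl
    rw [halfVal_of_lt F (by omega), eq_comm, mul_eq_zero] at h1
    exact_mod_cast h1.resolve_left hC0
  obtain ⟨z, hz⟩ := Real.sin_eq_zero_iff.mp hlast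
  push_cast at hz
  have hpi := Real.pi_pos
  have hN1 : (0 : ℝ) < N + 1 := by positivity
  have hz0 : 0 < z := by
    have : (0 : ℝ) < z * Real.pi := by rw [hz]; positivity
    exact_mod_cast pos_of_mul_pos_left this hpi.le
  have hzN : z < N + 1 := by
    have : (z : ℝ) * Real.pi < (N + 1) * Real.pi := by rw [hz]; gcongr
    exact_mod_cast lt_of_mul_lt_mul_right this hpi.le
  refine ⟨C, z.toNat, hC0, by omega, by omega, ?_, hnodal', hmid⟩
  have hcast : ((z.toNat : ℕ) : ℝ) = (z : ℝ) := by
    have : ((z.toNat : ℕ) : ℤ) = z := Int.toNat_of_nonneg hz0.le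
    exact_mod_cast this
  rw [hcast, hz, meshSize]
  field_simp

theorem low_eigenvector_unique {F G : DiscreteVec N} {L : ℝ} (hF : F ≠ 0) (hG : G ≠ 0)
    (h0 : 0 < L) (h4 : L ≤ 4)
    (hFev : stiffMatrix N *ᵥ F = ((L / meshSize N ^ 2 : ℝ) : ℂ) • (massMatrix N *ᵥ F))
    (hGev : stiffMatrix N *ᵥ G = ((L / meshSize N ^ 2 : ℝ) : ℂ) • (massMatrix N *ᵥ G)) :
    ∃ c : ℂ, G = c • F := by
  obtain ⟨C, _, hC, _, _, _, hn, hm⟩ := low_eigenvector hF h0 h4 hFev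
  obtain ⟨C', _, _, _, _, _, hn', hm'⟩ := low_eigenvector hG h0 h4 hGev
  have he : ∀ k ≤ N + 1, halfVal N G (2 * k) = C' / C * halfVal N F (2 * k) := by
    intro k hk
    rw [hn k hk, hn' k hk]
    field_simp
  refine ⟨C' / C, ?_⟩
  funext i
  rw [Pi.smul_apply, smul_eq_mul, ← halfVal_succ F, ← halfVal_succ G]
  rcases Nat.even_or_odd' ((i : ℕ) + 1) with ⟨k, hk | hk⟩
  · rw [hk, he k (by omega)]
  · rw [hk, hm k (by omega), hm' k (by omega), show 2 * k + 2 = 2 * (k + 1) by ring,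
      he k (by omega), he (k + 1) (by omega)]
    ring

/-- Existence of the low acoustic eigenvectors. -/
theorem exists_low_eigenvector {k : ℕ} (hk : 1 ≤ k) (hkN : 2 * k ≤ N) :
    ∃ (F : DiscreteVec N) (L : ℝ), F ≠ 0 ∧ 0 < L ∧ L ≤ 5 / 2 ∧
      Real.arccos (dispersion L) = k * Real.pi * meshSize N ∧
      stiffMatrix N *ᵥ F = ((L / meshSize N ^ 2 : ℝ) : ℂ) • (massMatrix N *ᵥ F) := by
  have hpi := Real.pi_pos
  set η : ℝ := k * Real.pi * meshSize N with hη
  have hN1 : (0 : ℝ) < N + 1 := by positivity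
  have hk' : (1 : ℝ) ≤ k := by exact_mod_cast hk
  have hkN' : 2 * (k : ℝ) ≤ N := by exact_mod_cast hkN
  have hη0 : 0 < η := by
    have := meshSize_pos N
    positivity
  have hη2 : η ≤ Real.pi / 2 := by
    rw [hη, meshSize, mul_one_div, div_le_div_iff₀ hN1 two_pos]
    nlinarith
  have hsin : 0 < Real.sin η := Real.sin_pos_of_pos_of_lt_pi hη0 (by linarith)
  have hc1 : Real.cos η < 1 := by
    rw [← Real.cos_zero]
    exact Real.cos_lt_cos_of_nonneg_of_le_pi le_rfl (by linarith) hη0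
  obtain ⟨L, hL0, hL2, hLc⟩ := exists_dispersion_eq
    (Real.cos_nonneg_of_neg_pi_div_two_le_of_le (by linarith) hη2) hc1
  set β : ℝ := (40 + L) / (80 - 8 * L) with hβ
  -- Sines at the nodes, with midpoints filled in from the midpoint rows. The values at `p = 0` and
  -- `p = 2N + 2` vanish, so `v` agrees with `halfVal` at the boundary too.
  let v : ℕ → ℝ := fun p => if Even p then Real.sin ((p / 2 : ℕ) * η) else
    β * (Real.sin ((p / 2 : ℕ) * η) + Real.sin ((p / 2 + 1 : ℕ) * η))
  have hve : ∀ j, v (2 * j) = Real.sin (j * η) := by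
    intro j
    simp only [v]
    rw [if_pos (even_two_mul j), Nat.mul_div_cancel_left j two_pos]
  have hvo : ∀ j, v (2 * j + 1) = β * (Real.sin (j * η) + Real.sin ((j + 1 : ℕ) * η)) := by
    intro j
    simp only [v]
    rw [if_neg (by simp), show (2 * j + 1) / 2 = j by omega]
  let F : DiscreteVec N := fun i => v (i + 1)
  have hF : ∀ p ≤ 2 * N + 2, halfVal N F p = v p := by
    intro p hp
    by_cases h : 1 ≤ p ∧ p ≤ 2 * N + 1
    · rw [halfVal, dif_pos h]
      simp only [F]
      rw [Nat.sub_add_cancel h.1]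
    · rw [halfVal, dif_neg h]
      have : p = 0 ∨ p = 2 * (N + 1) := by omega
      rcases this with rfl | rfl
      · have := hve 0
        simp only [mul_zero, Nat.cast_zero, zero_mul, Real.sin_zero] at this
        simp [this]
      · have h1 : ((N + 1 : ℕ) : ℝ) * η = k * Real.pi := by
          rw [hη, meshSize]
          push_cast
          field_simp
        rw [hve, h1, Real.sin_nat_mul_pi, Complex.ofReal_zero]
  refine ⟨F, L, ?_, hL0, hL2, ?_, ?_⟩
  · intro h0
    have h1 := hF (2 * 1) (by omega)
    rw [hve, h0, Nat.cast_one, one_mul] at h1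
    have h2 : halfVal N (0 : DiscreteVec N) (2 * 1) = 0 := by
      rw [halfVal]
      split_ifs <;> rfl
    rw [h2] at h1
    exact hsin.ne (by exact_mod_cast h1)
  · rw [hLc, Real.arccos_cos hη0.le (by linarith)]
  · have h8 : (80 - 8 * L : ℝ) ≠ 0 := by linarith
    have hodd : ∀ j ≤ N, (80 - 8 * L) * halfVal N F (2 * j + 1) =
        (40 + L) * (halfVal N F (2 * j) + halfVal N F (2 * j + 2)) := by
      intro j hj
      rw [hF _ (by omega), hF _ (by omega), hF _ (by omega), show 2 * j + 2 = 2 * (j + 1) by ring,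
        hve, hve, hvo]
      have : (80 - 8 * L) * (β * (Real.sin (j * η) + Real.sin ((j + 1 : ℕ) * η))) =
          (40 + L) * (Real.sin (j * η) + Real.sin ((j + 1 : ℕ) * η)) := by
        rw [hβ]
        field_simp
      exact_mod_cast this
    rw [eigenvector_iff]
    refine ⟨hodd, fun j hj => ?_⟩
    have h1 := hodd j (by omega)
    have h2 := hodd (j + 1) (by omega)
    rw [show 2 * (j + 1) = 2 * j + 2 by ring, show 2 * j + 2 + 1 = 2 * j + 3 by ring,
      show 2 * j + 2 + 2 = 2 * j + 4 by ring] at h2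
    refine (even_row_iff (L := L) (by linarith) (by linear_combination h1 + h2)).mpr ?_
    rw [hF _ (by omega), hF _ (by omega), hF _ (by omega), show 2 * j + 4 = 2 * (j + 2) by ring,
      show 2 * j + 2 = 2 * (j + 1) by ring, hve, hve, hve, sin_add_two_mul, hLc]
    push_cast
    ring

/-- The columns of `E` are `M`-orthonormal eigenvectors with eigenvalues `ev`. -/
structure IsModalBasis (N : ℕ) (E : Matrix (Fin (2 * N + 1)) (Fin (2 * N + 1)) ℂ)
    (ev : Fin (2 * N + 1) → ℝ) : Prop where
  orthonormal : Eᴴ * massMatrix N * E = 1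
  eigen : stiffMatrix N * E = massMatrix N * E * Matrix.diagonal fun i => (ev i : ℂ)

theorem exists_modalBasis (N : ℕ) : ∃ E ev, IsModalBasis N E ev := by
  obtain ⟨E, ev, h1, h2⟩ := exists_generalized_eigenbasis (massMatrix_posDef N)
    (stiffMatrix_posDef N).isHermitian
  exact ⟨E, ev, h1, h2⟩

namespace IsModalBasis

variable {E : Matrix (Fin (2 * N + 1)) (Fin (2 * N + 1)) ℂ} {ev : Fin (2 * N + 1) → ℝ}

theorem mulVec_coeff (h : IsModalBasis N E ev) (F : DiscreteVec N) :
    E *ᵥ (Eᴴ *ᵥ (massMatrix N *ᵥ F)) = F := by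
  have h1 : E * Eᴴ * massMatrix N = 1 := by
    rw [Matrix.mul_assoc]
    exact mul_eq_one_comm.mp h.orthonormal
  rw [Matrix.mulVec_mulVec, Matrix.mulVec_mulVec, h1, Matrix.one_mulVec]

theorem coeff_stiff (h : IsModalBasis N E ev) (F : DiscreteVec N) (i : Fin (2 * N + 1)) :
    (Eᴴ *ᵥ (stiffMatrix N *ᵥ F)) i = ev i * (Eᴴ *ᵥ (massMatrix N *ᵥ F)) i := by
  have h1 : Eᴴ * stiffMatrix N = (Matrix.diagonal fun i => (ev i : ℂ)) * (Eᴴ * massMatrix N) := by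
    have h2 := congrArg Matrix.conjTranspose h.eigen
    rw [Matrix.conjTranspose_mul, Matrix.conjTranspose_mul, Matrix.conjTranspose_mul,
      (stiffMatrix_posDef N).isHermitian.eq, (massMatrix_posDef N).isHermitian.eq,
      Matrix.diagonal_conjTranspose] at h2
    rw [h2]
    congr 2
    funext i
    simp
  rw [Matrix.mulVec_mulVec, h1, ← Matrix.mulVec_mulVec, ← Matrix.mulVec_mulVec,
    Matrix.mulVec_diagonal]

theorem massForm_mulVec (h : IsModalBasis N E ev) (c : DiscreteVec N) :
    massForm N (E *ᵥ c) = ∑ i, ‖c i‖ ^ 2 := by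
  have h1 : (massMatrix N *ᵥ (E *ᵥ c)) ⬝ᵥ star (E *ᵥ c) = star c ⬝ᵥ c := by
    rw [dotProduct_comm, Matrix.star_mulVec, ← Matrix.dotProduct_mulVec, Matrix.mulVec_mulVec,
      Matrix.mulVec_mulVec, h.orthonormal, Matrix.one_mulVec]
  rw [massForm, h1, dotProduct, Complex.re_sum]
  refine Finset.sum_congr rfl fun i _ => ?_
  rw [norm_sq_eq_re_im]
  simp [sq]

theorem massForm_eq (h : IsModalBasis N E ev) (F : DiscreteVec N) :
    massForm N F = ∑ i, ‖(Eᴴ *ᵥ (massMatrix N *ᵥ F)) i‖ ^ 2 := by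
  rw [← h.massForm_mulVec, h.mulVec_coeff]

theorem stiffForm_eq (h : IsModalBasis N E ev) (F : DiscreteVec N) :
    stiffForm N F = ∑ i, ev i * ‖(Eᴴ *ᵥ (massMatrix N *ᵥ F)) i‖ ^ 2 := by
  set c := Eᴴ *ᵥ (massMatrix N *ᵥ F) with hc
  have h1 : (stiffMatrix N *ᵥ F) ⬝ᵥ star F = ∑ i, (ev i * c i) * (starRingEnd ℂ) (c i) := by
    rw [dotProduct_comm]
    nth_rw 1 [← h.mulVec_coeff F]
    rw [Matrix.star_mulVec, ← Matrix.dotProduct_mulVec, dotProduct_comm, dotProduct]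
    refine Finset.sum_congr rfl fun i _ => ?_
    rw [h.coeff_stiff]
    rfl
  rw [stiffForm, h1, Complex.re_sum]
  refine Finset.sum_congr rfl fun i _ => ?_
  rw [mul_assoc, Complex.mul_conj, Complex.normSq_eq_norm_sq, ← Complex.ofReal_mul,
    Complex.ofReal_re]

theorem coeff_col (h : IsModalBasis N E ev) (i : Fin (2 * N + 1)) :
    Eᴴ *ᵥ (massMatrix N *ᵥ (fun j => E j i)) = Pi.single i 1 := by
  have h1 : (fun j => E j i) = E *ᵥ Pi.single i 1 := by
    rw [Matrix.mulVec_single_one]; rfl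
  rw [h1, Matrix.mulVec_mulVec, Matrix.mulVec_mulVec, h.orthonormal,
    Matrix.one_mulVec]

theorem massForm_col (h : IsModalBasis N E ev) (i : Fin (2 * N + 1)) :
    massForm N (fun j => E j i) = 1 := by
  rw [h.massForm_eq, h.coeff_col, Finset.sum_eq_single i]
  · simp
  · intro j _ hj
    simp [hj]
  · simp

theorem col_ne_zero (h : IsModalBasis N E ev) (i : Fin (2 * N + 1)) :
    (fun j => E j i) ≠ (0 : DiscreteVec N) := by
  intro h0
  have h1 := h.massForm_col i
  rw [h0] at h1
  simp [massForm] at h1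

theorem stiffForm_col (h : IsModalBasis N E ev) (i : Fin (2 * N + 1)) :
    stiffForm N (fun j => E j i) = ev i := by
  rw [h.stiffForm_eq, h.coeff_col, Finset.sum_eq_single i]
  · simp
  · intro j _ hj
    simp [hj]
  · simp

theorem ev_pos (h : IsModalBasis N E ev) (i : Fin (2 * N + 1)) : 0 < ev i := by
  rw [← h.stiffForm_col i]
  exact stiffForm_pos (h.col_ne_zero i)

theorem ev_le (h : IsModalBasis N E ev) (i : Fin (2 * N + 1)) : ev i * meshSize N ^ 2 ≤ 60 := by
  have h1 := stiffForm_le_massForm fun j => E j i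
  rw [h.stiffForm_col, h.massForm_col, mul_one, le_div_iff₀ (pow_pos (meshSize_pos N) 2)] at h1
  exact h1

theorem eigen_col (h : IsModalBasis N E ev) (i : Fin (2 * N + 1)) :
    stiffMatrix N *ᵥ (fun j => E j i) =
      ((ev i * meshSize N ^ 2 / meshSize N ^ 2 : ℝ) : ℂ) • (massMatrix N *ᵥ fun j => E j i) := by
  have hh := (pow_pos (meshSize_pos N) 2).ne'
  rw [mul_div_cancel_right₀ _ hh]
  have h1 : (fun j => E j i) = E *ᵥ Pi.single i 1 := by
    rw [Matrix.mulVec_single_one]; rfl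
  rw [h1, Matrix.mulVec_mulVec, h.eigen, ← Matrix.mulVec_mulVec, Matrix.diagonal_mulVec_single,
    mul_one, Matrix.mulVec_mulVec, ← Matrix.mulVec_smul]
  congr 1
  rw [← Pi.single_smul, smul_eq_mul, mul_one]

/-- Two columns with the same low eigenvalue are proportional by `low_eigenvector_unique`, which
contradicts orthonormality unless they coincide. -/
theorem eq_of_ev_eq (h : IsModalBasis N E ev) {i j : Fin (2 * N + 1)}
    (hi : ev i * meshSize N ^ 2 ≤ 4) (hij : ev i = ev j) : i = j := by
  by_contra hne
  have hpos : 0 < ev i * meshSize N ^ 2 := mul_pos (h.ev_pos i) (pow_pos (meshSize_pos N) 2)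
  have hj := h.eigen_col j
  rw [← hij] at hj
  obtain ⟨c, hc⟩ := low_eigenvector_unique (h.col_ne_zero i) (h.col_ne_zero j) hpos hi
    (h.eigen_col i) hj
  have h1 := h.coeff_col j
  rw [hc, Matrix.mulVec_smul, Matrix.mulVec_smul, h.coeff_col i] at h1
  have h2 := congrFun h1 j
  simp [Ne.symm hne] at h2

theorem exists_ev_eq (h : IsModalBasis N E ev) {F : DiscreteVec N} {l : ℝ} (hF : F ≠ 0)
    (hev : stiffMatrix N *ᵥ F = (l : ℂ) • (massMatrix N *ᵥ F)) : ∃ i, ev i = l := by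
  obtain ⟨i, hi⟩ : ∃ i, (Eᴴ *ᵥ (massMatrix N *ᵥ F)) i ≠ 0 := by
    by_contra! h0
    apply hF
    rw [← h.mulVec_coeff F, show Eᴴ *ᵥ (massMatrix N *ᵥ F) = 0 from funext h0, Matrix.mulVec_zero]
  refine ⟨i, ?_⟩
  have h1 := h.coeff_stiff F i
  rw [hev, Matrix.mulVec_smul, Pi.smul_apply, smul_eq_mul] at h1
  exact_mod_cast (mul_right_cancel₀ hi h1).symm

end IsModalBasis

end Eigenvectors

end QuadFEM

namespace QuadFEM

/-! ### The discrete sine transform. -/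

section SineTransform

theorem two_mul_sin_half_mul_sum_cos (x : ℝ) (K : ℕ) :
    2 * Real.sin (x / 2) * ∑ i ∈ Finset.range K, Real.cos (i * x) =
      Real.sin ((K - 1 / 2) * x) + Real.sin (x / 2) := by
  induction K with
  | zero =>
    rw [Finset.sum_range_zero, mul_zero, Nat.cast_zero,
      show ((0 : ℝ) - 1 / 2) * x = -(x / 2) by ring, Real.sin_neg]
    ring
  | succ K ih =>
    rw [Finset.sum_range_succ, mul_add, ih]
    push_cast
    rw [show ((K : ℝ) - 1 / 2) * x = K * x - x / 2 by ring,
      show ((K : ℝ) + 1 - 1 / 2) * x = K * x + x / 2 by ring, Real.sin_sub, Real.sin_add]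
    ring

/-- The Dirichlet kernel evaluated at `mπ/K`: the bounds on `m` keep `sin (x / 2)` away from zero,
and the value depends only on the parity of `m`. -/
theorem sum_cos_int_mul_pi_div {K : ℕ} {m : ℤ} (hm0 : m ≠ 0) (hm : |m| < 2 * K) :
    ∑ i ∈ Finset.range K, Real.cos (i * (m * Real.pi / K)) = (1 - (-1 : ℝ) ^ m) / 2 := by
  have hpi := Real.pi_pos
  have hK : (0 : ℝ) < K := by
    have : (0 : ℤ) < K := by have := abs_nonneg m; omega
    exact_mod_cast this
  set x : ℝ := m * Real.pi / K with hx
  have hs : Real.sin (x / 2) ≠ 0 := by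
    intro h
    obtain ⟨z, hz⟩ := Real.sin_eq_zero_iff.mp h
    rw [hx] at hz
    have h1 : (2 * K * z : ℝ) = m := by
      field_simp at hz
      linarith
    have h2 : 2 * (K : ℤ) * z = m := by exact_mod_cast h1
    have hz0 : z ≠ 0 := by
      rintro rfl
      exact hm0 (by rw [← h2, mul_zero])
    have h3 := Int.one_le_abs hz0
    rw [← h2, abs_mul, abs_mul, abs_two, Nat.abs_cast] at hm
    nlinarith
  have h := two_mul_sin_half_mul_sum_cos x K
  have h1 : ((K : ℝ) - 1 / 2) * x = m * Real.pi - x / 2 := by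
    rw [hx]
    field_simp
  rw [h1, Real.sin_sub, Real.sin_int_mul_pi, Real.cos_int_mul_pi] at h
  apply mul_left_cancel₀ (mul_ne_zero two_ne_zero hs)
  rw [h]
  ring

/-- The integers `k - l` and `k + l` have the same parity, so the two cosine sums cancel unless `k =
l`. -/
theorem sum_sin_mul_sin {K k l : ℕ} (hk : 1 ≤ k) (hkK : k < K) (hl : 1 ≤ l) (hlK : l < K) :
    ∑ i ∈ Finset.range K, Real.sin (i * (k * Real.pi / K)) * Real.sin (i * (l * Real.pi / K)) =
      if k = l then (K : ℝ) / 2 else 0 := by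
  have h1 : ∀ i ∈ Finset.range K, Real.sin (i * (k * Real.pi / K)) *
      Real.sin (i * (l * Real.pi / K)) =
      Real.cos (i * (((k - l : ℤ) : ℝ) * Real.pi / K)) / 2 -
        Real.cos (i * (((k + l : ℤ) : ℝ) * Real.pi / K)) / 2 := by
    intro i _
    push_cast
    rw [show (i : ℝ) * ((k - l) * Real.pi / K) = i * (k * Real.pi / K) - i * (l * Real.pi / K) by
      ring, show (i : ℝ) * ((k + l) * Real.pi / K) = i * (k * Real.pi / K) + i * (l * Real.pi / K) by
      ring, Real.cos_sub, Real.cos_add]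
    ring
  rw [Finset.sum_congr rfl h1, Finset.sum_sub_distrib, ← Finset.sum_div, ← Finset.sum_div,
    sum_cos_int_mul_pi_div (m := (k + l : ℤ)) (by omega) (by rw [abs_of_nonneg (by omega)]; omega)]
  have hpar : (-1 : ℝ) ^ ((k : ℤ) + l) = (-1 : ℝ) ^ ((k : ℤ) - l) := by
    rw [show (k : ℤ) + l = (k - l) + (l + l) by ring, zpow_add₀ (by norm_num),
      Even.neg_one_zpow ⟨(l : ℤ), rfl⟩, mul_one]
  rw [hpar]
  split_ifs with hkl
  · subst hkl
    simp
  · rw [sum_cos_int_mul_pi_div (m := (k - l : ℤ)) (by omega) (by rw [abs_lt]; constructor <;> omega)]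
    ring

theorem sum_range_sin_mul_sin {n k l : ℕ} (hk : k < n) (hl : l < n) :
    ∑ i ∈ Finset.range n, Real.sin ((i + 1 : ℕ) * ((k + 1 : ℕ) * Real.pi / (n + 1 : ℕ))) *
      Real.sin ((i + 1 : ℕ) * ((l + 1 : ℕ) * Real.pi / (n + 1 : ℕ))) =
      if k = l then ((n + 1 : ℕ) : ℝ) / 2 else 0 := by
  have h := sum_sin_mul_sin (K := n + 1) (k := k + 1) (l := l + 1) (by omega) (by omega) (by omega)
    (by omega)
  rw [Finset.sum_range_succ'] at h
  simpa using h

/-- The discrete sine coefficients of `f 1, …, f n`. -/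
noncomputable def sineCoeff (n : ℕ) (f : ℕ → ℂ) (k : ℕ) : ℂ :=
  2 / (n + 1 : ℕ) * ∑ i ∈ Finset.range n,
    f (i + 1) * (Real.sin ((i + 1 : ℕ) * ((k + 1 : ℕ) * Real.pi / (n + 1 : ℕ))) : ℂ)

theorem sineCoeff_inversion {n : ℕ} {f : ℕ → ℂ} (h0 : f 0 = 0) (hn : f (n + 1) = 0) {i : ℕ}
    (hi : i ≤ n + 1) : f i = ∑ k ∈ Finset.range n,
      sineCoeff n f k * (Real.sin (i * ((k + 1 : ℕ) * Real.pi / (n + 1 : ℕ))) : ℂ) := by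
  have hn1 : ((n + 1 : ℕ) : ℝ) ≠ 0 := by positivity
  have hn1c : ((n + 1 : ℕ) : ℂ) ≠ 0 := by exact_mod_cast hn1
  rcases Nat.eq_zero_or_pos i with rfl | hpos
  · simp [h0]
  rcases Nat.eq_or_lt_of_le hi with rfl | hlt
  · rw [hn, Finset.sum_eq_zero]
    intro k _
    rw [show ((n + 1 : ℕ) : ℝ) * ((k + 1 : ℕ) * Real.pi / (n + 1 : ℕ)) = (k + 1 : ℕ) * Real.pi by
      field_simp, Real.sin_nat_mul_pi, Complex.ofReal_zero, mul_zero]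
  obtain ⟨j, rfl⟩ : ∃ j, i = j + 1 := ⟨i - 1, by omega⟩
  have hswap : ∀ a b : ℕ, Real.sin ((a + 1 : ℕ) * ((b + 1 : ℕ) * Real.pi / (n + 1 : ℕ))) =
      Real.sin ((b + 1 : ℕ) * ((a + 1 : ℕ) * Real.pi / (n + 1 : ℕ))) := by
    intro a b
    congr 1
    ring
  calc f (j + 1) = ∑ l ∈ Finset.range n, 2 / (n + 1 : ℕ) * f (l + 1) *
        ((if l = j then ((n + 1 : ℕ) : ℝ) / 2 else 0 : ℝ) : ℂ) := by
        rw [Finset.sum_eq_single j]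
        · rw [if_pos rfl]
          push_cast at hn1c ⊢
          field_simp
        · intro l _ hl
          rw [if_neg hl, Complex.ofReal_zero, mul_zero]
        · intro hj
          exact absurd (Finset.mem_range.mpr (by omega)) hj
    _ = ∑ l ∈ Finset.range n, ∑ k ∈ Finset.range n, 2 / (n + 1 : ℕ) * f (l + 1) *
        ((Real.sin ((l + 1 : ℕ) * ((k + 1 : ℕ) * Real.pi / (n + 1 : ℕ))) : ℂ) *
          (Real.sin ((j + 1 : ℕ) * ((k + 1 : ℕ) * Real.pi / (n + 1 : ℕ))) : ℂ)) := by
        refine Finset.sum_congr rfl fun l hl => ?_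
        rw [← sum_range_sin_mul_sin (Finset.mem_range.mp hl) (show j < n by omega),
          ← Finset.mul_sum, Complex.ofReal_sum]
        congr 1
        refine Finset.sum_congr rfl fun k _ => ?_
        rw [hswap k l, hswap k j, Complex.ofReal_mul]
    _ = _ := by
        rw [Finset.sum_comm]
        refine Finset.sum_congr rfl fun k _ => ?_
        rw [sineCoeff, Finset.mul_sum, Finset.sum_mul]
        refine Finset.sum_congr rfl fun l _ => ?_
        ring

theorem sum_mul_sin_eq_sineCoeff (n : ℕ) (f : ℕ → ℂ) (k : ℕ) :
    ∑ i ∈ Finset.range n,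
      f (i + 1) * (Real.sin ((i + 1 : ℕ) * ((k + 1 : ℕ) * Real.pi / (n + 1 : ℕ))) : ℂ) =
      (n + 1 : ℕ) / 2 * sineCoeff n f k := by
  have hn1c : ((n + 1 : ℕ) : ℂ) ≠ 0 := by exact_mod_cast Nat.succ_ne_zero n
  rw [sineCoeff, ← mul_assoc, div_mul_div_cancel₀ two_ne_zero, div_self hn1c, one_mul]

/-- A weighted Parseval identity for the discrete sine transform. -/
theorem sum_weighted_mul_conj {n : ℕ} (f : ℕ → ℂ) (w : ℕ → ℝ) :
    ∑ i ∈ Finset.range n, (∑ k ∈ Finset.range n, sineCoeff n f k * ((w k : ℝ) : ℂ) *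
      (Real.sin ((i + 1 : ℕ) * ((k + 1 : ℕ) * Real.pi / (n + 1 : ℕ))) : ℂ)) *
        (starRingEnd ℂ) (f (i + 1)) =
      (((n + 1 : ℕ) / 2 * ∑ k ∈ Finset.range n, w k * ‖sineCoeff n f k‖ ^ 2 : ℝ) : ℂ) := by
  have h1 : ∀ k, ∑ i ∈ Finset.range n, (Real.sin ((i + 1 : ℕ) * ((k + 1 : ℕ) * Real.pi /
      (n + 1 : ℕ))) : ℂ) * (starRingEnd ℂ) (f (i + 1)) =
      (n + 1 : ℕ) / 2 * (starRingEnd ℂ) (sineCoeff n f k) := by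
    intro k
    have h := congrArg (starRingEnd ℂ) (sum_mul_sin_eq_sineCoeff n f k)
    rw [map_sum, map_mul, map_div₀, map_natCast, map_ofNat] at h
    rw [← h]
    refine Finset.sum_congr rfl fun i _ => ?_
    rw [map_mul, Complex.conj_ofReal, mul_comm]
  calc _ = ∑ k ∈ Finset.range n, sineCoeff n f k * ((w k : ℝ) : ℂ) *
        ∑ i ∈ Finset.range n, (Real.sin ((i + 1 : ℕ) * ((k + 1 : ℕ) * Real.pi /
          (n + 1 : ℕ))) : ℂ) * (starRingEnd ℂ) (f (i + 1)) := by
        simp only [Finset.sum_mul, Finset.mul_sum]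
        rw [Finset.sum_comm]
        refine Finset.sum_congr rfl fun k _ => Finset.sum_congr rfl fun i _ => ?_
        ring
    _ = ∑ k ∈ Finset.range n, (((n + 1 : ℕ) / 2 * (w k * ‖sineCoeff n f k‖ ^ 2) : ℝ) : ℂ) := by
        refine Finset.sum_congr rfl fun k _ => ?_
        rw [h1, ← Complex.normSq_eq_norm_sq]
        have := Complex.mul_conj (sineCoeff n f k)
        push_cast
        rw [← this]
        ring
    _ = _ := by rw [Finset.mul_sum, Complex.ofReal_sum]

theorem sum_norm_sq_eq_sineCoeff {n : ℕ} {f : ℕ → ℂ} (h0 : f 0 = 0) (hn : f (n + 1) = 0) :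
    ∑ i ∈ Finset.range n, ‖f (i + 1)‖ ^ 2 =
      (n + 1 : ℕ) / 2 * ∑ k ∈ Finset.range n, ‖sineCoeff n f k‖ ^ 2 := by
  have h := sum_weighted_mul_conj (n := n) f fun _ => 1
  simp only [one_mul, Complex.ofReal_one, mul_one] at h
  have h1 : ∀ i ∈ Finset.range n, (∑ k ∈ Finset.range n, sineCoeff n f k *
      (Real.sin ((i + 1 : ℕ) * ((k + 1 : ℕ) * Real.pi / (n + 1 : ℕ))) : ℂ)) *
        (starRingEnd ℂ) (f (i + 1)) = ((‖f (i + 1)‖ ^ 2 : ℝ) : ℂ) := by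
    intro i hi
    rw [← sineCoeff_inversion h0 hn (by have := Finset.mem_range.mp hi; omega), Complex.mul_conj,
      Complex.normSq_eq_norm_sq]
  rw [Finset.sum_congr rfl h1, ← Complex.ofReal_sum] at h
  exact_mod_cast h

end SineTransform

/-! ### Bi-grid data on the coarse grid. -/

section Bigrid

variable {n : ℕ}

theorem sum_range_odd_eq (n : ℕ) (f : ℕ → ℂ) : ∑ i ∈ Finset.range (2 * n + 1), f i =
    ∑ k ∈ Finset.range (n + 1), f (2 * k) + ∑ k ∈ Finset.range n, f (2 * k + 1) := by
  rw [← sum_fin_odd_eq, Fin.sum_univ_eq_sum_range]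

/-- For bi-grid data the stiffness matrix only sees the coarse nodes. -/
theorem dotProduct_stiff_bigrid {F : DiscreteVec (2 * n + 1)} (hl : F ∈ linearSpace (2 * n + 1))
    (hb : F ∈ bigridSpace (2 * n + 1)) (G : DiscreteVec (2 * n + 1)) :
    star G ⬝ᵥ (stiffMatrix (2 * n + 1) *ᵥ F) = ∑ i ∈ Finset.range n,
      (starRingEnd ℂ) (halfVal (2 * n + 1) G (4 * (i + 1))) * (1 / (2 * meshSize (2 * n + 1)) *
        (2 * halfVal (2 * n + 1) F (4 * (i + 1)) - halfVal (2 * n + 1) F (4 * i) -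
          halfVal (2 * n + 1) F (4 * (i + 2)))) := by
  set u := halfVal (2 * n + 1) F with hu
  set h := meshSize (2 * n + 1) with hh
  have hh0 : (h : ℂ) ≠ 0 := by exact_mod_cast (meshSize_pos (2 * n + 1)).ne'
  have hlin : ∀ j ≤ 2 * n + 1, u (2 * j + 1) = (u (2 * j) + u (2 * j + 2)) / 2 := hl
  have hbig : ∀ j ≤ n, u (4 * j + 2) = (u (4 * j) + u (4 * j + 4)) / 2 := by
    intro j hj
    have := hb j (by omega)
    rw [show 2 * (2 * j + 1) = 4 * j + 2 by ring, show 2 * (2 * j) = 4 * j by ring,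
      show 2 * (2 * j + 2) = 4 * j + 4 by ring] at this
    exact this
  have h1 : star G ⬝ᵥ (stiffMatrix (2 * n + 1) *ᵥ F) = ∑ i : Fin (2 * (2 * n + 1) + 1),
      (starRingEnd ℂ) (halfVal (2 * n + 1) G (i + 1)) *
        (if hi : (i : ℕ) < 2 * (2 * n + 1) + 1 then (stiffMatrix (2 * n + 1) *ᵥ F) ⟨i, hi⟩
          else 0) := by
    refine Finset.sum_congr rfl fun i _ => ?_
    rw [dif_pos i.2, halfVal_succ]
    rfl
  rw [h1, sum_fin_odd_eq (2 * n + 1) fun i => (starRingEnd ℂ) (halfVal (2 * n + 1) G (i + 1)) *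
        (if hi : i < 2 * (2 * n + 1) + 1 then (stiffMatrix (2 * n + 1) *ᵥ F) ⟨i, hi⟩
          else 0), sum_range_odd_eq n]
  -- In continuous terms, the second derivative of a coarse piecewise linear function is
  -- concentrated at the coarse nodes, with index `4 * i` here. The midpoint rows vanish because the
  -- data are linear in each cell.
  have hA : ∀ k ∈ Finset.range (2 * n + 1 + 1),
      (starRingEnd ℂ) (halfVal (2 * n + 1) G (2 * k + 1)) *
        (if hi : 2 * k < 2 * (2 * n + 1) + 1 then (stiffMatrix (2 * n + 1) *ᵥ F) ⟨2 * k, hi⟩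
          else 0) = 0 := by
    intro k hk
    have hk' := Finset.mem_range.mp hk
    rw [dif_pos (by omega), stiffMatrix_eq, pentaMatrix_mulVec_odd, ← hu, ← hh, hlin k (by omega)]
    push_cast
    field_simp
    ring
  have heven : ∀ (k : ℕ) (hk : 2 * k + 1 < 2 * (2 * n + 1) + 1),
      (stiffMatrix (2 * n + 1) *ᵥ F) ⟨2 * k + 1, hk⟩ =
        1 / h * (2 * u (2 * k + 2) - u (2 * k) - u (2 * k + 4)) := by
    intro k hk
    have e1 := hlin k (by omega)
    have e2 := hlin (k + 1) (by omega)
    rw [show 2 * (k + 1) = 2 * k + 2 by ring, show 2 * k + 2 + 1 = 2 * k + 3 by ring,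
      show 2 * k + 2 + 2 = 2 * k + 4 by ring] at e2
    rw [stiffMatrix_eq, pentaMatrix_mulVec_even, ← hu, ← hh, e1, e2]
    push_cast
    field_simp
    ring
  -- The nodes inside a coarse cell contribute nothing either, again by linearity.
  have hB : ∀ k ∈ Finset.range (n + 1),
      (starRingEnd ℂ) (halfVal (2 * n + 1) G (2 * (2 * k) + 1 + 1)) *
        (if hi : 2 * (2 * k) + 1 < 2 * (2 * n + 1) + 1 then
          (stiffMatrix (2 * n + 1) *ᵥ F) ⟨2 * (2 * k) + 1, hi⟩ else 0) = 0 := by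
    intro k hk
    have hk' := Finset.mem_range.mp hk
    rw [dif_pos (by omega), heven, show 2 * (2 * k) = 4 * k by ring, hbig k (by omega)]
    ring
  rw [Finset.sum_eq_zero hA, Finset.sum_eq_zero hB, zero_add, zero_add]
  refine Finset.sum_congr rfl fun k hk => ?_
  have hk' := Finset.mem_range.mp hk
  have e1 := hbig k (by omega)
  have e2 := hbig (k + 1) (by omega)
  rw [show 4 * (k + 1) = 4 * k + 4 by ring, show 4 * k + 4 + 2 = 4 * k + 6 by ring,
    show 4 * k + 4 + 4 = 4 * k + 8 by ring] at e2
  rw [dif_pos (by omega), heven, show 2 * (2 * k + 1) + 1 + 1 = 4 * (k + 1) by ring,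
    show 2 * (2 * k + 1) = 4 * k + 2 by ring,
    show 4 * (k + 2) = 4 * k + 8 by ring, show 4 * k + 2 + 4 = 4 * k + 6 by ring,
    show 4 * (k + 1) = 4 * k + 4 by ring, e1, e2]
  field_simp
  ring

/-- The wave number `(k + 1) π h` of the `k`-th coarse sine mode. -/
noncomputable def waveNumber (n k : ℕ) : ℝ := (k + 1 : ℕ) * Real.pi * meshSize (2 * n + 1)

theorem two_mul_waveNumber (n k : ℕ) :
    2 * waveNumber n k = (k + 1 : ℕ) * Real.pi / (n + 1 : ℕ) := by
  rw [waveNumber, meshSize]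
  push_cast
  field_simp
  ring

/-- The sine coefficients of the coarse nodal values. -/
noncomputable def coarseCoeff (n : ℕ) (F : DiscreteVec (2 * n + 1)) (k : ℕ) : ℂ :=
  sineCoeff n (fun i => halfVal (2 * n + 1) F (4 * i)) k

/-- The coarse step doubles the phase to `2 * waveNumber n k`, and the symbol `2 - 2 cos 2η` equals
`4 sin² η`. -/
theorem coarse_second_difference (F : DiscreteVec (2 * n + 1)) {i : ℕ} (hi : i < n) :
    2 * halfVal (2 * n + 1) F (4 * (i + 1)) - halfVal (2 * n + 1) F (4 * i) -
      halfVal (2 * n + 1) F (4 * (i + 2)) = ∑ k ∈ Finset.range n,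
        coarseCoeff n F k * ((4 * Real.sin (waveNumber n k) ^ 2 : ℝ) : ℂ) *
          (Real.sin ((i + 1 : ℕ) * ((k + 1 : ℕ) * Real.pi / (n + 1 : ℕ))) : ℂ) := by
  have hinv := fun j hj => sineCoeff_inversion (n := n)
    (f := fun i => halfVal (2 * n + 1) F (4 * i)) (halfVal_zero F)
    (halfVal_of_lt F (by omega)) (i := j) hj
  rw [hinv (i + 1) (by omega), hinv i (by omega), hinv (i + 2) (by omega), Finset.mul_sum,
    ← Finset.sum_sub_distrib, ← Finset.sum_sub_distrib]
  refine Finset.sum_congr rfl fun k _ => ?_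
  rw [coarseCoeff, sin_add_two_mul, ← two_mul_waveNumber, Real.cos_two_mul, Real.cos_sq']
  push_cast
  ring

theorem stiffForm_bigrid {F : DiscreteVec (2 * n + 1)} (hl : F ∈ linearSpace (2 * n + 1))
    (hb : F ∈ bigridSpace (2 * n + 1)) : stiffForm (2 * n + 1) F =
      (n + 1 : ℕ) / meshSize (2 * n + 1) * ∑ k ∈ Finset.range n,
        Real.sin (waveNumber n k) ^ 2 * ‖coarseCoeff n F k‖ ^ 2 := by
  have hh := (meshSize_pos (2 * n + 1)).ne'
  have h1 : star F ⬝ᵥ (stiffMatrix (2 * n + 1) *ᵥ F) =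
      1 / (2 * meshSize (2 * n + 1) : ℝ) * (((n + 1 : ℕ) / 2 * ∑ k ∈ Finset.range n,
        4 * Real.sin (waveNumber n k) ^ 2 * ‖coarseCoeff n F k‖ ^ 2 : ℝ) : ℂ) := by
    rw [dotProduct_stiff_bigrid hl hb]
    have h2 := sum_weighted_mul_conj (n := n) (fun i => halfVal (2 * n + 1) F (4 * i))
      fun k => 4 * Real.sin (waveNumber n k) ^ 2
    have h3 : ∀ k, sineCoeff n (fun i => halfVal (2 * n + 1) F (4 * i)) k = coarseCoeff n F k :=
      fun _ => rfl
    simp only [h3] at h2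
    rw [← h2, Finset.mul_sum]
    refine Finset.sum_congr rfl fun i hi => ?_
    rw [coarse_second_difference F (Finset.mem_range.mp hi)]
    push_cast
    ring
  rw [stiffForm, dotProduct_comm, h1, ← Complex.ofReal_one, ← Complex.ofReal_div,
    ← Complex.ofReal_mul, Complex.ofReal_re]
  simp only [mul_assoc, ← Finset.mul_sum]
  field_simp
  ring

/-- Only the coarse samples of `G` enter. They form a single coarse sine mode, so orthogonality
selects one coefficient of the data; the midpoint values of `G` are irrelevant. -/
theorem dotProduct_stiff_sine {F : DiscreteVec (2 * n + 1)} (hl : F ∈ linearSpace (2 * n + 1))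
    (hb : F ∈ bigridSpace (2 * n + 1)) {G : DiscreteVec (2 * n + 1)} {C : ℂ} {k : ℕ} (hk : k < n)
    (hG : ∀ j ≤ 2 * n + 2, halfVal (2 * n + 1) G (2 * j) = C * Real.sin (j * waveNumber n k)) :
    star G ⬝ᵥ (stiffMatrix (2 * n + 1) *ᵥ F) = (starRingEnd ℂ) C *
      (((n + 1 : ℕ) / meshSize (2 * n + 1) * Real.sin (waveNumber n k) ^ 2 : ℝ) : ℂ) *
        coarseCoeff n F k := by
  have hh : (meshSize (2 * n + 1) : ℂ) ≠ 0 := by exact_mod_cast (meshSize_pos (2 * n + 1)).ne'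
  rw [dotProduct_stiff_bigrid hl hb]
  calc _ = ∑ i ∈ Finset.range n, ∑ l ∈ Finset.range n, (starRingEnd ℂ) C *
        (1 / (2 * meshSize (2 * n + 1)) * (coarseCoeff n F l *
          ((4 * Real.sin (waveNumber n l) ^ 2 : ℝ) : ℂ))) *
        ((Real.sin ((i + 1 : ℕ) * ((l + 1 : ℕ) * Real.pi / (n + 1 : ℕ))) *
          Real.sin ((i + 1 : ℕ) * ((k + 1 : ℕ) * Real.pi / (n + 1 : ℕ))) : ℝ) : ℂ) := by
        refine Finset.sum_congr rfl fun i hi => ?_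
        have hi' := Finset.mem_range.mp hi
        rw [coarse_second_difference F hi', Finset.mul_sum, Finset.mul_sum]
        refine Finset.sum_congr rfl fun l _ => ?_
        rw [show 4 * (i + 1) = 2 * (2 * (i + 1)) by ring, hG _ (by omega), map_mul,
          Complex.conj_ofReal, show ((2 * (i + 1) : ℕ) : ℝ) * waveNumber n k =
            (i + 1 : ℕ) * (2 * waveNumber n k) by push_cast; ring, two_mul_waveNumber]
        push_cast
        ring
    _ = ∑ l ∈ Finset.range n, (starRingEnd ℂ) C *
        (1 / (2 * meshSize (2 * n + 1)) * (coarseCoeff n F l *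
          ((4 * Real.sin (waveNumber n l) ^ 2 : ℝ) : ℂ))) *
        ((if l = k then ((n + 1 : ℕ) : ℝ) / 2 else 0 : ℝ) : ℂ) := by
        rw [Finset.sum_comm]
        refine Finset.sum_congr rfl fun l hl => ?_
        rw [← Finset.mul_sum, ← Complex.ofReal_sum,
          sum_range_sin_mul_sin (Finset.mem_range.mp hl) hk]
    _ = _ := by
        rw [Finset.sum_eq_single k]
        · rw [if_pos rfl]
          push_cast
          field_simp
          ring
        · intro l _ hlk
          rw [if_neg hlk, Complex.ofReal_zero, mul_zero]
        · intro h
          exact absurd (Finset.mem_range.mpr hk) h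

theorem norm_convex_sq_le {a b : ℝ} (ha : 0 ≤ a) (hb : 0 ≤ b) (hab : a + b = 1) (z w : ℂ) :
    ‖(a : ℂ) * z + b * w‖ ^ 2 ≤ ‖z‖ ^ 2 + ‖w‖ ^ 2 := by
  have h1 : ‖(a : ℂ) * z + b * w‖ ≤ a * ‖z‖ + b * ‖w‖ := by
    refine (norm_add_le _ _).trans (le_of_eq ?_)
    rw [norm_mul, norm_mul, Complex.norm_real, Complex.norm_real, Real.norm_of_nonneg ha,
      Real.norm_of_nonneg hb]
  have h2 : ‖(a : ℂ) * z + b * w‖ ^ 2 ≤ (a * ‖z‖ + b * ‖w‖) ^ 2 := by gcongr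
  have h3 : a ≤ 1 := by linarith
  have h4 : b ≤ 1 := by linarith
  have h5 : (a * ‖z‖ + b * ‖w‖) ^ 2 ≤ (a + b) * (a * ‖z‖ ^ 2 + b * ‖w‖ ^ 2) := by
    nlinarith [mul_nonneg (mul_nonneg ha hb) (sq_nonneg (‖z‖ - ‖w‖))]
  rw [hab, one_mul] at h5
  have h6 := mul_le_of_le_one_left (sq_nonneg ‖z‖) h3
  have h7 := mul_le_of_le_one_left (sq_nonneg ‖w‖) h4
  linarith

theorem massForm_bigrid_le {F : DiscreteVec (2 * n + 1)} (hl : F ∈ linearSpace (2 * n + 1))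
    (hb : F ∈ bigridSpace (2 * n + 1)) :
    massForm (2 * n + 1) F ≤ 3 * ∑ k ∈ Finset.range n, ‖coarseCoeff n F k‖ ^ 2 := by
  have hh0 := meshSize_pos (2 * n + 1)
  set u := halfVal (2 * n + 1) F with hu
  set h := meshSize (2 * n + 1) with hh
  have hlin : ∀ j ≤ 2 * n + 1, u (2 * j + 1) = (u (2 * j) + u (2 * j + 2)) / 2 := hl
  have hbig : ∀ j ≤ n, u (4 * j + 2) = (u (4 * j) + u (4 * j + 4)) / 2 := by
    intro j hj
    have := hb j (by omega)
    rw [show 2 * (2 * j + 1) = 4 * j + 2 by ring, show 2 * (2 * j) = 4 * j by ring,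
      show 2 * (2 * j + 2) = 4 * j + 4 by ring] at this
    exact this
  -- Two fine cells form one coarse cell, and each of the six samples is a convex combination of its
  -- two end values.
  have hcell : ∀ i ≤ n, (‖u (2 * (2 * i))‖ ^ 2 + ‖u (2 * (2 * i) + 1)‖ ^ 2 +
      ‖u (2 * (2 * i) + 2)‖ ^ 2) + (‖u (2 * (2 * i + 1))‖ ^ 2 + ‖u (2 * (2 * i + 1) + 1)‖ ^ 2 +
      ‖u (2 * (2 * i + 1) + 2)‖ ^ 2) ≤ 6 * (‖u (4 * i)‖ ^ 2 + ‖u (4 * (i + 1))‖ ^ 2) := by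
    intro i hi
    have e0 := hbig i hi
    have e1 := hlin (2 * i) (by omega)
    have e2 := hlin (2 * i + 1) (by omega)
    rw [show 2 * (2 * i) + 1 = 4 * i + 1 by ring, show 2 * (2 * i) + 2 = 4 * i + 2 by ring,
      show 2 * (2 * i) = 4 * i by ring, e0] at e1
    rw [show 2 * (2 * i + 1) + 1 = 4 * i + 3 by ring, show 2 * (2 * i + 1) + 2 = 4 * i + 4 by ring,
      show 2 * (2 * i + 1) = 4 * i + 2 by ring, e0] at e2
    rw [show 2 * (2 * i) + 1 = 4 * i + 1 by ring, show 2 * (2 * i) + 2 = 4 * i + 2 by ring,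
      show 2 * (2 * i) = 4 * i by ring, show 2 * (2 * i + 1) + 1 = 4 * i + 3 by ring,
      show 2 * (2 * i + 1) + 2 = 4 * i + 4 by ring, show 2 * (2 * i + 1) = 4 * i + 2 by ring,
      show 4 * (i + 1) = 4 * i + 4 by ring]
    generalize u (4 * i) = x at *
    generalize u (4 * i + 4) = y at *
    have b0 : ‖u (4 * i + 2)‖ ^ 2 ≤ ‖x‖ ^ 2 + ‖y‖ ^ 2 := by
      rw [e0, show (x + y) / 2 = ((1 / 2 : ℝ) : ℂ) * x + ((1 / 2 : ℝ) : ℂ) * y by push_cast; ring]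
      exact norm_convex_sq_le (by norm_num) (by norm_num) (by norm_num) _ _
    have b1 : ‖u (4 * i + 1)‖ ^ 2 ≤ ‖x‖ ^ 2 + ‖y‖ ^ 2 := by
      rw [e1, show (x + (x + y) / 2) / 2 = ((3 / 4 : ℝ) : ℂ) * x + ((1 / 4 : ℝ) : ℂ) * y by
        push_cast; ring]
      exact norm_convex_sq_le (by norm_num) (by norm_num) (by norm_num) _ _
    have b2 : ‖u (4 * i + 3)‖ ^ 2 ≤ ‖x‖ ^ 2 + ‖y‖ ^ 2 := by
      rw [e2, show ((x + y) / 2 + y) / 2 = ((1 / 4 : ℝ) : ℂ) * x + ((3 / 4 : ℝ) : ℂ) * y by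
        push_cast; ring]
      exact norm_convex_sq_le (by norm_num) (by norm_num) (by norm_num) _ _
    have b3 := sq_nonneg ‖x‖
    have b4 := sq_nonneg ‖y‖
    linarith
  have hpair : ∀ (g : ℕ → ℝ) (m : ℕ), ∑ k ∈ Finset.range (2 * m), g k =
      ∑ i ∈ Finset.range m, (g (2 * i) + g (2 * i + 1)) := by
    intro g m
    induction m with
    | zero => simp
    | succ m ih =>
      rw [show 2 * (m + 1) = 2 * m + 1 + 1 by ring, Finset.sum_range_succ, Finset.sum_range_succ,
        ih, Finset.sum_range_succ]
      ring
  have hu0 : u (4 * 0) = 0 := halfVal_zero F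
  have hun : u (4 * (n + 1)) = 0 := halfVal_of_lt F (by omega)
  have hsum := sum_norm_sq_eq_sineCoeff (n := n) (f := fun i => u (4 * i)) hu0 hun
  have hhn : h * (n + 1 : ℕ) = 1 / 2 := by
    rw [hh, meshSize]
    push_cast
    field_simp
    ring
  calc massForm (2 * n + 1) F
      ≤ h * ∑ k ∈ Finset.range (2 * (n + 1)),
          (‖u (2 * k)‖ ^ 2 + ‖u (2 * k + 1)‖ ^ 2 + ‖u (2 * k + 2)‖ ^ 2) := massForm_upper F
    _ ≤ h * ∑ i ∈ Finset.range (n + 1), 6 * (‖u (4 * i)‖ ^ 2 + ‖u (4 * (i + 1))‖ ^ 2) := by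
        rw [hpair]
        refine mul_le_mul_of_nonneg_left (Finset.sum_le_sum fun i hi => ?_) hh0.le
        exact hcell i (by have := Finset.mem_range.mp hi; omega)
    _ = h * (12 * ∑ i ∈ Finset.range n, ‖u (4 * (i + 1))‖ ^ 2) := by
        rw [← Finset.mul_sum, Finset.sum_add_distrib, Finset.sum_range_succ', hu0,
          Finset.sum_range_succ (fun i => ‖u (4 * (i + 1))‖ ^ 2), hun]
        simp only [norm_zero]
        ring
    _ = 12 * (h * (n + 1 : ℕ)) / 2 * ∑ k ∈ Finset.range n, ‖coarseCoeff n F k‖ ^ 2 := by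
        rw [hsum]
        simp only [coarseCoeff]
        ring
    _ = _ := by rw [hhn]; ring

end Bigrid

end QuadFEM

namespace QuadFEM

/-! ### Size and boundary trace of the low modes. -/

section LowModes

variable {N : ℕ} {E : Matrix (Fin (2 * N + 1)) (Fin (2 * N + 1)) ℂ} {ev : Fin (2 * N + 1) → ℝ}

/-- Unit mass bounds the amplitude from below. Nodal values are at most `‖C‖`, and midpoint values
at most `17/12 * ‖C‖`, as `17/24` is the midpoint factor at `L = 5/2`. Each cell then contributes at
most `5 * ‖C‖ ^ 2`, and `h (N + 1) = 1`. -/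
theorem IsModalBasis.low_mode (h : IsModalBasis N E ev) {i : Fin (2 * N + 1)}
    (hi : ev i * meshSize N ^ 2 ≤ 5 / 2) : ∃ (C : ℂ) (m : ℕ), 1 / 5 ≤ ‖C‖ ^ 2 ∧
      Real.arccos (dispersion (ev i * meshSize N ^ 2)) = m * Real.pi * meshSize N ∧
      ∀ k ≤ N + 1, halfVal N (fun j => E j i) (2 * k) =
        C * Real.sin (k * Real.arccos (dispersion (ev i * meshSize N ^ 2))) := by
  have hh := meshSize_pos N
  set L := ev i * meshSize N ^ 2 with hL
  have hL0 : 0 < L := mul_pos (h.ev_pos i) (pow_pos hh 2)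
  obtain ⟨C, m, _, _, _, hη, hn, hm⟩ :=
    low_eigenvector (h.col_ne_zero i) hL0 (by linarith) (h.eigen_col i)
  refine ⟨C, m, ?_, hη, hn⟩
  have hnb : ∀ k ≤ N + 1, ‖halfVal N (fun j => E j i) (2 * k)‖ ≤ ‖C‖ := by
    intro k hk
    rw [hn k hk, norm_mul, Complex.norm_real]
    exact mul_le_of_le_one_right (norm_nonneg _) (Real.abs_sin_le_one _)
  have hβ0 : 0 < (40 + L) / (80 - 8 * L) := div_pos (by linarith) (by linarith)
  have hβ : (40 + L) / (80 - 8 * L) ≤ 17 / 24 := by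
    rw [div_le_div_iff₀ (by linarith) (by norm_num)]
    linarith
  have hmb : ∀ k ≤ N, ‖halfVal N (fun j => E j i) (2 * k + 1)‖ ≤ 17 / 12 * ‖C‖ := by
    intro k hk
    rw [hm k hk, norm_mul, Complex.norm_real, Real.norm_of_nonneg hβ0.le]
    have h1 := norm_add_le (halfVal N (fun j => E j i) (2 * k))
      (halfVal N (fun j => E j i) (2 * k + 2))
    have h2 := hnb k (by omega)
    have h3 := hnb (k + 1) (by omega)
    rw [show 2 * (k + 1) = 2 * k + 2 by ring] at h3
    calc (40 + L) / (80 - 8 * L) * ‖halfVal N (fun j => E j i) (2 * k) +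
          halfVal N (fun j => E j i) (2 * k + 2)‖ ≤ 17 / 24 * (2 * ‖C‖) := by
          gcongr
          linarith
      _ = _ := by ring
  have hu := massForm_upper fun j => E j i
  rw [h.massForm_col] at hu
  have hs : ∑ k ∈ Finset.range (N + 1), (‖halfVal N (fun j => E j i) (2 * k)‖ ^ 2 +
      ‖halfVal N (fun j => E j i) (2 * k + 1)‖ ^ 2 +
      ‖halfVal N (fun j => E j i) (2 * k + 2)‖ ^ 2) ≤ ∑ k ∈ Finset.range (N + 1), 5 * ‖C‖ ^ 2 := by
    refine Finset.sum_le_sum fun k hk => ?_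
    have hk' := Finset.mem_range.mp hk
    have h1 := pow_le_pow_left₀ (norm_nonneg _) (hnb k (by omega)) 2
    have h2 := pow_le_pow_left₀ (norm_nonneg _) (hnb (k + 1) (by omega)) 2
    have h3 := pow_le_pow_left₀ (norm_nonneg _) (hmb k (by omega)) 2
    rw [show 2 * (k + 1) = 2 * k + 2 by ring] at h2
    nlinarith [sq_nonneg ‖C‖]
  rw [Finset.sum_const, Finset.card_range, nsmul_eq_mul] at hs
  have h1 := hu.trans (mul_le_mul_of_nonneg_left hs hh.le)
  have h2 : meshSize N * (((N + 1 : ℕ) : ℝ) * (5 * ‖C‖ ^ 2)) = 5 * ‖C‖ ^ 2 := by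
    rw [meshSize]
    push_cast
    field_simp
  rw [h2] at h1
  linarith

/-- Since `(N + 1) η = mπ`, the last nodal value has modulus `‖C‖ sin η`. The factor 50 combines
`‖C‖ ^ 2 ≥ 1/5` with `sin² η ≥ L/10`. -/
theorem IsModalBasis.le_trace_sq (h : IsModalBasis N E ev) {i : Fin (2 * N + 1)}
    (hi : ev i * meshSize N ^ 2 ≤ 5 / 2) :
    ev i / 50 ≤ ‖halfVal N (fun j => E j i) (2 * N) / meshSize N‖ ^ 2 := by
  have hh := meshSize_pos N
  obtain ⟨C, m, hC, hη, hn⟩ := h.low_mode hi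
  set L := ev i * meshSize N ^ 2 with hL
  have hL0 : 0 < L := mul_pos (h.ev_pos i) (pow_pos hh 2)
  have hw1 := dispersion_lt_one hL0 (by linarith)
  have hw2 := neg_one_lt_dispersion (L := L) (by linarith)
  have hsq := le_one_sub_dispersion_sq hL0.le hi
  have hsin : Real.sin (N * Real.arccos (dispersion L)) ^ 2 = 1 - dispersion L ^ 2 := by
    have h1 : (N : ℝ) * Real.arccos (dispersion L) =
        m * Real.pi - Real.arccos (dispersion L) := by
      rw [hη, meshSize]
      field_simp
      ring
    rw [h1, Real.sin_sub, Real.sin_nat_mul_pi, zero_mul, zero_sub, neg_sq, mul_pow,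
      Real.sin_arccos, Real.sq_sqrt (by nlinarith), Real.cos_nat_mul_pi, ← pow_mul, mul_comm m 2,
      pow_mul, neg_one_sq, one_pow, one_mul]
  rw [hn N (by omega), norm_div, norm_mul, Complex.norm_real, Complex.norm_real, Real.norm_eq_abs,
    Real.norm_of_nonneg hh.le, div_pow, mul_pow, sq_abs, hsin, le_div_iff₀ (by positivity)]
  have h2 : L / 50 = 1 / 5 * (L / 10) := by ring
  calc ev i / 50 * meshSize N ^ 2 = 1 / 5 * (L / 10) := by rw [← h2, hL]; ring
    _ ≤ ‖C‖ ^ 2 * (1 - dispersion L ^ 2) := by gcongr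

/-- The modes with `λ h² ≤ 5 / 2`. -/
noncomputable def lowModes (N : ℕ) (ev : Fin (2 * N + 1) → ℝ) : Finset (Fin (2 * N + 1)) :=
  Finset.univ.filter fun i => ev i * meshSize N ^ 2 ≤ 5 / 2

theorem mem_lowModes {i : Fin (2 * N + 1)} :
    i ∈ lowModes N ev ↔ ev i * meshSize N ^ 2 ≤ 5 / 2 := by simp [lowModes]

end LowModes

/-! ### Low modes dominate the energy of bi-grid data. -/

section LowEnergy

variable {n : ℕ} {E : Matrix (Fin (2 * (2 * n + 1) + 1)) (Fin (2 * (2 * n + 1) + 1)) ℂ}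
  {ev : Fin (2 * (2 * n + 1) + 1) → ℝ}

/-- Every coarse sine mode is carried by a low mode of the finite element matrices. -/
theorem IsModalBasis.exists_index (h : IsModalBasis (2 * n + 1) E ev) :
    ∃ ι : ℕ → Fin (2 * (2 * n + 1) + 1), Set.InjOn ι (Finset.range n) ∧ ∀ k < n,
      ι k ∈ lowModes (2 * n + 1) ev ∧
      Real.arccos (dispersion (ev (ι k) * meshSize (2 * n + 1) ^ 2)) = waveNumber n k := by
  have hh := meshSize_pos (2 * n + 1)
  have hh2 : meshSize (2 * n + 1) ^ 2 ≠ 0 := by positivity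
  have hex : ∀ k : ℕ, ∃ i, k < n → i ∈ lowModes (2 * n + 1) ev ∧
      Real.arccos (dispersion (ev i * meshSize (2 * n + 1) ^ 2)) = waveNumber n k := by
    intro k
    by_cases hk : k < n
    · obtain ⟨F, L, hF, _, hL, hη, hev⟩ :=
        exists_low_eigenvector (N := 2 * n + 1) (k := k + 1) (by omega) (by omega)
      obtain ⟨i, hi⟩ := h.exists_ev_eq hF hev
      have hiL : ev i * meshSize (2 * n + 1) ^ 2 = L := by
        rw [hi, div_mul_cancel₀ _ hh2]
      exact ⟨i, fun _ => ⟨mem_lowModes.mpr (by rw [hiL]; exact hL), by rw [hiL, hη]; rfl⟩⟩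
    · exact ⟨0, fun h => absurd h hk⟩
  choose ι hι using hex
  refine ⟨ι, fun k hk l hl hkl => ?_, hι⟩
  have h1 := (hι k (Finset.mem_range.mp hk)).2
  rw [hkl, (hι l (Finset.mem_range.mp hl)).2, waveNumber, waveNumber] at h1
  have h2 := mul_right_cancel₀ Real.pi_ne_zero (mul_right_cancel₀ hh.ne' h1)
  have h3 : l + 1 = k + 1 := by exact_mod_cast h2
  omega

/-- The modal coefficient `c` satisfies `λ c = φᴴ S F`, which `dotProduct_stiff_sine` evaluates as
an explicit multiple of the coarse coefficient. Thus one low mode recovers the whole share of energy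
of its coarse sine mode, whatever the aliased and optic modes receive. -/
theorem IsModalBasis.coeff_bigrid (h : IsModalBasis (2 * n + 1) E ev)
    {F : DiscreteVec (2 * n + 1)} (hl : F ∈ linearSpace (2 * n + 1))
    (hb : F ∈ bigridSpace (2 * n + 1)) {i : Fin (2 * (2 * n + 1) + 1)} {k : ℕ} (hk : k < n)
    (hi : i ∈ lowModes (2 * n + 1) ev)
    (hη : Real.arccos (dispersion (ev i * meshSize (2 * n + 1) ^ 2)) = waveNumber n k) :
    Real.sin (waveNumber n k) ^ 2 * ((n + 1 : ℕ) / meshSize (2 * n + 1)) *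
        ‖coarseCoeff n F k‖ ^ 2 ≤
        100 * (ev i * ‖(Eᴴ *ᵥ (massMatrix (2 * n + 1) *ᵥ F)) i‖ ^ 2) ∧
      ‖coarseCoeff n F k‖ ^ 2 ≤
        2000 * ‖(Eᴴ *ᵥ (massMatrix (2 * n + 1) *ᵥ F)) i‖ ^ 2 := by
  have hh := meshSize_pos (2 * n + 1)
  set m := meshSize (2 * n + 1) with hm
  have hi' := mem_lowModes.mp hi
  obtain ⟨C, _, hC, _, hn⟩ := h.low_mode hi'
  have hev := h.ev_pos i
  have hL0 : 0 < ev i * m ^ 2 := mul_pos hev (pow_pos hh 2)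
  have hw1 := dispersion_lt_one hL0 (by linarith)
  have hw2 := neg_one_lt_dispersion (L := ev i * m ^ 2) (by linarith)
  have hcos : Real.cos (waveNumber n k) = dispersion (ev i * m ^ 2) := by
    rw [← hη, Real.cos_arccos hw2.le hw1.le]
  have hs : ev i * m ^ 2 / 10 ≤ Real.sin (waveNumber n k) ^ 2 := by
    rw [Real.sin_sq, hcos]
    exact le_one_sub_dispersion_sq hL0.le hi'
  rw [hη] at hn
  have hdot := dotProduct_stiff_sine hl hb hk hn
  have hcoef : (Eᴴ *ᵥ (stiffMatrix (2 * n + 1) *ᵥ F)) i =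
      star (fun j => E j i) ⬝ᵥ (stiffMatrix (2 * n + 1) *ᵥ F) := rfl
  rw [← hcoef, h.coeff_stiff] at hdot
  set c := (Eᴴ *ᵥ (massMatrix (2 * n + 1) *ᵥ F)) i with hc
  set α := coarseCoeff n F k with hα
  set s := Real.sin (waveNumber n k) ^ 2 with hsdef
  have hs0 : 0 ≤ s := sq_nonneg _
  set K : ℝ := ((n + 1 : ℕ) : ℝ) with hK
  have hK0 : 0 < K := by positivity
  have hKm : K * m = 1 / 2 := by
    rw [hK, hm, meshSize]
    push_cast
    field_simp
    ring
  have hnorm : ev i * ‖c‖ = ‖C‖ * (K / m * s) * ‖α‖ := by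
    have := congrArg norm hdot
    rw [norm_mul, norm_mul, norm_mul, Complex.norm_real, Complex.norm_real, RCLike.norm_conj,
      Real.norm_of_nonneg hev.le, Real.norm_of_nonneg (by positivity)] at this
    exact this
  have hsq : ev i ^ 2 * ‖c‖ ^ 2 = ‖C‖ ^ 2 * (K / m) ^ 2 * s ^ 2 * ‖α‖ ^ 2 := by
    rw [← mul_pow, hnorm]
    ring
  -- The coarse step is `2h`, hence `(K/m)² = 1/(4h⁴)`. With `‖C‖ ^ 2 ≥ 1/5` and `s ≥ λh²/10`, this
  -- yields the constants 100 and 2000.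
  have hK2 : K = 1 / (2 * m) := by field_simp; linarith
  constructor
  · have h1 : ev i * (s * (K / m) * ‖α‖ ^ 2) ≤ ev i * (100 * (ev i * ‖c‖ ^ 2)) := by
      calc ev i * (s * (K / m) * ‖α‖ ^ 2)
          = 100 * (1 / 5 * (K / m) ^ 2 * (s * (ev i * m ^ 2 / 10)) * ‖α‖ ^ 2) := by
            rw [hK2]
            field_simp
            ring
        _ ≤ 100 * (‖C‖ ^ 2 * (K / m) ^ 2 * (s * s) * ‖α‖ ^ 2) := by gcongr
        _ = ev i * (100 * (ev i * ‖c‖ ^ 2)) := by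
            rw [← sq, ← hsq]
            ring
    exact le_of_mul_le_mul_left h1 hev
  · have h1 : ev i ^ 2 * ‖α‖ ^ 2 ≤ ev i ^ 2 * (2000 * ‖c‖ ^ 2) := by
      calc ev i ^ 2 * ‖α‖ ^ 2
          = 2000 * (1 / 5 * (K / m) ^ 2 * (ev i * m ^ 2 / 10) ^ 2 * ‖α‖ ^ 2) := by
            rw [hK2]
            field_simp
            ring
        _ ≤ 2000 * (‖C‖ ^ 2 * (K / m) ^ 2 * s ^ 2 * ‖α‖ ^ 2) := by gcongr
        _ = ev i ^ 2 * (2000 * ‖c‖ ^ 2) := by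
            rw [← hsq]
            ring
    exact le_of_mul_le_mul_left h1 (by positivity)

theorem IsModalBasis.stiffForm_bigrid_le_low (h : IsModalBasis (2 * n + 1) E ev)
    {F : DiscreteVec (2 * n + 1)} (hl : F ∈ linearSpace (2 * n + 1))
    (hb : F ∈ bigridSpace (2 * n + 1)) : stiffForm (2 * n + 1) F ≤
      100 * ∑ i ∈ lowModes (2 * n + 1) ev,
        ev i * ‖(Eᴴ *ᵥ (massMatrix (2 * n + 1) *ᵥ F)) i‖ ^ 2 := by
  obtain ⟨ι, hinj, hι⟩ := h.exists_index
  rw [stiffForm_bigrid hl hb, Finset.mul_sum, Finset.mul_sum]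
  calc _ ≤ ∑ k ∈ Finset.range n,
        100 * (ev (ι k) * ‖(Eᴴ *ᵥ (massMatrix (2 * n + 1) *ᵥ F)) (ι k)‖ ^ 2) := by
        refine Finset.sum_le_sum fun k hk => ?_
        have hk' := Finset.mem_range.mp hk
        refine le_trans (le_of_eq ?_) (h.coeff_bigrid hl hb hk' (hι k hk').1 (hι k hk').2).1
        ring
    _ = ∑ i ∈ (Finset.range n).image ι,
        100 * (ev i * ‖(Eᴴ *ᵥ (massMatrix (2 * n + 1) *ᵥ F)) i‖ ^ 2) := by
        rw [Finset.sum_image hinj]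
    _ ≤ _ := by
        refine Finset.sum_le_sum_of_subset_of_nonneg ?_ fun i _ _ => ?_
        · intro i hi
          obtain ⟨k, hk, rfl⟩ := Finset.mem_image.mp hi
          exact (hι k (Finset.mem_range.mp hk)).1
        · have := h.ev_pos i
          positivity

theorem IsModalBasis.massForm_bigrid_le_low (h : IsModalBasis (2 * n + 1) E ev)
    {F : DiscreteVec (2 * n + 1)} (hl : F ∈ linearSpace (2 * n + 1))
    (hb : F ∈ bigridSpace (2 * n + 1)) : massForm (2 * n + 1) F ≤
      6000 * ∑ i ∈ lowModes (2 * n + 1) ev,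
        ‖(Eᴴ *ᵥ (massMatrix (2 * n + 1) *ᵥ F)) i‖ ^ 2 := by
  obtain ⟨ι, hinj, hι⟩ := h.exists_index
  refine (massForm_bigrid_le hl hb).trans ?_
  rw [Finset.mul_sum, Finset.mul_sum]
  calc _ ≤ ∑ k ∈ Finset.range n,
        6000 * ‖(Eᴴ *ᵥ (massMatrix (2 * n + 1) *ᵥ F)) (ι k)‖ ^ 2 := by
        refine Finset.sum_le_sum fun k hk => ?_
        have hk' := Finset.mem_range.mp hk
        have := (h.coeff_bigrid hl hb hk' (hι k hk').1 (hι k hk').2).2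
        linarith
    _ = ∑ i ∈ (Finset.range n).image ι,
        6000 * ‖(Eᴴ *ᵥ (massMatrix (2 * n + 1) *ᵥ F)) i‖ ^ 2 := by
        rw [Finset.sum_image hinj]
    _ ≤ _ := by
        refine Finset.sum_le_sum_of_subset_of_nonneg ?_ fun i _ _ => by positivity
        intro i hi
        obtain ⟨k, hk, rfl⟩ := Finset.mem_image.mp hi
        exact (hι k (Finset.mem_range.mp hk)).1

end LowEnergy

end QuadFEM

namespace QuadFEM

/-! ### Observability from spectral data alone. -/

section SpectralObservability

open Complex

variable {ι : Type*}

/-- The frequencies `± ω`. -/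
noncomputable def signedFreq (ω : ι → ℝ) (p : ι × Bool) : ℝ := if p.2 then ω p.1 else -ω p.1

/-- The amplitudes attached to the frequencies `± ω`. -/
def signedCoeff (A B : ι → ℂ) (p : ι × Bool) : ℂ := if p.2 then A p.1 else B p.1

/-- The oscillation of mode `i` with amplitudes `A i`, `B i`. -/
noncomputable def modeWave (ω : ι → ℝ) (A B : ι → ℂ) (i : ι) (t : ℝ) : ℂ :=
  A i * exp (I * ω i * t) + B i * exp (I * ((-ω i : ℝ) : ℂ) * t)

theorem continuous_modeWave (ω : ι → ℝ) (A B : ι → ℂ) (i : ι) : Continuous (modeWave ω A B i) := by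
  unfold modeWave
  fun_prop

theorem norm_exp_I_mul (x t : ℝ) : ‖exp (I * x * t)‖ = 1 := by
  rw [show I * (x : ℂ) * (t : ℂ) = ((x * t : ℝ) : ℂ) * I by push_cast; ring,
    Complex.norm_exp_ofReal_mul_I]

theorem norm_modeWave_sq_le (ω : ι → ℝ) (A B : ι → ℂ) (i : ι) (t : ℝ) :
    ‖modeWave ω A B i t‖ ^ 2 ≤ 2 * (‖A i‖ ^ 2 + ‖B i‖ ^ 2) := by
  have h := norm_add_le (A i * exp (I * ω i * t)) (B i * exp (I * ((-ω i : ℝ) : ℂ) * t))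
  rw [norm_mul, norm_mul, norm_exp_I_mul, norm_exp_I_mul, mul_one, mul_one] at h
  rw [modeWave]
  nlinarith [sq_nonneg (‖A i‖ - ‖B i‖),
    norm_nonneg (A i * exp (I * ω i * t) + B i * exp (I * ((-ω i : ℝ) : ℂ) * t))]

/-- A symmetric average of shifts multiplies both exponentials `±ω` by the same real cosine, so the
filter acts on each mode as a scalar. -/
theorem modeWave_shift (ω : ι → ℝ) (A B : ι → ℂ) (i : ι) (t r : ℝ) :
    (modeWave ω A B i (t + r) + modeWave ω A B i (t - r)) / 2 =
      Real.cos (r * ω i) * modeWave ω A B i t := by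
  have h1 : ∀ x : ℝ, exp (I * x * ((t + r : ℝ) : ℂ)) = exp (I * x * t) * exp (x * r * I) := by
    intro x
    rw [← Complex.exp_add]
    congr 1
    push_cast
    ring
  have h2 : ∀ x : ℝ, exp (I * x * ((t - r : ℝ) : ℂ)) = exp (I * x * t) * exp (-(x * r) * I) := by
    intro x
    rw [← Complex.exp_add]
    congr 1
    push_cast
    ring
  simp only [modeWave, h1, h2]
  rw [Complex.ofReal_cos, Complex.cos]
  push_cast
  rw [show -(ω i : ℂ) * r * I = -(r * ω i) * I by ring,
    show -(-(ω i : ℂ) * r) * I = r * ω i * I by ring, show (ω i : ℂ) * r * I = r * ω i * I by ring,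
    show -((ω i : ℂ) * r) * I = -(r * ω i) * I by ring]
  ring

/-- The multiplier of `shiftFilter` at frequency `x`. -/
noncomputable def filterSymbol (J : ℕ) (x : ℝ) : ℝ :=
  ∑ j ∈ Finset.range (J + 1), tentCoeff j * Real.cos (j * x)

theorem shiftFilter_sum_modeWave [Fintype ι] (ω : ι → ℝ) (d A B : ι → ℂ) (J : ℕ) (s t : ℝ) :
    shiftFilter J s (fun t => ∑ i, d i * modeWave ω A B i t) t =
      ∑ i, d i * (filterSymbol J (s * ω i) * modeWave ω A B i t) := by
  have h1 : ∀ j : ℕ, (tentCoeff j : ℂ) * ((∑ i, d i * modeWave ω A B i (t + j * s) +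
      ∑ i, d i * modeWave ω A B i (t - j * s)) / 2) =
      ∑ i, d i * (((tentCoeff j * Real.cos (j * (s * ω i)) : ℝ) : ℂ) * modeWave ω A B i t) := by
    intro j
    rw [← Finset.sum_add_distrib, Finset.sum_div, Finset.mul_sum]
    refine Finset.sum_congr rfl fun i _ => ?_
    have h := modeWave_shift ω A B i t (j * s)
    rw [← mul_add, mul_div_assoc, h, mul_assoc (j : ℝ) s, Complex.ofReal_mul]
    ring
  unfold shiftFilter
  simp only [h1]
  rw [Finset.sum_comm]
  refine Finset.sum_congr rfl fun i _ => ?_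
  rw [filterSymbol, Complex.ofReal_sum, Finset.sum_mul, Finset.mul_sum]

theorem sum_signed_exp (s : Finset ι) (ω : ι → ℝ) (A B : ι → ℂ) (t : ℝ) :
    ∑ p ∈ s ×ˢ (Finset.univ : Finset Bool),
      signedCoeff A B p * exp (I * signedFreq ω p * t) = ∑ i ∈ s, modeWave ω A B i t := by
  rw [Finset.sum_product]
  refine Finset.sum_congr rfl fun i _ => ?_
  rw [Fintype.sum_bool]
  simp [signedCoeff, signedFreq, modeWave]

theorem sum_norm_signedCoeff (s : Finset ι) (A B : ι → ℂ) :
    ∑ p ∈ s ×ˢ (Finset.univ : Finset Bool), ‖signedCoeff A B p‖ ^ 2 =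
      ∑ i ∈ s, (‖A i‖ ^ 2 + ‖B i‖ ^ 2) := by
  rw [Finset.sum_product]
  refine Finset.sum_congr rfl fun i _ => ?_
  rw [Fintype.sum_bool]
  simp [signedCoeff]

/-- Frequencies and boundary traces of the modes of the semi-discrete problem. -/
structure SpectralTrace [Fintype ι] (h : ℝ) (ω : ι → ℝ) (d : ι → ℂ) : Prop where
  mesh_pos : 0 < h
  freq_pos : ∀ i, 0 < ω i
  freq_le : ∀ i, (ω i * h) ^ 2 ≤ 60
  wave_number : ∀ i, (ω i * h) ^ 2 ≤ 4 →
    ∃ m : ℕ, Real.arccos (dispersion ((ω i * h) ^ 2)) = m * Real.pi * h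
  simple : ∀ i j, (ω i * h) ^ 2 ≤ 4 → ω i = ω j → i = j
  trace_lower : ∀ i, (ω i * h) ^ 2 ≤ 5 / 2 → ω i ^ 2 / 50 ≤ ‖d i‖ ^ 2
  trace_upper : ∀ z : ι → ℂ, ‖∑ i, d i * z i‖ ^ 2 ≤ 15 / h ^ 3 * ∑ i, ‖z i‖ ^ 2

/-- The energy of a superposition of modes. -/
noncomputable def modalEnergy [Fintype ι] (ω : ι → ℝ) (A B : ι → ℂ) : ℝ :=
  ∑ i, ω i ^ 2 * (‖A i‖ ^ 2 + ‖B i‖ ^ 2)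

namespace SpectralTrace

variable [Fintype ι] {h : ℝ} {ω : ι → ℝ} {d : ι → ℂ}

/-- Separation of the acoustic frequencies with `(ω h)² ≤ 4`. -/
theorem gap (hS : SpectralTrace h ω d) (m : ι → ℕ)
    (hm : ∀ i, (ω i * h) ^ 2 ≤ 4 → Real.arccos (dispersion ((ω i * h) ^ 2)) = m i * Real.pi * h)
    {i j : ι} (hi : (ω i * h) ^ 2 ≤ 4) (hj : (ω j * h) ^ 2 ≤ 4) :
    Real.pi * m i ≤ ω i ∧ Real.pi * |(m i : ℝ) - m j| ≤ |ω i - ω j| := by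
  have hh := hS.mesh_pos
  have hle2 : ∀ {i}, (ω i * h) ^ 2 ≤ 4 → ω i * h ≤ 2 := by
    intro i hi
    nlinarith [mul_pos (hS.freq_pos i) hh]
  have hmono : ∀ {i j}, (ω i * h) ^ 2 ≤ 4 → (ω j * h) ^ 2 ≤ 4 → ω i ≤ ω j →
      Real.pi * |(m i : ℝ) - m j| ≤ |ω i - ω j| := by
    intro i j hi hj hij
    have hωi := hS.freq_pos i
    have hxy : ω i * h ≤ ω j * h := by gcongr
    -- The wave numbers are integer multiples of `πh`; dividing the inequality by `h` gives the gap.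
    have h1 := arccos_dispersion_sub_le (mul_pos hωi hh).le hxy (hle2 hj)
    have h2 : dispersion ((ω j * h) ^ 2) ≤ dispersion ((ω i * h) ^ 2) :=
      strictAntiOn_dispersion.antitoneOn ⟨sq_nonneg _, hi⟩ ⟨sq_nonneg _, hj⟩
        (pow_le_pow_left₀ (mul_pos hωi hh).le hxy 2)
    have h3 := Real.arccos_le_arccos h2
    rw [hm i hi, hm j hj] at h1 h3
    have h4 : (m i : ℝ) ≤ m j :=
      le_of_mul_le_mul_right (le_of_mul_le_mul_right h3 hh) Real.pi_pos
    rw [abs_sub_comm, abs_of_nonneg (by linarith), abs_sub_comm, abs_of_nonneg (by linarith)]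
    refine le_of_mul_le_mul_right ?_ hh
    linarith
  refine ⟨?_, ?_⟩
  -- Comparison with frequency zero gives `ω ≥ πm`, which separates `ω` from the negative
  -- frequencies.
  · have h1 := arccos_dispersion_sub_le le_rfl (mul_pos (hS.freq_pos i) hh).le (hle2 hi)
    rw [hm i hi, zero_pow two_ne_zero, dispersion_zero, Real.arccos_one] at h1
    refine le_of_mul_le_mul_right ?_ hh
    linarith
  · rcases le_total (ω i) (ω j) with hij | hij
    · exact hmono hi hj hij
    · rw [abs_sub_comm, abs_sub_comm (ω i)]
      exact hmono hj hi hij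

/-- Ingham's inequality for the acoustic modes with `(ω h)² ≤ 4`. -/
theorem ingham (hS : SpectralTrace h ω d) (s : Finset ι) (hs : ∀ i ∈ s, (ω i * h) ^ 2 ≤ 4)
    {τ : ℝ} (hτ : 1 < τ) (t₀ : ℝ) (A B : ι → ℂ) :
    4 / Real.pi * (τ - 1 / τ) * ∑ i ∈ s, (‖A i‖ ^ 2 + ‖B i‖ ^ 2) ≤
      ∫ t in (t₀ - τ)..(t₀ + τ), ‖∑ i ∈ s, modeWave ω A B i t‖ ^ 2 := by
  have hh := hS.mesh_pos
  have hpi := Real.pi_pos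
  have hex : ∀ i, ∃ m : ℕ, (ω i * h) ^ 2 ≤ 4 →
      Real.arccos (dispersion ((ω i * h) ^ 2)) = m * Real.pi * h := by
    intro i
    by_cases hi : (ω i * h) ^ 2 ≤ 4
    · obtain ⟨m, hm⟩ := hS.wave_number i hi
      exact ⟨m, fun _ => hm⟩
    · exact ⟨0, fun h => absurd h hi⟩
  choose m hm using hex
  have hpos : ∀ i ∈ s, 1 ≤ m i := by
    intro i hi
    have h0 : 0 < (ω i * h) ^ 2 := pow_pos (mul_pos (hS.freq_pos i) hh) 2
    have h1 := Real.arccos_pos.mpr (dispersion_lt_one h0 (by linarith [hs i hi]))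
    rw [hm i (hs i hi)] at h1
    by_contra h2
    rw [show m i = 0 by omega] at h1
    simp at h1
  have hinj : ∀ i ∈ s, ∀ j ∈ s, m i = m j → i = j := by
    intro i hi j hj hij
    have h1 : Real.arccos (dispersion ((ω i * h) ^ 2)) =
        Real.arccos (dispersion ((ω j * h) ^ 2)) := by
      rw [hm i (hs i hi), hm j (hs j hj), hij]
    have hmem : ∀ i ∈ s, dispersion ((ω i * h) ^ 2) ∈ Set.Icc (-1 : ℝ) 1 := by
      intro i hi
      have h0 : 0 < (ω i * h) ^ 2 := pow_pos (mul_pos (hS.freq_pos i) hh) 2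
      exact ⟨(neg_one_lt_dispersion (by linarith [hs i hi])).le,
        (dispersion_lt_one h0 (by linarith [hs i hi])).le⟩
    have h2 := Real.arccos_injOn (hmem i hi) (hmem j hj) h1
    have h3 := strictAntiOn_dispersion.injOn ⟨sq_nonneg _, hs i hi⟩ ⟨sq_nonneg _, hs j hj⟩ h2
    have h4 := (sq_eq_sq₀ (mul_pos (hS.freq_pos i) hh).le (mul_pos (hS.freq_pos j) hh).le).mp h3
    exact hS.simple i j (hs i hi) (mul_right_cancel₀ hh.ne' h4)
  -- The frequencies `±ω` carry the labels `±m`; these are distinct because `m ≥ 1` and `m` is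
  -- injective on `s`.
  let n : ι × Bool → ℤ := fun p => if p.2 then (m p.1 : ℤ) else -(m p.1 : ℤ)
  have hn : Set.InjOn n (s ×ˢ (Finset.univ : Finset Bool) : Finset (ι × Bool)) := by
    rintro ⟨i, b⟩ hp ⟨j, b'⟩ hq hpq
    have hi : i ∈ s := by simpa using hp
    have hj : j ∈ s := by simpa using hq
    have h1 := hpos i hi
    have h2 := hpos j hj
    have h3 := hinj i hi j hj
    cases b <;> cases b' <;> simp only [n, if_true, if_false, Bool.false_eq_true] at hpq
    · rw [h3 (by omega)]
    · omega
    · omega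
    · rw [h3 (by omega)]
  have hgap : ∀ p ∈ s ×ˢ (Finset.univ : Finset Bool), ∀ q ∈ s ×ˢ (Finset.univ : Finset Bool),
      Real.pi * |((n p - n q : ℤ) : ℝ)| ≤ |signedFreq ω p - signedFreq ω q| := by
    rintro ⟨i, b⟩ hp ⟨j, b'⟩ hq
    have hi : i ∈ s := by simpa using hp
    have hj : j ∈ s := by simpa using hq
    obtain ⟨g1, g2⟩ := hS.gap m hm (hs i hi) (hs j hj)
    have g3 := (hS.gap m hm (hs j hj) (hs i hi)).1
    have hωi := hS.freq_pos i
    have hωj := hS.freq_pos j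
    have hmi : (0 : ℝ) ≤ m i := by positivity
    have hmj : (0 : ℝ) ≤ m j := by positivity
    cases b <;> cases b' <;> simp only [n, signedFreq, if_true, if_false, Bool.false_eq_true] <;>
      push_cast
    · rw [show -(m i : ℝ) - -(m j : ℝ) = -((m i : ℝ) - m j) by ring,
        show -ω i - -ω j = -(ω i - ω j) by ring, abs_neg, abs_neg]
      exact g2
    · rw [abs_of_nonpos (by linarith), abs_of_nonpos (by linarith)]
      linarith
    · rw [abs_of_nonneg (by linarith), abs_of_nonneg (by linarith)]
      linarith
    · exact g2
  have key := ingham_inequality_shift (s ×ˢ (Finset.univ : Finset Bool)) hτ t₀ (signedFreq ω) n hn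
    hgap (signedCoeff A B)
  rw [sum_norm_signedCoeff] at key
  simpa only [sum_signed_exp] using key

theorem continuous_trace (ω : ι → ℝ) (d A B : ι → ℂ) :
    Continuous fun t => ∑ i, d i * modeWave ω A B i t :=
  continuous_finsetSum _ fun i _ => continuous_const.mul (continuous_modeWave ω A B i)

theorem filterSymbol_bounds (hS : SpectralTrace h ω d) {J : ℕ} (hJ : 20 ≤ J) (i : ι) :
    ((ω i * h) ^ 2 ≤ 5 / 2 → 1 / 10 ≤ filterSymbol J (h / 2 * ω i)) ∧
    (4 < (ω i * h) ^ 2 → |filterSymbol J (h / 2 * ω i)| ≤ 2 / J) := by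
  have hpi := Real.pi_gt_three
  have hx0 : 0 < ω i * h := mul_pos (hS.freq_pos i) hS.mesh_pos
  have hle := hS.freq_le i
  -- The filter variable `ωh/2` is then at most 5, below `2π - 1`, so no mode meets the next
  -- periodic tent.
  have hx1 : ω i * h ≤ 10 := by nlinarith
  have hb := abs_sum_tentCoeff_mul_cos_sub_le (x := h / 2 * ω i) (by linarith) (by linarith)
    (J := J) (by omega)
  have hJ' : (2 : ℝ) / J ≤ 1 / 10 := by
    have : (20 : ℝ) ≤ J := by exact_mod_cast hJ
    rw [div_le_div_iff₀ (by linarith) (by norm_num)]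
    linarith
  constructor
  · intro hlow
    -- The tent is at least `1/5` here, and the truncation error is at most `2/20 = 1/10`.
    have h1 : ω i * h ≤ 8 / 5 := by nlinarith
    have h2 := (abs_le.mp hb).1
    have h3 := le_max_right 0 (1 - h / 2 * ω i)
    unfold filterSymbol
    linarith
  · intro hhigh
    have h1 : 2 ≤ ω i * h := by nlinarith
    rwa [max_eq_left (by linarith), sub_zero] at hb

/-- The loss `15/h³` of the trace bound is met by the symbol bound `(2/J)²` and by `1 ≤ ω²h²/4` on
these modes, which turns amplitudes into energy. For `J` of order `1/h` the result is `O(h)`. -/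
theorem norm_high_filtered_sq_le (hS : SpectralTrace h ω d) {J : ℕ} (hJ : 20 ≤ J) (A B : ι → ℂ)
    (s : Finset ι) (hs : ∀ i ∈ s, 4 < (ω i * h) ^ 2) (t : ℝ) :
    ‖∑ i ∈ s, d i * (filterSymbol J (h / 2 * ω i) * modeWave ω A B i t)‖ ^ 2 ≤
      30 / (h * (J : ℝ) ^ 2) * modalEnergy ω A B := by
  classical
  have hh := hS.mesh_pos
  have hJ0 : (0 : ℝ) < J := by exact_mod_cast (by omega : 0 < J)
  have h1 := hS.trace_upper fun i =>
    if i ∈ s then (filterSymbol J (h / 2 * ω i) : ℂ) * modeWave ω A B i t else 0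
  have h2 : ∑ i, d i * (if i ∈ s then (filterSymbol J (h / 2 * ω i) : ℂ) * modeWave ω A B i t
      else 0) = ∑ i ∈ s, d i * (filterSymbol J (h / 2 * ω i) * modeWave ω A B i t) := by
    simp only [mul_ite, mul_zero, Finset.sum_ite_mem, Finset.univ_inter]
  rw [h2] at h1
  refine h1.trans ?_
  have h3 : ∀ i, ‖(if i ∈ s then (filterSymbol J (h / 2 * ω i) : ℂ) * modeWave ω A B i t
      else 0)‖ ^ 2 ≤ 2 * h ^ 2 / (J : ℝ) ^ 2 * (ω i ^ 2 * (‖A i‖ ^ 2 + ‖B i‖ ^ 2)) := by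
    intro i
    have hω := hS.freq_pos i
    split_ifs with hi
    · have hP := (hS.filterSymbol_bounds hJ i).2 (hs i hi)
      have hW := norm_modeWave_sq_le ω A B i t
      have h4 : 4 ≤ ω i ^ 2 * h ^ 2 := by rw [← mul_pow]; exact (hs i hi).le
      rw [norm_mul, mul_pow, Complex.norm_real, Real.norm_eq_abs]
      calc |filterSymbol J (h / 2 * ω i)| ^ 2 * ‖modeWave ω A B i t‖ ^ 2
          ≤ (2 / J) ^ 2 * (2 * (‖A i‖ ^ 2 + ‖B i‖ ^ 2)) := by gcongr
        _ = 2 / (J : ℝ) ^ 2 * (‖A i‖ ^ 2 + ‖B i‖ ^ 2) * 4 := by ring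
        _ ≤ 2 / (J : ℝ) ^ 2 * (‖A i‖ ^ 2 + ‖B i‖ ^ 2) * (ω i ^ 2 * h ^ 2) := by gcongr
        _ = _ := by ring
    · rw [norm_zero, zero_pow two_ne_zero]
      positivity
  calc _ ≤ 15 / h ^ 3 * ∑ i, 2 * h ^ 2 / (J : ℝ) ^ 2 * (ω i ^ 2 * (‖A i‖ ^ 2 + ‖B i‖ ^ 2)) := by
        gcongr with i _
        exact h3 i
    _ = _ := by
        rw [← Finset.mul_sum, modalEnergy]
        field_simp
        ring

/-- Uniform observability for small mesh sizes, for data whose energy is controlled by its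
low-frequency part. -/
theorem observability (hS : SpectralTrace h ω d) {T : ℝ} (hT : 2 < T) (A B : ι → ℂ)
    (hlow : modalEnergy ω A B ≤ 6000 * ∑ i with (ω i * h) ^ 2 ≤ 5 / 2,
      ω i ^ 2 * (‖A i‖ ^ 2 + ‖B i‖ ^ 2))
    {δ τ κ : ℝ} (hδ : δ = (T - 2) / 4) (hτ : τ = (T + 2) / 4)
    (hκ : κ = 4 / Real.pi * (τ - 1 / τ)) (hhδ : h ≤ δ / 20)
    (hsmall : 60 * T * h / δ ^ 2 ≤ κ / 60000000) :
    modalEnergy ω A B ≤ 120000000 / κ *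
      ∫ t in (0 : ℝ)..T, ‖∑ i, d i * modeWave ω A B i t‖ ^ 2 := by
  classical
  have hh := hS.mesh_pos
  have hδ0 : 0 < δ := by rw [hδ]; linarith
  have hτ1 : 1 < τ := by rw [hτ]; linarith
  have hκ0 : 0 < κ := by
    have : 1 / τ < 1 := by rw [div_lt_one (by linarith)]; exact hτ1
    have h1 : 0 < τ - 1 / τ := by linarith
    rw [hκ]
    have := Real.pi_pos
    positivity
  set 𝓔 := modalEnergy ω A B with h𝓔
  have h𝓔0 : 0 ≤ 𝓔 := Finset.sum_nonneg fun i _ => by positivity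
  set g : ℝ → ℂ := fun t => ∑ i, d i * modeWave ω A B i t with hg
  have hgc : Continuous g := continuous_trace ω d A B
  -- The largest number of steps `h/2` that fits in the margin `δ`; `h ≤ δ/20` ensures `J ≥ δ/h ≥
  -- 20`.
  set J : ℕ := ⌊2 * δ / h⌋₊ with hJdef
  have hJle : (J : ℝ) ≤ 2 * δ / h := Nat.floor_le (by positivity)
  have hJs : (J : ℝ) * (h / 2) ≤ δ := by
    rw [le_div_iff₀ hh] at hJle
    linarith
  have hδh : 20 ≤ δ / h := by
    rw [le_div_iff₀ hh]
    linarith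
  have hJge : δ / h ≤ J := by
    have h1 := Nat.lt_floor_add_one (2 * δ / h)
    rw [← hJdef, mul_div_assoc] at h1
    linarith
  have hJ20 : 20 ≤ J := by exact_mod_cast hδh.trans hJge
  set P : ι → ℝ := fun i => filterSymbol J (h / 2 * ω i) with hP
  set y : ℝ → ℂ := shiftFilter J (h / 2) g with hy
  have hyc : Continuous y := continuous_shiftFilter J _ hgc
  set Z : Finset ι := Finset.univ.filter fun i => (ω i * h) ^ 2 ≤ 4 with hZ
  have hwave : ∀ i t, d i * ((P i : ℂ) * modeWave ω A B i t) =
      modeWave ω (fun i => d i * P i * A i) (fun i => d i * P i * B i) i t := by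
    intro i t
    simp only [modeWave]
    ring
  set yZ : ℝ → ℂ := fun t => ∑ i ∈ Z, d i * (P i * modeWave ω A B i t) with hyZ
  set yH : ℝ → ℂ := fun t => ∑ i ∈ Zᶜ, d i * (P i * modeWave ω A B i t) with hyH
  have hyZc : Continuous yZ := continuous_finsetSum _ fun i _ =>
    continuous_const.mul (continuous_const.mul (continuous_modeWave ω A B i))
  have hsplit : ∀ t, y t = yZ t + yH t := by
    intro t
    rw [hy, hg, shiftFilter_sum_modeWave, hyZ, hyH]
    exact (Finset.sum_add_sum_compl Z _).symm
  have hyHb : ∀ t, ‖yH t‖ ^ 2 ≤ 30 * h / δ ^ 2 * 𝓔 := by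
    intro t
    refine (hS.norm_high_filtered_sq_le hJ20 A B Zᶜ (fun i hi => ?_) t).trans ?_
    · simpa [hZ] using hi
    · refine mul_le_mul_of_nonneg_right ?_ h𝓔0
      calc 30 / (h * (J : ℝ) ^ 2) ≤ 30 / (h * (δ / h) ^ 2) := by gcongr
        _ = 30 * h / δ ^ 2 := by field_simp
  have hyint : ∫ t in δ..(T - δ), ‖y t‖ ^ 2 ≤ ∫ t in (0 : ℝ)..T, ‖g t‖ ^ 2 :=
    integral_norm_shiftFilter_sq_le (by positivity) hJs (by rw [hδ]; linarith) hgc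
  -- The interval `[δ, T - δ]` has length `2τ = (T + 2)/2`, still larger than 2.
  have hing := hS.ingham Z (fun i hi => by simpa [hZ] using hi) hτ1 (T / 2)
    (fun i => d i * P i * A i) (fun i => d i * P i * B i)
  simp only [← hwave] at hing
  rw [← hκ, show T / 2 - τ = δ by rw [hδ, hτ]; ring, show T / 2 + τ = T - δ by rw [hδ, hτ]; ring]
    at hing
  -- The constant is `6000 · 50 · 100`, from the low-energy fraction, the trace bound and the square
  -- of the filter bound `1/10`.
  have hcoef : 1 / 30000000 * 𝓔 ≤
      ∑ i ∈ Z, (‖d i * P i * A i‖ ^ 2 + ‖d i * P i * B i‖ ^ 2) := by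
    have hterm : ∀ i ∈ Finset.univ.filter (fun i => (ω i * h) ^ 2 ≤ 5 / 2),
        1 / 5000 * (ω i ^ 2 * (‖A i‖ ^ 2 + ‖B i‖ ^ 2)) ≤
          ‖d i * P i * A i‖ ^ 2 + ‖d i * P i * B i‖ ^ 2 := by
      intro i hi
      have hi' : (ω i * h) ^ 2 ≤ 5 / 2 := by simpa using hi
      have hd := hS.trace_lower i hi'
      have hPi := (hS.filterSymbol_bounds hJ20 i).1 hi'
      have hP2 : 1 / 100 ≤ ‖(P i : ℂ)‖ ^ 2 := by
        rw [Complex.norm_real, Real.norm_eq_abs, sq_abs]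
        have : (1 / 10 : ℝ) ^ 2 ≤ P i ^ 2 := pow_le_pow_left₀ (by norm_num) hPi 2
        linarith
      simp only [norm_mul, mul_pow]
      calc 1 / 5000 * (ω i ^ 2 * (‖A i‖ ^ 2 + ‖B i‖ ^ 2))
          = (ω i ^ 2 / 50) * (1 / 100) * (‖A i‖ ^ 2 + ‖B i‖ ^ 2) := by ring
        _ ≤ ‖d i‖ ^ 2 * ‖(P i : ℂ)‖ ^ 2 * (‖A i‖ ^ 2 + ‖B i‖ ^ 2) := by gcongr
        _ = _ := by ring
    calc 1 / 30000000 * 𝓔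
        ≤ ∑ i with (ω i * h) ^ 2 ≤ 5 / 2, 1 / 5000 * (ω i ^ 2 * (‖A i‖ ^ 2 + ‖B i‖ ^ 2)) := by
          rw [← Finset.mul_sum]
          linarith
      _ ≤ ∑ i with (ω i * h) ^ 2 ≤ 5 / 2, (‖d i * P i * A i‖ ^ 2 + ‖d i * P i * B i‖ ^ 2) :=
          Finset.sum_le_sum hterm
      _ ≤ _ := by
          refine Finset.sum_le_sum_of_subset_of_nonneg ?_ fun i _ _ => by positivity
          intro i hi
          simp only [hZ, Finset.mem_filter, Finset.mem_univ, true_and] at hi ⊢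
          linarith
  have hyZint : ∫ t in δ..(T - δ), ‖yZ t‖ ^ 2 ≤
      2 * (∫ t in δ..(T - δ), ‖y t‖ ^ 2) + T * (2 * (30 * h / δ ^ 2 * 𝓔)) := by
    calc ∫ t in δ..(T - δ), ‖yZ t‖ ^ 2
        ≤ ∫ t in δ..(T - δ), (2 * ‖y t‖ ^ 2 + 2 * (30 * h / δ ^ 2 * 𝓔)) := by
          refine intervalIntegral.integral_mono_on (by rw [hδ]; linarith) ?_ ?_ fun t _ => ?_
          · exact (hyZc.norm.pow 2).intervalIntegrable _ _
          · apply Continuous.intervalIntegrable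
            fun_prop
          · have h1 : yZ t = y t - yH t := by rw [hsplit]; ring
            have h2 := norm_sub_le (y t) (yH t)
            rw [← h1] at h2
            nlinarith [hyHb t, sq_nonneg (‖y t‖ - ‖yH t‖), norm_nonneg (yZ t)]
      _ = 2 * (∫ t in δ..(T - δ), ‖y t‖ ^ 2) + (T - δ - δ) * (2 * (30 * h / δ ^ 2 * 𝓔)) := by
          rw [intervalIntegral.integral_add, intervalIntegral.integral_const_mul,
            intervalIntegral.integral_const, smul_eq_mul]
          · apply Continuous.intervalIntegrable
            fun_prop
          · exact intervalIntegrable_const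
      _ ≤ _ := by
          gcongr
          linarith
  -- Smallness of `h` makes the high-frequency remainder at most half of the left side, so it can be
  -- absorbed.
  have hfin : κ * (1 / 30000000 * 𝓔) ≤
      2 * (∫ t in (0 : ℝ)..T, ‖g t‖ ^ 2) + κ / 60000000 * 𝓔 := by
    have h1 := mul_le_mul_of_nonneg_left hcoef hκ0.le
    have h2 := mul_le_mul_of_nonneg_right hsmall h𝓔0
    have h3 : T * (2 * (30 * h / δ ^ 2 * 𝓔)) = 60 * T * h / δ ^ 2 * 𝓔 := by ring
    linarith
  rw [div_mul_eq_mul_div, le_div_iff₀ hκ0]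
  linarith

/-- Observability on a fixed mesh. -/
theorem exists_observability (hS : SpectralTrace h ω d) {T : ℝ} (hT : 0 < T) :
    ∃ C : ℝ, 0 ≤ C ∧ ∀ A B : ι → ℂ,
      modalEnergy ω A B ≤ 6000 * ∑ i with (ω i * h) ^ 2 ≤ 5 / 2,
        ω i ^ 2 * (‖A i‖ ^ 2 + ‖B i‖ ^ 2) →
      modalEnergy ω A B ≤ C * ∫ t in (0 : ℝ)..T, ‖∑ i, d i * modeWave ω A B i t‖ ^ 2 := by
  classical
  have hex : ∀ p : ι × Bool, ∃ C : ℝ, 0 < C ∧ ((ω p.1 * h) ^ 2 ≤ 5 / 2 → ∀ A B : ι → ℂ,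
      ‖signedCoeff (fun i => d i * A i) (fun i => d i * B i) p‖ ^ 2 ≤
        C * ∫ t in (0 : ℝ)..T, ‖∑ i, d i * modeWave ω A B i t‖ ^ 2) := by
    intro p
    by_cases hp : (ω p.1 * h) ^ 2 ≤ 5 / 2
    -- A low frequency differs from all the others. High frequencies may coincide among themselves,
    -- but no amplitude needs to be recovered there.
    · have hne : ∀ q ∈ Finset.univ.erase p, signedFreq ω q ≠ signedFreq ω p := by
        intro q hq hqp
        refine Finset.ne_of_mem_erase hq ?_
        obtain ⟨i, b⟩ := p
        obtain ⟨j, b'⟩ := q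
        have h1 := hS.freq_pos i
        have h2 := hS.freq_pos j
        have h3 := hS.simple i j (by linarith)
        cases b <;> cases b' <;>
          simp only [signedFreq, if_true, if_false, Bool.false_eq_true] at hqp
        · rw [h3 (by linarith)]
        · linarith
        · linarith
        · rw [h3 (by linarith)]
      obtain ⟨C, hC, hCa⟩ := exists_norm_coeff_sq_le (signedFreq ω) p (Finset.univ.erase p) hne T hT
      refine ⟨C, hC, fun _ A B => (hCa _).trans (le_of_eq ?_)⟩
      congr 2
      funext t
      congr 2
      rw [Finset.add_sum_erase _ (fun q => signedCoeff (fun i => d i * A i) (fun i => d i * B i) q *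
        exp (I * signedFreq ω q * t)) (Finset.mem_univ p), ← Finset.univ_product_univ, sum_signed_exp]
      refine Finset.sum_congr rfl fun i _ => ?_
      simp only [modeWave]
      ring
    · exact ⟨1, one_pos, fun h => absurd h hp⟩
  choose C hC0 hC using hex
  refine ⟨6000 * ∑ i, 50 * (C (i, true) + C (i, false)), ?_, fun A B hlow => ?_⟩
  · have : 0 ≤ ∑ i, 50 * (C (i, true) + C (i, false)) := Finset.sum_nonneg fun i _ => by
      have := hC0 (i, true)
      have := hC0 (i, false)
      positivity
    positivity
  · set Q := ∫ t in (0 : ℝ)..T, ‖∑ i, d i * modeWave ω A B i t‖ ^ 2 with hQ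
    have hQ0 : 0 ≤ Q := intervalIntegral.integral_nonneg hT.le fun t _ => sq_nonneg _
    refine hlow.trans ?_
    rw [mul_assoc]
    refine mul_le_mul_of_nonneg_left ?_ (by norm_num)
    rw [Finset.sum_mul]
    calc ∑ i with (ω i * h) ^ 2 ≤ 5 / 2, ω i ^ 2 * (‖A i‖ ^ 2 + ‖B i‖ ^ 2)
        ≤ ∑ i with (ω i * h) ^ 2 ≤ 5 / 2, 50 * (C (i, true) + C (i, false)) * Q := by
          refine Finset.sum_le_sum fun i hi => ?_
          have hi' : (ω i * h) ^ 2 ≤ 5 / 2 := by simpa using hi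
          have hd := hS.trace_lower i hi'
          have hA := hC (i, true) hi' A B
          have hB := hC (i, false) hi' A B
          simp only [signedCoeff, if_true, if_false, Bool.false_eq_true, norm_mul, mul_pow] at hA hB
          calc ω i ^ 2 * (‖A i‖ ^ 2 + ‖B i‖ ^ 2)
              = 50 * (ω i ^ 2 / 50 * (‖A i‖ ^ 2 + ‖B i‖ ^ 2)) := by ring
            _ ≤ 50 * (‖d i‖ ^ 2 * (‖A i‖ ^ 2 + ‖B i‖ ^ 2)) := by gcongr
            _ ≤ _ := by linarith
      _ ≤ _ := by
          refine Finset.sum_le_sum_of_subset_of_nonneg (Finset.filter_subset _ _) fun i _ _ => ?_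
          have := hC0 (i, true)
          have := hC0 (i, false)
          positivity

end SpectralTrace

end SpectralObservability

end QuadFEM

namespace QuadFEM

/-! ### From spectral data to the semi-discrete wave equation. -/

section Observability

variable {N : ℕ} {E : Matrix (Fin (2 * N + 1)) (Fin (2 * N + 1)) ℂ} {ev : Fin (2 * N + 1) → ℝ}

theorem halfVal_mulVec (E : Matrix (Fin (2 * N + 1)) (Fin (2 * N + 1)) ℂ) (z : DiscreteVec N)
    (p : ℕ) : halfVal N (E *ᵥ z) p = ∑ i, halfVal N (fun j => E j i) p * z i := by
  unfold halfVal
  split_ifs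
  · rfl
  · simp

/-- The boundary trace of mode `i`. -/
noncomputable def modeTrace (N : ℕ) (E : Matrix (Fin (2 * N + 1)) (Fin (2 * N + 1)) ℂ)
    (i : Fin (2 * N + 1)) : ℂ :=
  halfVal N (fun j => E j i) (2 * N) / meshSize N

theorem sum_modeTrace_mul (E : Matrix (Fin (2 * N + 1)) (Fin (2 * N + 1)) ℂ) (z : DiscreteVec N) :
    ∑ i, modeTrace N E i * z i = halfVal N (E *ᵥ z) (2 * N) / meshSize N := by
  rw [halfVal_mulVec, Finset.sum_div]
  refine Finset.sum_congr rfl fun i _ => ?_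
  rw [modeTrace]
  ring

theorem sq_sqrt_ev_mul (h : IsModalBasis N E ev) (i : Fin (2 * N + 1)) :
    (√(ev i) * meshSize N) ^ 2 = ev i * meshSize N ^ 2 := by
  rw [mul_pow, Real.sq_sqrt (h.ev_pos i).le]

theorem IsModalBasis.spectralTrace (h : IsModalBasis N E ev) :
    SpectralTrace (meshSize N) (fun i => √(ev i)) (modeTrace N E) where
  mesh_pos := meshSize_pos N
  freq_pos i := Real.sqrt_pos.mpr (h.ev_pos i)
  freq_le i := by
    rw [sq_sqrt_ev_mul h]
    exact h.ev_le i
  wave_number i hi := by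
    rw [sq_sqrt_ev_mul h] at hi ⊢
    obtain ⟨_, m, _, _, _, hm, _⟩ := low_eigenvector (h.col_ne_zero i)
      (mul_pos (h.ev_pos i) (pow_pos (meshSize_pos N) 2)) hi (h.eigen_col i)
    exact ⟨m, hm⟩
  simple i j hi hij := by
    rw [sq_sqrt_ev_mul h] at hi
    exact h.eq_of_ev_eq hi ((Real.sqrt_inj (h.ev_pos i).le (h.ev_pos j).le).mp hij)
  trace_lower i hi := by
    rw [sq_sqrt_ev_mul h] at hi
    rw [Real.sq_sqrt (h.ev_pos i).le]
    exact h.le_trace_sq hi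
  trace_upper z := by
    have hh := meshSize_pos N
    have h1 := halfVal_sq_le_massForm (E *ᵥ z) (2 * N)
    rw [h.massForm_mulVec] at h1
    rw [sum_modeTrace_mul, norm_div, Complex.norm_real, Real.norm_of_nonneg hh.le, div_pow,
      div_le_iff₀ (by positivity)]
    calc ‖halfVal N (E *ᵥ z) (2 * N)‖ ^ 2
        = 15 / meshSize N * (meshSize N / 15 * ‖halfVal N (E *ᵥ z) (2 * N)‖ ^ 2) := by field_simp
      _ ≤ 15 / meshSize N * ∑ i, ‖z i‖ ^ 2 := by gcongr
      _ = _ := by field_simp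

theorem obsNormSq_eq (hN : 1 ≤ N) (F : DiscreteVec N) :
    obsNormSq N F = ‖halfVal N F (2 * N) / meshSize N‖ ^ 2 := by
  have hlast : halfVal N F (2 * N) = F ⟨2 * N - 1, by omega⟩ := by
    rw [halfVal, dif_pos ⟨by omega, by omega⟩]
  have hrow : ∀ i : Fin (2 * N + 1), (obsMatrix N *ᵥ F) i =
      if i = Fin.last (2 * N) then -(1 / meshSize N : ℝ) * F ⟨2 * N - 1, by omega⟩ else 0 := by
    intro i
    show ∑ j, obsMatrix N i j * F j = _
    by_cases hi : i = Fin.last (2 * N)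
    · rw [if_pos hi, Finset.sum_eq_single ⟨2 * N - 1, by omega⟩]
      · rw [obsMatrix, Matrix.of_apply, if_pos]
        · push_cast
          ring
        · subst hi
          exact ⟨rfl, by simp only; omega⟩
      · intro j _ hj
        rw [obsMatrix, Matrix.of_apply, if_neg, zero_mul]
        rintro ⟨_, h2⟩
        exact hj (Fin.ext (by simp only; omega))
      · intro h
        exact absurd (Finset.mem_univ _) h
    · rw [if_neg hi]
      refine Finset.sum_eq_zero fun j _ => ?_
      rw [obsMatrix, Matrix.of_apply, if_neg, zero_mul]
      rintro ⟨h1, _⟩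
      exact hi (Fin.ext (by simp only [Fin.val_last]; omega))
  rw [obsNormSq, EuclideanSpace.norm_sq_eq, Finset.sum_eq_single (Fin.last (2 * N))]
  · simp only [hrow, if_true]
    rw [hlast, norm_mul, norm_neg, norm_div, Complex.norm_real, Complex.norm_real, norm_div,
      norm_one]
    ring
  · intro i _ hi
    simp only [hrow, if_neg hi, norm_zero]
    norm_num
  · intro h
    exact absurd (Finset.mem_univ _) h

theorem hasDerivAt_mulVec {n : Type*} [Fintype n] (A : Matrix n n ℂ) {U : ℝ → n → ℂ} {V : n → ℂ}
    {t : ℝ} (hU : HasDerivAt U V t) (i : n) :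
    HasDerivAt (fun t => (A *ᵥ U t) i) ((A *ᵥ V) i) t :=
  HasDerivAt.fun_sum fun j _ => (hasDerivAt_pi.mp hU j).const_mul (A i j)

/-- Modal decomposition of the solutions of the adjoint problem. -/
theorem IsAdjointSolution.exists_modal (h : IsModalBasis N E ev) {T : ℝ} {U0 U1 : DiscreteVec N}
    {U : ℝ → DiscreteVec N} (hU : IsAdjointSolution N T U0 U1 U) :
    ∃ A B : Fin (2 * N + 1) → ℂ,
      (∀ t, U t = E *ᵥ fun i => modeWave (fun i => √(ev i)) A B i t) ∧
      ∀ i, ev i * ‖(Eᴴ *ᵥ (massMatrix N *ᵥ U0)) i‖ ^ 2 +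
        ‖(Eᴴ *ᵥ (massMatrix N *ᵥ U1)) i‖ ^ 2 =
          2 * (√(ev i) ^ 2 * (‖A i‖ ^ 2 + ‖B i‖ ^ 2)) := by
  have hcoef : ∀ (F : DiscreteVec N) i,
      (Eᴴ *ᵥ (massMatrix N *ᵥ F)) i = ((Eᴴ * massMatrix N) *ᵥ F) i := fun F i => by
    rw [Matrix.mulVec_mulVec]
  -- Applying `Eᴴ` to the equation decouples it: each coefficient of `U` in the modal basis is a
  -- harmonic oscillator of frequency `√(ev i)`.
  have hex : ∀ i, ∃ A B : ℂ, ∀ t : ℝ,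
      (Eᴴ *ᵥ (massMatrix N *ᵥ U t)) i = A * Complex.exp (Complex.I * (√(ev i) : ℝ) * t) +
        B * Complex.exp (Complex.I * ((-√(ev i) : ℝ) : ℂ) * t) ∧
      (Eᴴ *ᵥ (massMatrix N *ᵥ deriv U t)) i =
        Complex.I * (√(ev i) : ℝ) * (A * Complex.exp (Complex.I * (√(ev i) : ℝ) * t) -
          B * Complex.exp (Complex.I * ((-√(ev i) : ℝ) : ℂ) * t)) := by
    intro i
    have hd1 : ∀ t, HasDerivAt (fun t => (Eᴴ *ᵥ (massMatrix N *ᵥ U t)) i)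
        ((Eᴴ *ᵥ (massMatrix N *ᵥ deriv U t)) i) t := by
      intro t
      simp only [hcoef]
      exact hasDerivAt_mulVec _ (hU.differentiable t).hasDerivAt i
    have hd2 : ∀ t, HasDerivAt (fun t => (Eᴴ *ᵥ (massMatrix N *ᵥ deriv U t)) i)
        (-(((√(ev i) : ℝ) : ℂ) ^ 2) * (Eᴴ *ᵥ (massMatrix N *ᵥ U t)) i) t := by
      intro t
      have h1 : HasDerivAt (fun t => (Eᴴ *ᵥ (massMatrix N *ᵥ deriv U t)) i)
          ((Eᴴ *ᵥ (massMatrix N *ᵥ deriv (deriv U) t)) i) t := by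
        simp only [hcoef]
        exact hasDerivAt_mulVec _ (hU.differentiable_deriv t).hasDerivAt i
      refine h1.congr_deriv ?_
      rw [eq_neg_of_add_eq_zero_left (hU.equation t), Matrix.mulVec_neg, Pi.neg_apply,
        h.coeff_stiff, ← Complex.ofReal_pow, Real.sq_sqrt (h.ev_pos i).le]
      ring
    exact exists_harmonic_coeffs (Real.sqrt_pos.mpr (h.ev_pos i)) hd1 hd2
  choose A B hAB using hex
  refine ⟨A, B, fun t => ?_, fun i => ?_⟩
  · rw [← h.mulVec_coeff (U t)]
    congr 1
    funext i
    exact (hAB i t).1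
  · have h1 := (hAB i T).1
    have h2 := (hAB i T).2
    rw [hU.position_final] at h1
    rw [hU.velocity_final] at h2
    have h3 : ev i = √(ev i) ^ 2 := (Real.sq_sqrt (h.ev_pos i).le).symm
    rw [h1, h2]
    nth_rw 1 [h3]
    rw [harmonic_energy]
    have hn : ∀ (z : ℂ) (x : ℝ), ‖z * Complex.exp (Complex.I * x * T)‖ = ‖z‖ := fun z x => by
      rw [norm_mul, norm_exp_I_mul, mul_one]
    rw [hn, hn]

/-- Reduction of the observability of bi-grid data to its modal coefficients. -/
theorem IsAdjointSolution.modal_reduction {n : ℕ}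
    {E : Matrix (Fin (2 * (2 * n + 1) + 1)) (Fin (2 * (2 * n + 1) + 1)) ℂ}
    {ev : Fin (2 * (2 * n + 1) + 1) → ℝ} (h : IsModalBasis (2 * n + 1) E ev) {T : ℝ}
    {U0 U1 : DiscreteVec (2 * n + 1)} {U : ℝ → DiscreteVec (2 * n + 1)}
    (hU : IsAdjointSolution (2 * n + 1) T U0 U1 U) (hdata : (U0, U1) ∈ dataSpace (2 * n + 1)) :
    ∃ A B : Fin (2 * (2 * n + 1) + 1) → ℂ,
      energy (2 * n + 1) U0 U1 = modalEnergy (fun i => √(ev i)) A B ∧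
      (∀ t, obsNormSq (2 * n + 1) (U t) =
        ‖∑ i, modeTrace (2 * n + 1) E i * modeWave (fun i => √(ev i)) A B i t‖ ^ 2) ∧
      modalEnergy (fun i => √(ev i)) A B ≤
        6000 * ∑ i with (√(ev i) * meshSize (2 * n + 1)) ^ 2 ≤ 5 / 2,
          √(ev i) ^ 2 * (‖A i‖ ^ 2 + ‖B i‖ ^ 2) := by
  obtain ⟨A, B, hUt, hAB⟩ := hU.exists_modal h
  obtain ⟨⟨hl0, hb0⟩, ⟨hl1, hb1⟩⟩ := hdata
  have hE : energy (2 * n + 1) U0 U1 = modalEnergy (fun i => √(ev i)) A B := by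
    rw [energy_eq, h.stiffForm_eq, h.massForm_eq, ← Finset.sum_add_distrib,
      Finset.sum_congr rfl fun i _ => hAB i, ← Finset.mul_sum, modalEnergy]
    ring
  refine ⟨A, B, hE, fun t => ?_, ?_⟩
  · rw [obsNormSq_eq (by omega), hUt t, ← sum_modeTrace_mul]
  · rw [← hE, energy_eq]
    have hset : (Finset.univ.filter fun i => (√(ev i) * meshSize (2 * n + 1)) ^ 2 ≤ 5 / 2) =
        lowModes (2 * n + 1) ev := by
      ext i
      simp only [Finset.mem_filter, Finset.mem_univ, true_and]
      rw [sq_sqrt_ev_mul h, mem_lowModes]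
    -- Position and velocity are bounded separately, with constants 100 and 6000; the larger one
    -- serves for both.
    have hs := h.stiffForm_bigrid_le_low hl0 hb0
    have hm := h.massForm_bigrid_le_low hl1 hb1
    have hpos : 0 ≤ ∑ i ∈ lowModes (2 * n + 1) ev,
        ev i * ‖(Eᴴ *ᵥ (massMatrix (2 * n + 1) *ᵥ U0)) i‖ ^ 2 :=
      Finset.sum_nonneg fun i _ => mul_nonneg (h.ev_pos i).le (sq_nonneg _)
    have hsum : ∑ i ∈ lowModes (2 * n + 1) ev,
          ev i * ‖(Eᴴ *ᵥ (massMatrix (2 * n + 1) *ᵥ U0)) i‖ ^ 2 +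
        ∑ i ∈ lowModes (2 * n + 1) ev, ‖(Eᴴ *ᵥ (massMatrix (2 * n + 1) *ᵥ U1)) i‖ ^ 2 =
        2 * ∑ i ∈ lowModes (2 * n + 1) ev, √(ev i) ^ 2 * (‖A i‖ ^ 2 + ‖B i‖ ^ 2) := by
      rw [← Finset.sum_add_distrib, Finset.sum_congr rfl fun i _ => hAB i, ← Finset.mul_sum]
    rw [hset]
    linarith

/-- Observability on a fixed mesh. -/
theorem exists_observability_constant (n : ℕ) {T : ℝ} (hT : 0 < T) :
    ∃ C : ℝ, 0 ≤ C ∧ ∀ U0 U1 : DiscreteVec (2 * n + 1), (U0, U1) ∈ dataSpace (2 * n + 1) →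
      ∀ U, IsAdjointSolution (2 * n + 1) T U0 U1 U → energy (2 * n + 1) U0 U1 ≤
        C * ∫ t in (0 : ℝ)..T, obsNormSq (2 * n + 1) (U t) := by
  obtain ⟨E, ev, h⟩ := exists_modalBasis (2 * n + 1)
  obtain ⟨C, hC0, hC⟩ := h.spectralTrace.exists_observability hT
  refine ⟨C, hC0, fun U0 U1 hdata U hU => ?_⟩
  obtain ⟨A, B, hE, hobs, hlow⟩ := hU.modal_reduction h hdata
  simp only [hE, hobs]
  exact hC A B hlow

/-- Observability with a constant that does not depend on the mesh, for fine meshes. -/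
theorem exists_uniform_observability_constant {T : ℝ} (hT : 2 < T) :
    ∃ (C : ℝ) (n₀ : ℕ), 0 < C ∧ ∀ n, n₀ ≤ n → ∀ U0 U1 : DiscreteVec (2 * n + 1),
      (U0, U1) ∈ dataSpace (2 * n + 1) →
      ∀ U, IsAdjointSolution (2 * n + 1) T U0 U1 U → energy (2 * n + 1) U0 U1 ≤
        C * ∫ t in (0 : ℝ)..T, obsNormSq (2 * n + 1) (U t) := by
  set δ : ℝ := (T - 2) / 4 with hδ
  set τ : ℝ := (T + 2) / 4 with hτ
  set κ : ℝ := 4 / Real.pi * (τ - 1 / τ) with hκ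
  have hpi := Real.pi_pos
  have hδ0 : 0 < δ := by rw [hδ]; linarith
  have hτ1 : 1 < τ := by rw [hτ]; linarith
  have hκ0 : 0 < κ := by
    have : 1 / τ < 1 := by rw [div_lt_one (by linarith)]; exact hτ1
    have h1 : 0 < τ - 1 / τ := by linarith
    positivity
  have hT0 : 0 < T := by linarith
  -- The two entries are exactly the two smallness conditions of `SpectralTrace.observability`.
  set b : ℝ := min (δ / 20) (κ / 60000000 * δ ^ 2 / (60 * T)) with hb
  have hb0 : 0 < b := lt_min (by positivity) (by positivity)
  obtain ⟨n₀, hn₀⟩ := exists_nat_gt (1 / b)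
  refine ⟨120000000 / κ, n₀, by positivity, fun n hn U0 U1 hdata U hU => ?_⟩
  obtain ⟨E, ev, h⟩ := exists_modalBasis (2 * n + 1)
  obtain ⟨A, B, hE, hobs, hlow⟩ := hU.modal_reduction h hdata
  have hmesh : meshSize (2 * n + 1) ≤ b := by
    have h1 : (n₀ : ℝ) ≤ n := by exact_mod_cast hn
    have h2 : 1 / b ≤ ((2 * n + 1 : ℕ) : ℝ) + 1 := by
      push_cast
      linarith [(Nat.cast_nonneg n : (0 : ℝ) ≤ n)]
    rw [meshSize, div_le_iff₀ (by positivity)]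
    rw [div_le_iff₀ hb0] at h2
    linarith
  simp only [hE, hobs]
  refine h.spectralTrace.observability hT A B hlow hδ hτ hκ (hmesh.trans (min_le_left _ _)) ?_
  have h3 := hmesh.trans (min_le_right _ _)
  rw [le_div_iff₀ (by positivity)] at h3
  rw [div_le_iff₀ (by positivity)]
  linarith

end Observability

end QuadFEM

theorem mainTheorem3 (T : ℝ) (hT : 2 < T) :
    ∃ C : ℝ, 0 < C ∧ ∀ N : ℕ, Odd N → ∀ U0 U1 : QuadFEM.DiscreteVec N,
      (U0, U1) ∈ QuadFEM.dataSpace N →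
      ∀ U : ℝ → QuadFEM.DiscreteVec N, QuadFEM.IsAdjointSolution N T U0 U1 U →
        QuadFEM.energy N U0 U1 ≤ C * ∫ t in (0 : ℝ)..T, QuadFEM.obsNormSq N (U t) := by
  have hT0 : 0 < T := by linarith
  obtain ⟨C₁, n₀, hC₁, hlarge⟩ := QuadFEM.exists_uniform_observability_constant hT
  choose C hC0 hC using fun n => QuadFEM.exists_observability_constant n hT0
  have hsum : 0 ≤ ∑ n ∈ Finset.range n₀, C n := Finset.sum_nonneg fun n _ => hC0 n
  -- One constant covers all fine meshes. The sum dominates each constant of the finitely many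
  -- coarse ones and depends only on `T`.
  refine ⟨C₁ + ∑ n ∈ Finset.range n₀, C n, by linarith, fun N hN => ?_⟩
  obtain ⟨n, rfl⟩ := hN
  intro U0 U1 hdata U hU
  have hI : 0 ≤ ∫ t in (0 : ℝ)..T, QuadFEM.obsNormSq (2 * n + 1) (U t) :=
    intervalIntegral.integral_nonneg hT0.le fun t _ => sq_nonneg _
  rcases Nat.lt_or_ge n n₀ with hn | hn
  · refine (hC n U0 U1 hdata U hU).trans (mul_le_mul_of_nonneg_right ?_ hI)
    have := Finset.single_le_sum (fun n _ => hC0 n) (Finset.mem_range.mpr hn)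
    linarith
  · refine (hlarge n hn U0 U1 hdata U hU).trans (mul_le_mul_of_nonneg_right ?_ hI)
    linarith
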